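/- **Conventions.** A cube complex is a complex of unit cubes in which cubes are embedded and two cubes that meet intersect in a common face. It is *CAT(0)* if it is simply connected and the link of each vertex is a flag simplicial complex, and *finite-dimensional* if the dimensions of its cubes are bounded. It carries its piecewise Euclidean length metric. The median of three points of a CAT(0) cube complex $C$ is the point $\mu_C(a,b,c)$ lying between any two of them for the piecewise $\ell^1$ length metric of $C$ (on the vertices of $C$, this is the median of the median graph $C^{(1)}$). A graph is *median* if it is connected and any three vertices $x_1,x_2,x_3$ have a unique median, i.e. a vertex $p$ with $d(x_i,x_j)=d(x_i,p)+d(p,x_j)$ for $i\ne j$. A *coarse median space* is a metric space $(X,d)$ with a map $m:X^3\to X$ for which there is a function $h:\mathbb N\to[0,\infty)$ such that - $d(m(x,y,z),m(x',y',z'))\le h(1)\,(d(x,x')+d(y,y')+d(z,z')+1)$ for all $x,y,z,x',y',z'\in X$; - for all $n\in\mathbb N$ and all $A\subset X$ with $|A|\le n$ there are a finite median graph with vertex set $V$ and median $m_V$, and maps $f:A\to V$, $g:V\to X$, such that $d(g\,m_V(x,y,z),m(g(x),g(y),g(z)))\le h(n)$ for all $x,y,z\in V$ and $d(a,gf(a))\le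 h(n)$ for all $a\in A$. A metric space $X$ is *coarsely connected* if for some $r>0$ any two points of $X$ are joined by a finite sequence of points with consecutive distances at most $r$. A map $\Phi:X\to Y$ of metric spaces is a *quasiisometric embedding* if there are $L\ge1$, $A\ge0$ with $L^{-1}d_X(x,x')-A\le d_Y(\Phi(x),\Phi(x'))\le L\,d_X(x,x')+A$ for all $x,x'\in X$; it is a *quasiisometry* if moreover for some $B$ every point of $Y$ is within $B$ of $\Phi(X)$. A map $\Phi$ from a coarse median space $(X,d,m)$ to a CAT(0) cube complex $C$ is *quasimedian* if for some $D$ one has $d_C\big(\Phi(m(x,y,z)),\mu_C(\Phi(x),\Phi(y),\Phi(z))\big)\le D$ for all $x,y,z\in X$. **Proposition.** Let $(X,d,m)$ be a coarsely connected coarse median space. If there is a quasimedian quasiisometric embedding $\Phi$ of $X$ in a finite-dimensional CAT(0) cube complex $C$, then there is a quasiisometry from $X$ to a (possibly different) finite-dimensional CAT(0) cube complex. -/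

import Mathlib

universe u v

/-! ### Coarse geometry

Distances are passed as explicit functions, because a cube complex below carries both a Euclidean
and an `ℓ¹` length metric. -/

/-- `f` is an `(L, A)`-quasiisometric embedding for some `L ≥ 1` and `A ≥ 0`. -/
def IsQuasiisometricEmbedding {X Y : Type*} (dX : X → X → ℝ) (dY : Y → Y → ℝ) (f : X → Y) : Prop :=
  ∃ L A : ℝ, 1 ≤ L ∧ 0 ≤ A ∧
    ∀ x x' : X, L⁻¹ * dX x x' - A ≤ dY (f x) (f x') ∧ dY (f x) (f x') ≤ L * dX x x' + A

/-- A quasiisometry is a quasiisometric embedding that is coarsely onto. -/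
def IsQuasiisometry {X Y : Type*} (dX : X → X → ℝ) (dY : Y → Y → ℝ) (f : X → Y) : Prop :=
  IsQuasiisometricEmbedding dX dY f ∧ ∃ B : ℝ, ∀ y : Y, ∃ x : X, dY (f x) y ≤ B

/-- There is `r > 0` such that any two points of `X` are joined by a finite sequence of points with
consecutive distances at most `r`. -/
def IsCoarselyConnected (X : Type*) [MetricSpace X] : Prop :=
  ∃ r : ℝ, 0 < r ∧ ∀ x y : X, Relation.ReflTransGen (fun a b : X => dist a b ≤ r) x y

/-! ### Medians -/

/-- `p` is a median of `a, b, c` for the distance `d`: it lies between any two of them. -/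
def IsMedianPoint {α : Type*} (d : α → α → ℝ) (a b c p : α) : Prop :=
  d a b = d a p + d p b ∧ d b c = d b p + d p c ∧ d a c = d a p + d p c

/-- The combinatorial distance of a graph, as a real number. -/
noncomputable def graphDist {V : Type*} (G : SimpleGraph V) (u v : V) : ℝ := (G.dist u v : ℝ)

/-- A median graph: a connected graph in which any three vertices have a unique median. -/
def IsMedianGraph {V : Type*} (G : SimpleGraph V) : Prop :=
  G.Connected ∧ ∀ a b c : V, ∃! p : V, IsMedianPoint (graphDist G) a b c p

/-- `m` is a coarse median on the metric space `X`. The finite discrete median algebras are the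
vertex sets of finite median graphs `G`, with the median of `G` as operation. -/
def IsCoarseMedian {X : Type*} [MetricSpace X] (m : X → X → X → X) : Prop :=
  ∃ h : ℕ → ℝ, (∀ n, 0 ≤ h n) ∧
    (∀ x y z x' y' z' : X,
      dist (m x y z) (m x' y' z') ≤ h 1 * (dist x x' + dist y y' + dist z z' + 1)) ∧
    ∀ (n : ℕ) (A : Finset X), A.card ≤ n →
      ∃ (V : Type) (_ : Finite V) (G : SimpleGraph V) (f : A → V) (g : V → X),
        IsMedianGraph G ∧
        (∀ x y z p : V, IsMedianPoint (graphDist G) x y z p →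
          dist (g p) (m (g x) (g y) (g z)) ≤ h n) ∧
        ∀ a : A, dist (a : X) (g (f a)) ≤ h n

/-! ### Cube complexes -/

/-- The vertex set of the face of the cube `[0,1]ⁿ` on which the coordinates `i` with
`σ i = some b` are fixed to be `b`. -/
def cubeFace {n : ℕ} (σ : Fin n → Option Bool) : Set (Fin n → Bool) :=
  {x | ∀ i b, σ i = some b → x i = b}

/-- `φ` identifies the vertices of `[0,1]ⁿ` with a set of vertices in such a way that the members of
`cubes` contained in that set are exactly the (vertex sets of) faces of `[0,1]ⁿ`. -/
def IsCubeChart {V : Type*} (cubes : Set (Set V)) {n : ℕ} (φ : (Fin n → Bool) → V) : Prop :=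
  Function.Injective φ ∧
    ∀ s : Set V, s ⊆ Set.range φ → (s ∈ cubes ↔ ∃ σ : Fin n → Option Bool, s = φ '' cubeFace σ)

/-- A cube complex with vertex set `V`: cubes are embedded, faces of cubes are cubes, and two cubes
that meet intersect in a common face. A cube is recorded by its set of vertices. -/
structure CubeComplex (V : Type*) where
  cubes : Set (Set V)
  singleton_mem : ∀ v : V, {v} ∈ cubes
  exists_chart : ∀ c ∈ cubes, ∃ (n : ℕ) (φ : (Fin n → Bool) → V),
    IsCubeChart cubes φ ∧ Set.range φ = c
  inter_mem : ∀ c ∈ cubes, ∀ d ∈ cubes, (c ∩ d).Nonempty → c ∩ d ∈ cubes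

namespace CubeComplex

/-- The dimensions of the cubes are bounded. -/
def FiniteDimensional {V : Type*} (K : CubeComplex V) : Prop :=
  ∃ N : ℕ, ∀ (n : ℕ) (φ : (Fin n → Bool) → V), IsCubeChart K.cubes φ → n ≤ N

/-- The 1-skeleton. -/
def graph {V : Type*} (K : CubeComplex V) : SimpleGraph V where
  Adj u v := u ≠ v ∧ ({u, v} : Set V) ∈ K.cubes
  symm := ⟨fun u v h => ⟨h.1.symm, by rw [Set.pair_comm]; exact h.2⟩⟩
  loopless := ⟨fun _ h => h.1 rfl⟩

/-- `S` is the vertex set of a simplex (possibly empty) of the link of `v`. The vertices of the link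
are the edges at `v`, recorded by their other endpoints, and each cube at `v` contributes the
simplex spanned by its edges at `v`. -/
def IsLinkSimplex {V : Type*} (K : CubeComplex V) (v : V) (S : Set V) : Prop :=
  ∃ c ∈ K.cubes, v ∈ c ∧ S = {u ∈ c | K.graph.Adj v u}

/-- All vertex links are flag: finitely many pairwise adjacent vertices of a link span a simplex. -/
def HasFlagLinks {V : Type*} (K : CubeComplex V) : Prop :=
  ∀ (v : V) (S : Set V), S.Finite → (∀ u ∈ S, K.graph.Adj v u) →
    (∀ a ∈ S, ∀ b ∈ S, a ≠ b → K.IsLinkSimplex v {a, b}) → K.IsLinkSimplex v S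

/-- Homotopy of edge paths relative to their endpoints: the equivalence relation generated by
removing backtracks and by pushing a path across a square. -/
inductive EdgeHomotopic {V : Type*} (K : CubeComplex V) :
    ∀ {u v : V}, K.graph.Walk u v → K.graph.Walk u v → Prop
  | refl {u v : V} (p : K.graph.Walk u v) : EdgeHomotopic K p p
  | symm {u v : V} {p q : K.graph.Walk u v} : EdgeHomotopic K p q → EdgeHomotopic K q p
  | trans {u v : V} {p q r : K.graph.Walk u v} :
      EdgeHomotopic K p q → EdgeHomotopic K q r → EdgeHomotopic K p r
  | backtrack {u v a b : V} (p : K.graph.Walk u a) (hab : K.graph.Adj a b)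
      (q : K.graph.Walk a v) :
      EdgeHomotopic K (p.append (.cons hab (.cons hab.symm q))) (p.append q)
  | square {u v a b c d : V} (p : K.graph.Walk u a)
      (hab : K.graph.Adj a b) (hbc : K.graph.Adj b c)
      (had : K.graph.Adj a d) (hdc : K.graph.Adj d c) (q : K.graph.Walk c v)
      (hs : ({a, b, c, d} : Set V) ∈ K.cubes) :
      EdgeHomotopic K (p.append (.cons hab (.cons hbc q))) (p.append (.cons had (.cons hdc q)))

/-- Connected (in particular nonempty), with trivial fundamental group. The fundamental group is
computed as the edge-path group of the 2-skeleton. -/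
def SimplyConnected {V : Type*} (K : CubeComplex V) : Prop :=
  K.graph.Connected ∧
    ∀ (v : V) (p : K.graph.Walk v v), K.EdgeHomotopic p SimpleGraph.Walk.nil

/-- A CAT(0) cube complex: simply connected, with flag vertex links. -/
def IsCATZero {V : Type*} (K : CubeComplex V) : Prop :=
  K.SimplyConnected ∧ K.HasFlagLinks

/-! #### Geometric realization and its length metrics -/

/-- The solid unit cube `[0,1]ⁿ`. -/
def solidCube (n : ℕ) : Set (Fin n → ℝ) := {x | ∀ i, 0 ≤ x i ∧ x i ≤ 1}

/-- The multilinear weights of a point `x` of `[0,1]ⁿ` on the vertices of the cube, transported to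
`V` along `φ`. They determine the face containing `x` in its interior (as their support), and the
coordinates of `x`. -/
noncomputable def weight {V : Type*} {n : ℕ} (φ : (Fin n → Bool) → V) (x : Fin n → ℝ) : V → ℝ :=
  open Classical in
  fun v => ∑ b : Fin n → Bool, if φ b = v then ∏ i, (if b i then x i else 1 - x i) else 0

/-- The geometric realization: the union of one solid cube for each cube of `K`, glued along common
faces. A point is recorded by its weights on the vertices of `K`. -/
def Realization {V : Type*} (K : CubeComplex V) : Type _ :=
  {f : V → ℝ // ∃ (n : ℕ) (φ : (Fin n → Bool) → V) (x : Fin n → ℝ),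
    IsCubeChart K.cubes φ ∧ x ∈ solidCube n ∧ f = weight φ x}

/-- `K.IsString δ p q ℓ`: there is a finite string of points from `p` to `q`, any two consecutive
ones lying in a common solid cube, of total length `ℓ`, where lengths in `[0,1]ⁿ` are measured
by `δ n`. -/
inductive IsString {V : Type*} (K : CubeComplex V) (δ : ∀ n : ℕ, (Fin n → ℝ) → (Fin n → ℝ) → ℝ) :
    K.Realization → K.Realization → ℝ → Prop
  | nil (p : K.Realization) : IsString K δ p p 0
  | cons {n : ℕ} (φ : (Fin n → Bool) → V) (hφ : IsCubeChart K.cubes φ)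
      (x y : Fin n → ℝ) (hx : x ∈ solidCube n) (hy : y ∈ solidCube n)
      {p p' q : K.Realization} {l : ℝ} (hp : p.1 = weight φ x) (hp' : p'.1 = weight φ y) :
      IsString K δ p' q l → IsString K δ p q (δ n x y + l)

/-- The length metric on the realization: the infimum of the lengths of strings. (In a connected
complex any two points are joined by a string.) -/
noncomputable def lengthDist {V : Type*} (K : CubeComplex V)
    (δ : ∀ n : ℕ, (Fin n → ℝ) → (Fin n → ℝ) → ℝ) (p q : K.Realization) : ℝ :=
  sInf {l : ℝ | K.IsString δ p q l}

/-- The piecewise Euclidean length metric. -/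
noncomputable def euclideanDist {V : Type*} (K : CubeComplex V) : K.Realization → K.Realization → ℝ :=
  K.lengthDist fun _ x y => Real.sqrt (∑ i, (x i - y i) ^ 2)

/-- The piecewise `ℓ¹` length metric, which restricts to the combinatorial metric on the vertices
of a CAT(0) cube complex. The median of a CAT(0) cube complex is the median of this metric. -/
noncomputable def l1Dist {V : Type*} (K : CubeComplex V) : K.Realization → K.Realization → ℝ :=
  K.lengthDist fun _ x y => ∑ i, |x i - y i|

/-- A map from a space `X` with ternary operation `m` to a CAT(0) cube complex is quasimedian if it
maps `m x y z` uniformly close to the median of the images of `x, y, z`. -/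
def IsQuasimedian {X V : Type*} (m : X → X → X → X) (K : CubeComplex V) (Φ : X → K.Realization) :
    Prop :=
  ∃ D : ℝ, ∀ x y z : X, ∃ p : K.Realization,
    IsMedianPoint K.l1Dist (Φ x) (Φ y) (Φ z) p ∧ K.euclideanDist (Φ (m x y z)) p ≤ D

end CubeComplex

/-! The vertices of a CAT(0) cube complex form a median graph. The median is the majority vote over
the halfspaces of the 1-skeleton, and the distance of two vertices is the number of halfspaces
containing the first but not the second. After moving `Φ` by a bounded amount it takes values in the
vertices; its image `S` is coarsely closed under medians because `Φ` is quasimedian. The new complex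
has as vertices the median subalgebra `T` generated by `S`, and two facts control it.

If the dimension is at most `N`, then at most `N` halfspaces cross pairwise (`crossingBound`), and
this forces every point of `T` to arise from `S` by `2 * N + 1` rounds of medians
(`medianIter_eq_univ`, `medianSpan_eq_medianIter`). Each round costs a bounded error, so `T` stays
within bounded distance of `S` (`exists_near_of_mem_medianIter`).

The traces on `T` of the halfspaces again present its median as a majority vote, and any such
presentation has a dual CAT(0) cube complex (`isCATZero`), here of dimension at most `N`. Distances
in it count distinct traces rather than halfspaces. Coarse connectedness of `X` makes `T` connected
by bounded jumps; all halfspaces with one given nontrivial trace separate the two ends of a single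
jump, so their number is bounded (`wallDist_le_trace`) and the two metrics on `T` are comparable.

It remains to pass from the definition of CAT(0) to halfspaces. Reduced edge paths modulo squares
behave like the points of a covering; simple connectivity makes this covering trivial, so a reduced
path is determined by its ends up to squares (`pathRun_equiv`). Comparing two geodesics gives the
quadrangle condition (`exists_quadrangle`), from which halfspaces and medians follow
(`halfspace_eq_of_crossing`, `exists_medianWalls`). The two length metrics are compared with the
graph metric by multilinear interpolation (`abs_interpolation_sub_le`). -/

open Set

/-! ### Medians as majority votes over halfspaces, and the cubes they determine. -/

/-- A ternary operation `m` on `M` that is the majority vote on every member of a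
complement-closed family `H` of subsets (halfspaces), where any two points are separated by a
nonzero finite number of halfspaces. -/
structure MedianWalls {M : Type*} (H : Set (Set M)) (m : M → M → M → M) : Prop where
  compl_mem : ∀ A ∈ H, Aᶜ ∈ H
  finite_sep : ∀ x y : M, {A ∈ H | x ∈ A ∧ y ∉ A}.Finite
  exists_sep : ∀ x y : M, x ≠ y → ∃ A ∈ H, x ∈ A ∧ y ∉ A
  majority : ∀ A ∈ H, ∀ x y z : M,
    m x y z ∈ A ↔ (x ∈ A ∧ y ∈ A) ∨ (y ∈ A ∧ z ∈ A) ∨ (x ∈ A ∧ z ∈ A)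

/-- The halfspaces containing `x` but not `y`. -/
def wallSep {M : Type*} (H : Set (Set M)) (x y : M) : Set (Set M) := {A ∈ H | x ∈ A ∧ y ∉ A}

/-- `φ` maps a discrete cube to `M` so that the coordinates are halfspaces, and all other
halfspaces are constant on the image. -/
def IsWallCube {M : Type*} (H : Set (Set M)) {ι : Type*} (φ : (ι → Bool) → M) : Prop :=
  ∃ A : ι → Set M, (∀ i, A i ∈ H) ∧ (∀ i b, φ b ∈ A i ↔ b i = true) ∧
    ∀ B ∈ H, (∃ i, B = A i ∨ B = (A i)ᶜ) ∨ ∀ b b', φ b ∈ B ↔ φ b' ∈ B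

/-- Any family of pairwise crossing halfspaces has at most `N` members. -/
def CrossingBound {M : Type*} (H : Set (Set M)) (N : ℕ) : Prop :=
  ∀ (n : ℕ) (A : Fin n → Set M), (∀ i, A i ∈ H) →
    (∀ i j, i ≠ j → ∀ β γ : Prop, ∃ x, (x ∈ A i ↔ β) ∧ (x ∈ A j ↔ γ)) → n ≤ N

namespace IsWallCube

variable {M : Type*} {H : Set (Set M)}

lemma coord_or_const {ι : Type*} {φ : (ι → Bool) → M} (h : IsWallCube H φ) {A : Set M}
    (hA : A ∈ H) :
    (∃ i β, ∀ b, φ b ∈ A ↔ b i = β) ∨ (∀ b b', φ b ∈ A ↔ φ b' ∈ A) := by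
  obtain ⟨B, -, hBφ, hB⟩ := h
  rcases hB A hA with ⟨i, rfl | rfl⟩ | hc
  · exact Or.inl ⟨i, true, hBφ i⟩
  · exact Or.inl ⟨i, false, fun b => by simp [hBφ]⟩
  · exact Or.inr hc

lemma injective {ι : Type*} {φ : (ι → Bool) → M} (h : IsWallCube H φ) :
    Function.Injective φ := by
  obtain ⟨A, -, hA, -⟩ := h
  intro b b' e
  funext i
  have h1 := hA i b
  rw [e, hA i b'] at h1
  rw [Bool.eq_iff_iff]
  exact h1.symm

lemma comp_equiv {ι κ : Type*} {φ : (ι → Bool) → M} (h : IsWallCube H φ) (e : ι ≃ κ) :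
    IsWallCube H (fun b : κ → Bool => φ (b ∘ e)) := by
  obtain ⟨A, hAH, hA, hB⟩ := h
  refine ⟨A ∘ e.symm, fun i => hAH _, fun i b => by simp [hA], fun B hBH => ?_⟩
  rcases hB B hBH with ⟨i, hi⟩ | hc
  · exact Or.inl ⟨e i, by simpa using hi⟩
  · exact Or.inr fun b b' => hc _ _

lemma range_comp_equiv {ι κ : Type*} (φ : (ι → Bool) → M) (e : ι ≃ κ) :
    range (fun b : κ → Bool => φ (b ∘ e)) = range φ := by
  ext x
  constructor
  · rintro ⟨b, rfl⟩; exact ⟨_, rfl⟩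
  · rintro ⟨b, rfl⟩; exact ⟨b ∘ e.symm, by simp [Function.comp_assoc]⟩

/-- The face of a cube on which the coordinates `i` with `σ i = some β` are fixed. -/
lemma face {ι : Type*} {φ : (ι → Bool) → M} (h : IsWallCube H φ) (σ : ι → Option Bool) :
    IsWallCube H (fun b : {i // σ i = none} → Bool =>
      φ (fun i => if hi : σ i = none then b ⟨i, hi⟩ else (σ i).getD true)) := by
  obtain ⟨A, hAH, hA, hB⟩ := h
  refine ⟨fun i => A i.1, fun i => hAH _, fun i b => by simp [hA, i.2], fun B hBH => ?_⟩
  rcases hB B hBH with ⟨i, hi⟩ | hc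
  · by_cases hσ : σ i = none
    · exact Or.inl ⟨⟨i, hσ⟩, hi⟩
    · refine Or.inr fun b b' => ?_
      rcases hi with rfl | rfl <;> simp [hA, hσ]
  · exact Or.inr fun b b' => hc _ _

lemma range_face {n : ℕ} (φ : (Fin n → Bool) → M) (σ : Fin n → Option Bool) :
    range (fun b : {i // σ i = none} → Bool =>
      φ (fun i => if hi : σ i = none then b ⟨i, hi⟩ else (σ i).getD true)) =
      φ '' cubeFace σ := by
  ext x
  constructor
  · rintro ⟨b, rfl⟩
    refine ⟨_, ?_, rfl⟩
    intro i β hi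
    simp [hi]
  · rintro ⟨b, hb, rfl⟩
    refine ⟨fun i => b i.1, ?_⟩
    simp only
    congr 1
    funext i
    split_ifs with hi
    · rfl
    · obtain ⟨β, hβ⟩ := Option.ne_none_iff_exists'.1 hi
      rw [hb i β hβ, hβ]; rfl

end IsWallCube

/-! ### The cube complex dual to a family of halfspaces. -/

namespace MedianWalls

variable {M : Type*} {H : Set (Set M)} {m : M → M → M → M}

lemma ext (hW : MedianWalls H m) {x y : M} (h : ∀ A ∈ H, x ∈ A → y ∈ A) : x = y := by
  by_contra hne
  obtain ⟨A, hA, hx, hy⟩ := hW.exists_sep x y hne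
  exact hy (h A hA hx)

/-- A wall cube is the intersection of the halfspaces containing it. -/
lemma mem_range_of_forall (hW : MedianWalls H m) {ι : Type*} {φ : (ι → Bool) → M}
    (h : IsWallCube H φ) {x : M} (hx : ∀ A ∈ H, range φ ⊆ A → x ∈ A) : x ∈ range φ := by
  classical
  obtain ⟨B, hBH, hBφ, hB⟩ := h
  -- The only candidate preimage: read off the coordinates of `x`.
  refine ⟨fun i => decide (x ∈ B i), ?_⟩
  symm
  apply hW.ext
  intro A hA hxA
  rcases hB A hA with ⟨i, rfl | rfl⟩ | hc
  · simp [hBφ, hxA]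
  · have : x ∉ B i := hxA
    simp [hBφ, this]
  · by_contra hne
    have : x ∈ Aᶜ := hx Aᶜ (hW.compl_mem A hA) (by
      rintro _ ⟨b, rfl⟩ hbA
      exact hne ((hc _ _).1 hbA))
    exact this hxA

/-- A set that is an intersection of halfspaces meets a cube in a face, or not at all. -/
lemma inter_range_eq_face {n : ℕ} {φ : (Fin n → Bool) → M}
    (h : IsWallCube H φ) {s : Set M} (hs : ∀ x, (∀ A ∈ H, s ⊆ A → x ∈ A) → x ∈ s)
    (hne : (s ∩ range φ).Nonempty) :
    ∃ σ : Fin n → Option Bool, s ∩ range φ = φ '' cubeFace σ := by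
  classical
  -- `σ` fixes exactly the coordinates that are constant on the intersection. A halfspace containing
  -- `s` is then either one of these coordinates or constant on the cube, so it contains the whole
  -- face.
  have key : ∃ σ : Fin n → Option Bool, ∀ i β,
      σ i = some β ↔ ∀ b, φ b ∈ s → b i = β := by
    obtain ⟨_, hbs, b₀, rfl⟩ := hne
    refine ⟨fun i => if (∀ b, φ b ∈ s → b i = b₀ i) then some (b₀ i) else none, ?_⟩
    intro i β
    constructor
    · intro hi
      by_cases hc : ∀ b, φ b ∈ s → b i = b₀ i
      · simp only [if_pos hc] at hi
        cases hi; exact hc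
      · simp only [if_neg hc] at hi
        cases hi
    · intro hc
      have := hc b₀ hbs
      subst this
      exact if_pos hc
  obtain ⟨σ, hσ⟩ := key
  refine ⟨σ, ?_⟩
  ext x
  constructor
  · rintro ⟨hxs, b, rfl⟩
    exact ⟨b, fun i β hi => (hσ i β).1 hi b hxs, rfl⟩
  · rintro ⟨b, hb, rfl⟩
    refine ⟨hs _ fun A hA hsA => ?_, b, rfl⟩
    rcases h.coord_or_const hA with ⟨i, β, hi⟩ | hc
    · rw [hi]
      exact hb i β ((hσ i β).2 fun b' hb' => (hi b').1 (hsA hb'))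
    · obtain ⟨_, hbs, b₀, rfl⟩ := hne
      exact (hc b₀ b).1 (hsA hbs)

variable (H) in
/-- The vertex sets of cubes of the complex dual to a family of halfspaces. -/
def wallCubes : Set (Set M) :=
  {c | ∃ (n : ℕ) (φ : (Fin n → Bool) → M), IsWallCube H φ ∧ range φ = c}

lemma range_mem_wallCubes {ι : Type*} [Finite ι] {φ : (ι → Bool) → M} (h : IsWallCube H φ) :
    range φ ∈ wallCubes H :=
  ⟨_, _, h.comp_equiv (Finite.equivFin ι), IsWallCube.range_comp_equiv _ _⟩

lemma image_cubeFace_mem {n : ℕ} {φ : (Fin n → Bool) → M} (h : IsWallCube H φ)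
    (σ : Fin n → Option Bool) : φ '' cubeFace σ ∈ wallCubes H := by
  rw [← IsWallCube.range_face]
  exact range_mem_wallCubes (h.face σ)

lemma convex_of_mem_wallCubes (hW : MedianWalls H m) {c : Set M} (hc : c ∈ wallCubes H) (x : M)
    (hx : ∀ A ∈ H, c ⊆ A → x ∈ A) : x ∈ c := by
  obtain ⟨n, φ, hφ, rfl⟩ := hc
  exact hW.mem_range_of_forall hφ hx

lemma nonempty_of_mem_wallCubes {c : Set M} (hc : c ∈ wallCubes H) : c.Nonempty := by
  obtain ⟨n, φ, hφ, rfl⟩ := hc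
  exact range_nonempty _

/-- Cubes are intersections of halfspaces, so a cube inside another meets it in a face; conversely,
fixing coordinates leaves a cube on the remaining ones. -/
lemma isCubeChart (hW : MedianWalls H m) {n : ℕ} {φ : (Fin n → Bool) → M}
    (h : IsWallCube H φ) : IsCubeChart (wallCubes H) φ := by
  refine ⟨h.injective, fun s hs => ⟨fun hsc => ?_, ?_⟩⟩
  · have := inter_range_eq_face h (hW.convex_of_mem_wallCubes hsc)
      (by rw [inter_eq_left.2 hs]; exact nonempty_of_mem_wallCubes hsc)
    rwa [inter_eq_left.2 hs] at this
  · rintro ⟨σ, rfl⟩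
    exact image_cubeFace_mem h σ

lemma isWallCube_point (v : M) :
    IsWallCube H (fun _ : Fin 0 → Bool => v) :=
  ⟨fun i => i.elim0, fun i => i.elim0, fun i => i.elim0, fun _ _ => Or.inr fun _ _ => Iff.rfl⟩

/-- The cube complex dual to a family of halfspaces. -/
def wallComplex (hW : MedianWalls H m) : CubeComplex M where
  cubes := wallCubes H
  singleton_mem v := by
    convert range_mem_wallCubes (isWallCube_point v)
    simp
  exists_chart := by
    rintro _ ⟨n, φ, hφ, rfl⟩
    exact ⟨n, φ, hW.isCubeChart hφ, rfl⟩
  inter_mem := by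
    rintro c hc _ ⟨n, φ, hφ, rfl⟩ hne
    obtain ⟨σ, hσ⟩ := inter_range_eq_face hφ (hW.convex_of_mem_wallCubes hc) hne
    rw [hσ]
    exact image_cubeFace_mem hφ σ

lemma dim_eq_of_range_eq {n k : ℕ} {φ : (Fin n → Bool) → M}
    {ψ : (Fin k → Bool) → M} (hφ : Function.Injective φ) (hψ : Function.Injective ψ)
    (h : range φ = range ψ) : n = k := by
  have h1 := Nat.card_congr (Equiv.ofInjective φ hφ)
  have h2 := Nat.card_congr (Equiv.ofInjective ψ hψ)
  rw [← h, ← h1] at h2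
  simp at h2
  exact h2.symm

lemma range_mem_of_isCubeChart {cubes : Set (Set M)} {n : ℕ} {φ : (Fin n → Bool) → M}
    (hφ : IsCubeChart cubes φ) : range φ ∈ cubes :=
  (hφ.2 _ subset_rfl).2 ⟨fun _ => none, by simp [cubeFace]⟩

lemma finiteDimensional (hW : MedianWalls H m) {N : ℕ} (hN : CrossingBound H N) :
    hW.wallComplex.FiniteDimensional := by
  classical
  refine ⟨N, fun n φ hφ => ?_⟩
  -- An arbitrary chart need not be given by halfspaces, but its image is the image of a wall cube,
  -- whose dimension agrees by counting vertices.
  obtain ⟨k, ψ, hψ, hr⟩ := range_mem_of_isCubeChart hφ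
  have hk : k = n := dim_eq_of_range_eq hψ.injective hφ.1 hr
  subst hk
  obtain ⟨A, hAH, hA, -⟩ := hψ
  refine hN k A hAH fun i j hij β γ => ?_
  refine ⟨ψ (fun l => if l = i then decide β else decide γ), ?_, ?_⟩
  · simp [hA]
  · simp [hA, hij.symm]

end MedianWalls

namespace CubeComplex

variable {V : Type*} {K : CubeComplex V}

/-- Every elementary move allows an arbitrary initial path, which absorbs the new edge. -/
lemma EdgeHomotopic.cons {u v w : V} (h : K.graph.Adj u v) {p q : K.graph.Walk v w}
    (hpq : K.EdgeHomotopic p q) : K.EdgeHomotopic (.cons h p) (.cons h q) := by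
  induction hpq with
  | refl p => exact .refl _
  | symm _ ih => exact .symm ih
  | trans _ _ ih₁ ih₂ => exact .trans ih₁ ih₂
  | backtrack p hab q => exact .backtrack (.cons h p) hab q
  | square p hab hbc had hdc q hs => exact .square (.cons h p) hab hbc had hdc q hs

end CubeComplex

/-! ### Cubes at a vertex of the dual complex, and flag links. -/

namespace MedianWalls

variable {M : Type*} {H : Set (Set M)} {m : M → M → M → M}

lemma wallSep_finite (hW : MedianWalls H m) (x y : M) : (wallSep H x y).Finite :=
  hW.finite_sep x y

lemma wallSep_self (x : M) : wallSep H x x = ∅ := by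
  ext A; simp [wallSep]

/-- Seen from a base point `v`, a point is encoded by the finite set of halfspaces that contain it
and avoid `v`; halfspaces containing `v` are recovered from their complements. -/
lemma wallSep_injective (hW : MedianWalls H m) {x y v : M}
    (h : wallSep H x v = wallSep H y v) : x = y := by
  apply hW.ext
  intro B hB hx
  by_cases hv : v ∈ B
  · by_contra hy
    have : Bᶜ ∈ wallSep H x v := by
      rw [h]; exact ⟨hW.compl_mem B hB, hy, by simpa using hv⟩
    exact this.2.1 hx
  · have : B ∈ wallSep H y v := by rw [← h]; exact ⟨hB, hx, hv⟩
    exact this.2.1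

lemma wallSep_eq_empty (hW : MedianWalls H m) {x y : M} : wallSep H x y = ∅ ↔ x = y := by
  constructor
  · intro h
    exact hW.wallSep_injective (v := y) (by rw [h, wallSep_self])
  · rintro rfl; exact wallSep_self _

/-- In the encoding by finite sets relative to `v`, the median is the majority of three sets. -/
lemma mem_wallSep_median (hW : MedianWalls H m) {a b c v : M} {A : Set M} :
    A ∈ wallSep H (m a b c) v ↔ (A ∈ wallSep H a v ∧ A ∈ wallSep H b v) ∨
      (A ∈ wallSep H b v ∧ A ∈ wallSep H c v) ∨ (A ∈ wallSep H a v ∧ A ∈ wallSep H c v) := by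
  by_cases hA : A ∈ H
  · simp only [wallSep, mem_ofPred_eq, hW.majority A hA]
    tauto
  · simp [wallSep, hA]

/-- Points realizing a finite set of halfspaces exist if singletons and pairs are realized. -/
lemma exists_wallSep_eq (hW : MedianWalls H m) (v : M) (T : Finset (Set M))
    (h1 : ∀ A ∈ T, ∃ u, wallSep H u v = {A})
    (h2 : ∀ A ∈ T, ∀ B ∈ T, A ≠ B → ∃ u, wallSep H u v = {A, B}) :
    ∃ w, wallSep H w v = T := by
  classical
  induction hn : T.card using Nat.strong_induction_on generalizing T with
  | _ n ih =>
  have sub : ∀ A ∈ T, ∃ w, wallSep H w v = (T.erase A : Finset (Set M)) := fun A hA =>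
    ih (T.erase A).card (by rw [← hn]; exact Finset.card_erase_lt_of_mem hA) (T.erase A)
      (fun B hB => h1 B (Finset.mem_of_mem_erase hB))
      (fun B hB C hC => h2 B (Finset.mem_of_mem_erase hB) C (Finset.mem_of_mem_erase hC)) rfl
  by_cases h3 : 2 < T.card
  -- The majority of `T \ {A}`, `T \ {B}` and `T \ {C}` is `T`.
  · obtain ⟨A, B, C, hA, hB, hC, hAB, hAC, hBC⟩ := Finset.two_lt_card_iff.1 h3
    obtain ⟨a, ha⟩ := sub A hA
    obtain ⟨b, hb⟩ := sub B hB
    obtain ⟨c, hc⟩ := sub C hC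
    refine ⟨m a b c, ?_⟩
    ext D
    rw [hW.mem_wallSep_median, ha, hb, hc]
    simp only [Finset.coe_erase, mem_sdiff, Finset.mem_coe, mem_singleton_iff]
    by_cases hDA : D = A
    · subst hDA; tauto
    · by_cases hDB : D = B
      · subst hDB; tauto
      · tauto
  · have : T.card = 0 ∨ T.card = 1 ∨ T.card = 2 := by omega
    rcases this with h | h | h
    · exact ⟨v, by rw [Finset.card_eq_zero.1 h, wallSep_self]; simp⟩
    · obtain ⟨A, rfl⟩ := Finset.card_eq_one.1 h
      simpa using h1 A (by simp)
    · obtain ⟨A, B, hAB, rfl⟩ := Finset.card_eq_two.1 h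
      simpa using h2 A (by simp) B (by simp) hAB

/-- The hypotheses pass to every subset of `T`, so all subsets are realized by points; these points
are the vertices of a cube with coordinates in `T`. Edges, squares and flagness all come from this.
-/
lemma exists_cube (hW : MedianWalls H m) (v : M) (T : Finset (Set M))
    (h1 : ∀ A ∈ T, ∃ u, wallSep H u v = {A})
    (h2 : ∀ A ∈ T, ∀ B ∈ T, A ≠ B → ∃ u, wallSep H u v = {A, B}) :
    ∃ c ∈ wallCubes H, ∀ w, w ∈ c ↔ wallSep H w v ⊆ T := by
  classical
  have hT : ∀ A ∈ T, A ∈ H ∧ v ∉ A := fun A hA => by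
    obtain ⟨u, hu⟩ := h1 A hA
    have : A ∈ wallSep H u v := by rw [hu]; rfl
    exact ⟨this.1, this.2.2⟩
  have ex : ∀ b : T → Bool, ∃ w, wallSep H w v = {A | ∃ h : A ∈ T, b ⟨A, h⟩ = true} := by
    intro b
    obtain ⟨w, hw⟩ := hW.exists_wallSep_eq v
      (T.attach.filter (fun A => b A = true) |>.image Subtype.val)
      (fun A hA => h1 A (by
        simp only [Finset.mem_image, Finset.mem_filter] at hA
        obtain ⟨B, -, rfl⟩ := hA; exact B.2))
      (fun A hA B hB => h2 A (by
        simp only [Finset.mem_image, Finset.mem_filter] at hA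
        obtain ⟨B, -, rfl⟩ := hA; exact B.2) B (by
        simp only [Finset.mem_image, Finset.mem_filter] at hB
        obtain ⟨B, -, rfl⟩ := hB; exact B.2))
    refine ⟨w, hw.trans ?_⟩
    ext A
    simp
  choose φ hφ using ex
  have hmem : ∀ b, ∀ B ∈ H, v ∉ B → (φ b ∈ B ↔ ∃ h : B ∈ T, b ⟨B, h⟩ = true) := by
    intro b B hB hv
    have : B ∈ wallSep H (φ b) v ↔ ∃ h : B ∈ T, b ⟨B, h⟩ = true := by rw [hφ]; rfl
    rw [← this]
    exact ⟨fun h => ⟨hB, h, hv⟩, fun h => h.2.1⟩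
  refine ⟨range φ, range_mem_wallCubes ⟨fun A => A.1, fun A => (hT A.1 A.2).1, ?_, ?_⟩, ?_⟩
  · intro A b
    rw [hmem b A.1 (hT A.1 A.2).1 (hT A.1 A.2).2]
    simp
  · intro B hB
    by_cases hv : v ∈ B
    · have hB' := hW.compl_mem B hB
      by_cases hBT : Bᶜ ∈ T
      · exact Or.inl ⟨⟨_, hBT⟩, Or.inr (by simp)⟩
      · refine Or.inr fun b b' => ?_
        have hb := fun b => hmem b Bᶜ hB' (by simpa using hv)
        simp only [hBT, mem_compl_iff] at hb
        have := hb b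
        have := hb b'
        simp_all
    · by_cases hBT : B ∈ T
      · exact Or.inl ⟨⟨_, hBT⟩, Or.inl rfl⟩
      · refine Or.inr fun b b' => ?_
        rw [hmem b B hB hv, hmem b' B hB hv]
        simp [hBT]
  · intro w
    constructor
    · rintro ⟨b, rfl⟩
      rw [hφ]
      rintro A ⟨h, -⟩
      exact h
    · intro h
      refine ⟨fun A => decide (A.1 ∈ wallSep H w v), ?_⟩
      apply hW.wallSep_injective (v := v)
      rw [hφ]
      ext A
      constructor
      · rintro ⟨_, h⟩; simpa using h
      · intro hA; exact ⟨h hA, by simpa using hA⟩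

lemma singleton_unique {u v : M} {A B : Set M}
    (hA : wallSep H u v = {A}) (hB : wallSep H u v = {B}) : A = B := by
  rw [hA] at hB; simpa using hB

lemma adj_iff (hW : MedianWalls H m) {v u : M} :
    hW.wallComplex.graph.Adj v u ↔ ∃ A, wallSep H u v = {A} := by
  classical
  constructor
  · rintro ⟨hne, n, ψ, ⟨A, hAH, hA, hB⟩, hr⟩
    obtain ⟨D, hD, huD, hvD⟩ := hW.exists_sep u v hne.symm
    obtain ⟨b, rfl⟩ : v ∈ range ψ := by rw [hr]; simp
    obtain ⟨b', rfl⟩ : u ∈ range ψ := by rw [hr]; simp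
    have inj := IsWallCube.injective ⟨A, hAH, hA, hB⟩
    -- If `b` and `b'` differed in two coordinates, flipping just one of them would give a third
    -- vertex.
    have key : ∀ i j, b i ≠ b' i → b j ≠ b' j → i = j := by
      intro i j hi hj
      by_contra hij
      have hmem : ψ (Function.update b j (! b j)) ∈ ({ψ b, ψ b'} : Set M) := by
        rw [← hr]; exact ⟨_, rfl⟩
      rcases hmem with h | h
      · have := congrFun (inj h) j
        simp at this
      · have := congrFun (inj h) i
        simp [Function.update_of_ne hij] at this
        exact hi this
    have hcoord : ∀ B ∈ wallSep H (ψ b') (ψ b), ∃ i, b i ≠ b' i ∧ (B = A i ∨ B = (A i)ᶜ) := by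
      rintro B ⟨hBH, h1, h2⟩
      rcases hB B hBH with ⟨i, hi⟩ | hc
      · refine ⟨i, fun h => ?_, hi⟩
        rcases hi with rfl | rfl <;> simp [hA, h] at h1 h2 <;> simp_all
      · exact absurd ((hc b b').2 h1) h2
    refine ⟨D, Subset.antisymm (fun B hBs => ?_) (by rintro _ rfl; exact ⟨hD, huD, hvD⟩)⟩
    obtain ⟨i, hi, h1⟩ := hcoord D ⟨hD, huD, hvD⟩
    obtain ⟨j, hj, h2⟩ := hcoord B hBs
    obtain rfl := key i j hi hj
    obtain ⟨-, h3, h4⟩ := hBs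
    rcases h1 with rfl | rfl <;> rcases h2 with rfl | rfl <;> simp_all
  · rintro ⟨A, hA⟩
    obtain ⟨c, hc, hcm⟩ := hW.exists_cube v {A} (by
      intro B hB; obtain rfl := Finset.mem_singleton.1 hB; exact ⟨u, hA⟩) (by
      intro B hB C hC hne
      rw [Finset.mem_singleton] at hB hC
      exact absurd (hB.trans hC.symm) hne)
    refine ⟨?_, ?_⟩
    · rintro rfl; rw [wallSep_self] at hA
      exact (Set.singleton_ne_empty A hA.symm).elim
    · change _ ∈ wallCubes H
      suffices h : ({v, u} : Set M) = c by rwa [h]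
      ext w
      rw [hcm, Finset.coe_singleton, subset_singleton_iff_eq, hW.wallSep_eq_empty, ← hA]
      constructor
      · rintro (rfl | rfl) <;> simp
      · rintro (rfl | h)
        · simp
        · right; exact hW.wallSep_injective h

lemma exists_pair_of_mem_cube {c : Set M} (hc : c ∈ wallCubes H)
    {v a b : M} (hv : v ∈ c) (ha : a ∈ c) (hb : b ∈ c) {A B : Set M}
    (hA : wallSep H a v = {A}) (hB : wallSep H b v = {B}) (hne : A ≠ B) :
    ∃ w, wallSep H w v = {A, B} := by
  obtain ⟨n, ψ, hψ, rfl⟩ := hc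
  obtain ⟨b₀, rfl⟩ := hv
  obtain ⟨b₁, rfl⟩ := ha
  obtain ⟨b₂, rfl⟩ := hb
  -- The fourth corner of the square is the sum modulo 2 of the other three. An odd number of
  -- summands makes the formula insensitive to complementing a halfspace, and valid for those
  -- constant on the cube.
  refine ⟨ψ (fun i => xor (b₀ i) (xor (b₁ i) (b₂ i))), ?_⟩
  have key : ∀ D ∈ H, (ψ (fun i => xor (b₀ i) (xor (b₁ i) (b₂ i))) ∈ D ↔
      Xor (ψ b₀ ∈ D) (Xor (ψ b₁ ∈ D) (ψ b₂ ∈ D))) := by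
    intro D hD
    rcases hψ.coord_or_const hD with ⟨i, β, h⟩ | h
    · simp only [h]
      cases β <;> cases b₀ i <;> cases b₁ i <;> cases b₂ i <;> simp [Xor]
    · rw [h _ b₀, h b₁ b₀, h b₂ b₀]
      by_cases hh : ψ b₀ ∈ D <;> simp [hh, Xor]
  ext D
  by_cases hD : D ∈ H
  swap
  · have h1 : D ∉ wallSep H (ψ b₁) (ψ b₀) := fun h => hD h.1
    have h2 : D ∉ wallSep H (ψ b₂) (ψ b₀) := fun h => hD h.1
    rw [hA] at h1
    rw [hB] at h2
    have h3 : D ∉ wallSep H (ψ (fun i => xor (b₀ i) (xor (b₁ i) (b₂ i)))) (ψ b₀) := fun h => hD h.1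
    simp only [mem_singleton_iff] at h1 h2
    simp [h1, h2, h3]
  have h1 : D ∈ wallSep H (ψ b₁) (ψ b₀) ↔ D = A := by rw [hA]; simp
  have h2 : D ∈ wallSep H (ψ b₂) (ψ b₀) ↔ D = B := by rw [hB]; simp
  simp only [wallSep, mem_ofPred_eq, hD, true_and, key, mem_insert_iff, mem_singleton_iff]
    at h1 h2 ⊢
  rw [← h1, ← h2]
  have h3 : ¬ (D = A ∧ D = B) := fun h => hne (h.1.symm.trans h.2)
  rw [← h1, ← h2] at h3
  simp only [Xor]
  tauto

/-- Neighbours of `v` correspond to single halfspaces. A link edge between two neighbours realizes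
the corresponding pair, which is all that `exists_cube` needs. -/
lemma hasFlagLinks (hW : MedianWalls H m) : hW.wallComplex.HasFlagLinks := by
  classical
  intro v S hS hadj hpair
  choose A hA using fun u : S => hW.adj_iff.1 (hadj u.1 u.2)
  have := hS.fintype
  let T : Finset (Set M) := Finset.univ.image A
  have hT : ∀ B ∈ T, ∃ u ∈ S, wallSep H u v = {B} := by
    intro B hB
    obtain ⟨u, -, rfl⟩ := Finset.mem_image.1 hB
    exact ⟨u.1, u.2, hA u⟩
  obtain ⟨c, hc, hcm⟩ := hW.exists_cube v T (fun B hB => by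
    obtain ⟨u, -, hu⟩ := hT B hB; exact ⟨u, hu⟩) (fun B hB C hC hne => by
    obtain ⟨a, ha, hB⟩ := hT B hB
    obtain ⟨b, hb, hC⟩ := hT C hC
    have hab : a ≠ b := by
      rintro rfl; exact hne (singleton_unique hB hC)
    obtain ⟨d, hd, hvd, hd'⟩ := hpair a ha b hb hab
    have ha' : a ∈ d := by
      have : a ∈ ({a, b} : Set M) := by simp
      rw [hd'] at this; exact this.1
    have hb' : b ∈ d := by
      have : b ∈ ({a, b} : Set M) := by simp
      rw [hd'] at this; exact this.1
    exact exists_pair_of_mem_cube hd hvd ha' hb' hB hC hne)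
  refine ⟨c, hc, (hcm v).2 (by simp [wallSep_self]), ?_⟩
  ext u
  constructor
  · intro hu
    refine ⟨(hcm u).2 ?_, hadj u hu⟩
    rw [hA ⟨u, hu⟩]
    simp [T]
  · rintro ⟨huc, hu⟩
    obtain ⟨B, hB⟩ := hW.adj_iff.1 hu
    have := (hcm u).1 huc
    rw [hB, singleton_subset_iff] at this
    obtain ⟨u', hu', h⟩ := hT B this
    rw [← hB] at h
    rwa [← hW.wallSep_injective h]

end MedianWalls

/-! ### Geodesics and simple connectivity of the dual complex. -/

namespace MedianWalls

variable {M : Type*} {H : Set (Set M)} {m : M → M → M → M}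

lemma wallSep_flip_of_mem {u v a : M} {A : Set M}
    (hW : MedianWalls H m) (hA : wallSep H a v = {A}) (h : A ∈ wallSep H u v) :
    wallSep H u a = wallSep H u v \ {A} := by
  have hAa : A ∈ wallSep H a v := by rw [hA]; rfl
  have key : ∀ B ∈ H, v ∉ B → (a ∈ B ↔ B = A) := fun B hB hv => by
    have : B ∈ wallSep H a v ↔ B = A := by rw [hA]; rfl
    rw [← this]; exact ⟨fun h => ⟨hB, h, hv⟩, fun h => h.2.1⟩
  ext B
  simp only [wallSep, mem_sdiff, mem_singleton_iff, mem_ofPred_eq]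
  constructor
  · rintro ⟨hB, hu, ha⟩
    refine ⟨⟨hB, hu, fun hv => ?_⟩, ?_⟩
    · have := (key Bᶜ (hW.compl_mem B hB) (by simpa using hv)).1 ha
      rw [← this] at h
      exact h.2.1 hu
    · rintro rfl; exact ha hAa.2.1
  · rintro ⟨⟨hB, hu, hv⟩, hne⟩
    exact ⟨hB, hu, fun ha => hne ((key B hB hv).1 ha)⟩

lemma wallSep_flip_of_notMem {u v a : M} {A : Set M}
    (hW : MedianWalls H m) (hA : wallSep H a v = {A}) (h : A ∉ wallSep H u v) :
    Aᶜ ∉ wallSep H u v ∧ wallSep H u a = insert Aᶜ (wallSep H u v) := by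
  have hAa : A ∈ wallSep H a v := by rw [hA]; rfl
  have hA' := hW.compl_mem A hAa.1
  have key : ∀ B ∈ H, v ∉ B → (a ∈ B ↔ B = A) := fun B hB hv => by
    have : B ∈ wallSep H a v ↔ B = A := by rw [hA]; rfl
    rw [← this]; exact ⟨fun h => ⟨hB, h, hv⟩, fun h => h.2.1⟩
  refine ⟨fun h' => h'.2.2 hAa.2.2, ?_⟩
  ext B
  rw [mem_insert_iff]
  constructor
  · rintro ⟨hB, hu, ha⟩
    by_cases hv : v ∈ B
    · left
      rw [← (key Bᶜ (hW.compl_mem B hB) (by simpa using hv)).1 ha, compl_compl]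
    · exact Or.inr ⟨hB, hu, hv⟩
  · rintro (rfl | ⟨hB, hu, hv⟩)
    · refine ⟨hA', fun hu => h ⟨hAa.1, hu, hAa.2.2⟩, by simpa using hAa.2.1⟩
    · refine ⟨hB, hu, fun ha => ?_⟩
      obtain rfl := (key B hB hv).1 ha
      exact h ⟨hB, hu, hv⟩

lemma wallDist_flip_of_mem {u v a : M} {A : Set M}
    (hW : MedianWalls H m) (hA : wallSep H a v = {A}) (h : A ∈ wallSep H u v) :
    (wallSep H u a).ncard + 1 = (wallSep H u v).ncard := by
  rw [hW.wallSep_flip_of_mem hA h]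
  exact ncard_sdiff_singleton_add_one h (hW.wallSep_finite u v)

lemma wallDist_flip_of_notMem {u v a : M} {A : Set M}
    (hW : MedianWalls H m) (hA : wallSep H a v = {A}) (h : A ∉ wallSep H u v) :
    (wallSep H u a).ncard = (wallSep H u v).ncard + 1 := by
  obtain ⟨h1, h2⟩ := hW.wallSep_flip_of_notMem hA h
  rw [h2]
  exact ncard_insert_of_notMem h1 (hW.wallSep_finite u v)

/-- Take `z ≠ v` between `v` and `u` with as few separating halfspaces from `v` as possible. Two
distinct such halfspaces would differ at some `w`, and the median of `v`, `z`, `w` would be a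
smaller choice; hence `z` is a neighbour of `v`. -/
lemma exists_flip_toward (hW : MedianWalls H m) {u v : M} (hne : v ≠ u) :
    ∃ a, ∃ A ∈ wallSep H u v, wallSep H a v = {A} := by
  classical
  obtain ⟨z, ⟨hzv, hz⟩, hmin⟩ := exists_minimalFor_of_wellFoundedLT
    (fun z => z ≠ v ∧ wallSep H z v ⊆ wallSep H u v) (fun z => (wallSep H z v).ncard)
    ⟨u, hne.symm, subset_rfl⟩
  have hzne : (wallSep H z v).Nonempty := by
    rw [nonempty_iff_ne_empty]
    exact fun h => hzv (hW.wallSep_eq_empty.1 h)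
  obtain ⟨A, hA⟩ := hzne
  refine ⟨z, A, hz hA, Subset.antisymm (fun B hB => ?_) (by simpa using hA)⟩
  by_contra hBA
  have aux : ∀ D E : Set M, D ∈ wallSep H z v → E ∈ wallSep H z v → ∀ w, w ∈ D → w ∉ E → False := by
    intro D E hD hE w hwD hwE
    have hsub : wallSep H (m v z w) v ⊆ wallSep H z v := by
      intro F hF
      rw [hW.mem_wallSep_median] at hF
      simp only [wallSep_self, mem_empty_iff_false, false_and, false_or, or_false] at hF
      exact hF.1
    have hD' : D ∈ wallSep H (m v z w) v := by
      rw [hW.mem_wallSep_median]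
      exact Or.inr (Or.inl ⟨hD, hD.1, hwD, hD.2.2⟩)
    have hE' : E ∉ wallSep H (m v z w) v := by
      rw [hW.mem_wallSep_median]
      simp only [wallSep_self, mem_empty_iff_false, false_and, false_or, or_false, not_and]
      intro _ h; exact hwE h.2.1
    have hlt : (wallSep H (m v z w) v).ncard < (wallSep H z v).ncard :=
      ncard_lt_ncard ⟨hsub, fun h => hE' (h hE)⟩ (hW.wallSep_finite z v)
    have := hmin (j := m v z w) ⟨fun h => by rw [h, wallSep_self] at hD'; exact hD', hsub.trans hz⟩
      hlt.le
    exact absurd this (not_le.2 hlt)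
  rw [mem_singleton_iff] at hBA
  apply hBA
  ext w
  constructor
  · intro h; by_contra h'; exact aux B A hB hA w h h'
  · intro h; by_contra h'; exact aux A B hA hB w h h'

lemma exists_walk (hW : MedianWalls H m) (v u : M) :
    ∃ p : hW.wallComplex.graph.Walk v u, p.length = (wallSep H u v).ncard := by
  induction hn : (wallSep H u v).ncard generalizing v with
  | zero =>
    rw [ncard_eq_zero (hW.wallSep_finite u v), hW.wallSep_eq_empty] at hn
    subst hn
    exact ⟨.nil, rfl⟩
  | succ n ih =>
    have hne : v ≠ u := by
      rintro rfl; simp [wallSep_self] at hn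
    obtain ⟨a, A, hA, ha⟩ := hW.exists_flip_toward hne
    have := hW.wallDist_flip_of_mem ha hA
    obtain ⟨p, hp⟩ := ih a (by omega)
    exact ⟨.cons (hW.adj_iff.2 ⟨A, ha⟩) p, by simp [hp]⟩

lemma wallDist_le_length (hW : MedianWalls H m) {v u : M} (p : hW.wallComplex.graph.Walk v u) :
    (wallSep H u v).ncard ≤ p.length := by
  induction p with
  | nil => simp [wallSep_self]
  | @cons v a u h p ih =>
    obtain ⟨A, hA⟩ := hW.adj_iff.1 h
    rw [SimpleGraph.Walk.length_cons]
    by_cases hm : A ∈ wallSep H u v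
    · have := hW.wallDist_flip_of_mem hA hm; omega
    · have := hW.wallDist_flip_of_notMem hA hm; omega

lemma graph_connected [Nonempty M] (hW : MedianWalls H m) : hW.wallComplex.graph.Connected := by
  refine ⟨fun v u => ?_⟩
  obtain ⟨p, -⟩ := hW.exists_walk v u
  exact ⟨p⟩

lemma dist_eq (hW : MedianWalls H m) (v u : M) :
    hW.wallComplex.graph.dist v u = (wallSep H u v).ncard := by
  obtain ⟨p, hp⟩ := hW.exists_walk v u
  apply le_antisymm
  · rw [← hp]; exact SimpleGraph.dist_le p
  · obtain ⟨q, hq⟩ := p.reachable.exists_walk_length_eq_dist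
    rw [← hq]; exact hW.wallDist_le_length q

/-- If the geodesics start with edges to `a` and `b`, the median of `a`, `b`, `u` is the fourth
corner of a square at `v` and still lies toward `u`. Both geodesics can be rerouted through it by
induction on the distance, and the square closes the gap. -/
lemma geodesics_homotopic (hW : MedianWalls H m) {v u : M} (p q : hW.wallComplex.graph.Walk v u)
    (hp : p.length = (wallSep H u v).ncard) (hq : q.length = (wallSep H u v).ncard) :
    hW.wallComplex.EdgeHomotopic p q := by
  classical
  induction hn : (wallSep H u v).ncard generalizing v with
  | zero =>
    rw [hn] at hp hq
    cases p with
    | nil => cases q with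
      | nil => exact .refl _
      | cons h q => simp at hq
    | cons h p => simp at hp
  | succ n ih =>
    rw [hn] at hp hq
    cases p with
    | nil => simp at hp
    | @cons _ a _ ha p =>
    cases q with
    | nil => simp at hq
    | @cons _ b _ hb q =>
    rw [SimpleGraph.Walk.length_cons] at hp hq
    obtain ⟨A, hA⟩ := hW.adj_iff.1 ha
    obtain ⟨B, hB⟩ := hW.adj_iff.1 hb
    have hpl := hW.wallDist_le_length p
    have hql := hW.wallDist_le_length q
    have hAm : A ∈ wallSep H u v := by
      by_contra h; have := hW.wallDist_flip_of_notMem hA h; omega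
    have hBm : B ∈ wallSep H u v := by
      by_contra h; have := hW.wallDist_flip_of_notMem hB h; omega
    have hca := hW.wallDist_flip_of_mem hA hAm
    have hcb := hW.wallDist_flip_of_mem hB hBm
    by_cases hab : a = b
    · subst hab
      exact (ih p q (by omega) (by omega) (by omega)).cons ha
    have hAB : A ≠ B := by
      rintro rfl; exact hab (hW.wallSep_injective (hA.trans hB.symm))
    have hw : wallSep H (m a b u) v = {A, B} := by
      ext D
      rw [hW.mem_wallSep_median, hA, hB]
      simp only [mem_singleton_iff, mem_insert_iff]
      constructor
      · rintro (⟨rfl, -⟩ | ⟨rfl, -⟩ | ⟨rfl, -⟩) <;> simp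
      · rintro (rfl | rfl)
        · exact Or.inr (Or.inr ⟨rfl, hAm⟩)
        · exact Or.inr (Or.inl ⟨rfl, hBm⟩)
    generalize m a b u = w at hw
    have hAw : A ∈ wallSep H w v := by rw [hw]; simp
    have hBw : B ∈ wallSep H w v := by rw [hw]; simp
    have haw : wallSep H w a = {B} := by
      rw [hW.wallSep_flip_of_mem hA hAw, hw]
      ext D; simp only [mem_sdiff, mem_insert_iff, mem_singleton_iff]
      constructor
      · tauto
      · rintro rfl; exact ⟨Or.inr rfl, hAB.symm⟩
    have hbw : wallSep H w b = {A} := by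
      rw [hW.wallSep_flip_of_mem hB hBw, hw]
      ext D; simp only [mem_sdiff, mem_insert_iff, mem_singleton_iff]
      constructor
      · tauto
      · rintro rfl; exact ⟨Or.inl rfl, hAB⟩
    have hcw : (wallSep H u w).ncard + 1 = (wallSep H u a).ncard := by
      apply hW.wallDist_flip_of_mem haw
      rw [hW.wallSep_flip_of_mem hA hAm]
      exact ⟨hBm, fun h => hAB h.symm⟩
    obtain ⟨r, hr⟩ := hW.exists_walk w u
    have haw' := hW.adj_iff.2 ⟨B, haw⟩
    have hbw' := hW.adj_iff.2 ⟨A, hbw⟩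
    have h1 := ih p (.cons haw' r) (by omega) (by simp; omega) (by omega)
    have h2 := ih q (.cons hbw' r) (by omega) (by simp; omega) (by omega)
    refine (h1.cons ha).trans (.trans ?_ (h2.cons hb).symm)
    refine .square .nil ha haw' hb hbw' r ?_
    obtain ⟨c, hc, hcm⟩ := hW.exists_cube v {A, B} (by
      intro D hD
      rcases Finset.mem_insert.1 hD with rfl | hD
      · exact ⟨a, hA⟩
      · obtain rfl := Finset.mem_singleton.1 hD; exact ⟨b, hB⟩) (by
      intro D hD E hE hne
      refine ⟨w, ?_⟩
      rw [hw]
      simp only [Finset.mem_insert, Finset.mem_singleton] at hD hE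
      rcases hD with rfl | rfl <;> rcases hE with rfl | rfl
      · exact absurd rfl hne
      · rfl
      · exact pair_comm _ _
      · exact absurd rfl hne)
    change _ ∈ wallCubes H
    suffices h : ({v, a, w, b} : Set M) = c by rwa [h]
    ext x
    rw [hcm, Finset.coe_insert, Finset.coe_singleton, subset_pair_iff_eq, hW.wallSep_eq_empty,
      ← hw]
    simp only [mem_insert_iff, mem_singleton_iff]
    constructor
    · rintro (rfl | rfl | rfl | rfl) <;> simp_all
    · rintro (rfl | h | h | h)
      · simp
      · rw [← hA] at h; simp [hW.wallSep_injective h]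
      · rw [← hB] at h; simp [hW.wallSep_injective h]
      · simp [hW.wallSep_injective h]

/-- After replacing the tail by a geodesic, the first edge either extends it to a geodesic or starts
a backtrack. -/
lemma walk_homotopic_geodesic (hW : MedianWalls H m) {v u : M}
    (p g : hW.wallComplex.graph.Walk v u) (hg : g.length = (wallSep H u v).ncard) :
    hW.wallComplex.EdgeHomotopic p g := by
  induction p with
  | nil =>
    rw [wallSep_self, ncard_empty] at hg
    rw [(SimpleGraph.Walk.length_eq_zero_iff.1 hg).eq_nil]
    exact .refl _
  | @cons v a u ha p ih =>
    obtain ⟨A, hA⟩ := hW.adj_iff.1 ha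
    obtain ⟨g', hg'⟩ := hW.exists_walk a u
    refine ((ih g' hg').cons ha).trans ?_
    by_cases h : A ∈ wallSep H u v
    · have := hW.wallDist_flip_of_mem hA h
      exact hW.geodesics_homotopic _ _ (by simp; omega) hg
    · have := hW.wallDist_flip_of_notMem hA h
      have h2 := hW.geodesics_homotopic g' (.cons ha.symm g) hg' (by simp; omega)
      exact (h2.cons ha).trans (.backtrack .nil ha g)

lemma isCATZero [Nonempty M] (hW : MedianWalls H m) : hW.wallComplex.IsCATZero :=
  ⟨⟨hW.graph_connected, fun v p => hW.walk_homotopic_geodesic p .nil (by simp [wallSep_self])⟩,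
    hW.hasFlagLinks⟩

end MedianWalls

/-! ### Generating a median subalgebra in boundedly many rounds. -/

namespace MedianWalls

variable {M : Type*} {H : Set (Set M)} {m : M → M → M → M}

/-- Points obtained from `S` by at most `k` rounds of taking medians. -/
def medianIter (m : M → M → M → M) (S : Set M) : ℕ → Set M
  | 0 => S
  | k + 1 => {x | ∃ a ∈ medianIter m S k, ∃ b ∈ medianIter m S k, ∃ c ∈ medianIter m S k,
      x = m a b c}

/-- The median subalgebra generated by `S`. -/
def medianSpan (m : M → M → M → M) (S : Set M) : Set M := ⋃ k, medianIter m S k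

lemma median_self (hW : MedianWalls H m) (a : M) : m a a a = a :=
  hW.ext fun A hA h => by simpa [hW.majority A hA] using h

lemma medianIter_mono (hW : MedianWalls H m) (S : Set M) : Monotone (medianIter m S) :=
  monotone_nat_of_le_succ fun _ x hx => ⟨x, hx, x, hx, x, hx, (hW.median_self x).symm⟩

lemma subset_medianSpan (S : Set M) : S ⊆ medianSpan m S := subset_iUnion (medianIter m S) 0

lemma median_mem_medianSpan (hW : MedianWalls H m) {S : Set M} {a b c : M}
    (ha : a ∈ medianSpan m S) (hb : b ∈ medianSpan m S) (hc : c ∈ medianSpan m S) :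
    m a b c ∈ medianSpan m S := by
  obtain ⟨i, ha⟩ := mem_iUnion.1 ha
  obtain ⟨j, hb⟩ := mem_iUnion.1 hb
  obtain ⟨k, hc⟩ := mem_iUnion.1 hc
  refine mem_iUnion.2 ⟨max i (max j k) + 1, a, ?_, b, ?_, c, ?_, rfl⟩
  · exact hW.medianIter_mono S (by omega) ha
  · exact hW.medianIter_mono S (by omega) hb
  · exact hW.medianIter_mono S (by omega) hc

/-- On any two halfspaces a point generated by `S` agrees with a member of `S`. -/
lemma exists_agree_pair (hW : MedianWalls H m) {S : Set M} {k : ℕ} {x : M}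
    (hx : x ∈ medianIter m S k) {A B : Set M} (hA : A ∈ H) (hB : B ∈ H) :
    ∃ s ∈ S, (s ∈ A ↔ x ∈ A) ∧ (s ∈ B ↔ x ∈ B) := by
  induction k generalizing x with
  | zero => exact ⟨x, hx, Iff.rfl, Iff.rfl⟩
  | succ k ih =>
    obtain ⟨a, ha, b, hb, c, hc, rfl⟩ := hx
    rw [hW.majority A hA, hW.majority B hB]
    obtain ⟨s, hs, h1⟩ := ih ha
    obtain ⟨t, ht, h2⟩ := ih hb
    obtain ⟨r, hr, h3⟩ := ih hc
    -- Two of the three points vote with the median on `A` and two do so on `B`, so one of them does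
    -- both.
    have : (∃ z ∈ ({a, b, c} : Set M), (z ∈ A ↔ (a ∈ A ∧ b ∈ A ∨ b ∈ A ∧ c ∈ A ∨ a ∈ A ∧ c ∈ A)) ∧
        (z ∈ B ↔ (a ∈ B ∧ b ∈ B ∨ b ∈ B ∧ c ∈ B ∨ a ∈ B ∧ c ∈ B))) := by
      simp only [mem_insert_iff, mem_singleton_iff, exists_eq_or_imp, exists_eq_left]
      by_cases h1 : a ∈ A <;> by_cases h2 : b ∈ A <;> by_cases h3 : c ∈ A <;>
        by_cases h4 : a ∈ B <;> by_cases h5 : b ∈ B <;> by_cases h6 : c ∈ B <;>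
        simp [h1, h2, h3, h4, h5, h6]
    obtain ⟨z, hz, h4, h5⟩ := this
    rw [← h4, ← h5]
    rcases hz with rfl | rfl | rfl
    · exact ⟨s, hs, h1⟩
    · exact ⟨t, ht, h2⟩
    · exact ⟨r, hr, h3⟩

lemma nonempty_of_mem_medianIter {S : Set M} {k : ℕ} {x : M} (hx : x ∈ medianIter m S k) :
    S.Nonempty := by
  induction k generalizing x with
  | zero => exact ⟨x, hx⟩
  | succ k ih =>
    obtain ⟨a, ha, -⟩ := hx
    exact ih ha

/-- On finitely many halfspaces a point generated by `S` agrees with a point obtained from `S` by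
a bounded number of medians. -/
lemma exists_agree_finset (hW : MedianWalls H m) {S : Set M} {x : M} (hx : x ∈ medianSpan m S)
    (n : ℕ) (F : Finset (Set M)) (hF : ∀ A ∈ F, A ∈ H) (hn : F.card ≤ n + 2) :
    ∃ y ∈ medianIter m S n, ∀ A ∈ F, (y ∈ A ↔ x ∈ A) := by
  classical
  induction n generalizing F with
  | zero =>
    obtain ⟨k, hk⟩ := mem_iUnion.1 hx
    have : F.card = 0 ∨ F.card = 1 ∨ F.card = 2 := by omega
    rcases this with h | h | h
    · obtain ⟨s, hs⟩ := nonempty_of_mem_medianIter hk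
      rw [Finset.card_eq_zero.1 h]
      exact ⟨s, hs, by simp⟩
    · obtain ⟨A, rfl⟩ := Finset.card_eq_one.1 h
      have hA := hF A (by simp)
      obtain ⟨s, hs, h1, -⟩ := hW.exists_agree_pair hk hA hA
      exact ⟨s, hs, by simpa using h1⟩
    · obtain ⟨A, B, hAB, rfl⟩ := Finset.card_eq_two.1 h
      obtain ⟨s, hs, h1⟩ := hW.exists_agree_pair hk (hF A (by simp)) (hF B (by simp))
      exact ⟨s, hs, by simpa using h1⟩
  | succ n ih =>
    by_cases h3 : 2 < F.card
    · have sub : ∀ A ∈ F, ∃ y ∈ medianIter m S n, ∀ B ∈ F, B ≠ A → (y ∈ B ↔ x ∈ B) := by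
        intro A hA
        obtain ⟨y, hy, h⟩ := ih (F.erase A) (fun B hB => hF B (Finset.mem_of_mem_erase hB))
          (by rw [Finset.card_erase_of_mem hA]; omega)
        exact ⟨y, hy, fun B hB hne => h B (Finset.mem_erase.2 ⟨hne, hB⟩)⟩
      obtain ⟨A, B, C, hA, hB, hC, hAB, hAC, hBC⟩ := Finset.two_lt_card_iff.1 h3
      obtain ⟨a, ha, ha'⟩ := sub A hA
      obtain ⟨b, hb, hb'⟩ := sub B hB
      obtain ⟨c, hc, hc'⟩ := sub C hC
      -- Each of `a`, `b`, `c` may fail on one halfspace only, and these three are distinct, so the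
      -- majority is right everywhere. One round gains one halfspace.
      refine ⟨m a b c, ⟨a, ha, b, hb, c, hc, rfl⟩, fun D hD => ?_⟩
      rw [hW.majority D (hF D hD)]
      by_cases hDA : D = A
      · subst hDA
        rw [hb' D hD hAB, hc' D hD hAC]; tauto
      · by_cases hDB : D = B
        · subst hDB
          rw [ha' D hD hDA, hc' D hD hBC]; tauto
        · rw [ha' D hD hDA, hb' D hD hDB]; tauto
    · obtain ⟨y, hy, h⟩ := ih F hF (by omega)
      exact ⟨y, hW.medianIter_mono S (Nat.le_succ n) hy, h⟩

/-- The maximal halfspaces among those containing `y` but not `x`. -/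
def maximalSep (H : Set (Set M)) (x y : M) : Set (Set M) :=
  {A ∈ wallSep H y x | ∀ B ∈ H, x ∉ B → A ⊆ B → B ⊆ A}

lemma maximalSep_finite (hW : MedianWalls H m) (x y : M) : (maximalSep H x y).Finite :=
  (hW.wallSep_finite y x).subset (sep_subset _ _)

lemma maximalSep_nonempty (hW : MedianWalls H m) {x y : M} (hne : y ≠ x) :
    (maximalSep H x y).Nonempty := by
  obtain ⟨A, hA, hmax⟩ := (hW.wallSep_finite y x).exists_maximal
    (by rw [nonempty_iff_ne_empty]; exact fun h => hne (hW.wallSep_eq_empty.1 h))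
  exact ⟨A, hA, fun B hB hx hAB => hmax ⟨hB, hAB hA.2.1, hx⟩ hAB⟩

/-- Two distinct maximal halfspaces cross: both contain `y`, both avoid `x`, and neither contains
the other. -/
lemma maximalSep_ncard_le {N : ℕ} (hN : CrossingBound H N) (hW : MedianWalls H m) (x y : M) :
    (maximalSep H x y).ncard ≤ N := by
  have hf := hW.maximalSep_finite x y
  apply hN _ (fun i => ((hf.equivFin).symm i).1)
  · intro i; exact ((hf.equivFin).symm i).2.1.1
  · intro i j hij β γ
    have hne : ((hf.equivFin).symm i).1 ≠ ((hf.equivFin).symm j).1 := by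
      intro h; exact hij ((hf.equivFin).symm.injective (Subtype.ext h))
    generalize (hf.equivFin).symm i = A at hne ⊢
    generalize (hf.equivFin).symm j = B at hne ⊢
    obtain ⟨A, ⟨hA, hyA, hxA⟩, hmA⟩ := A
    obtain ⟨B, ⟨hB, hyB, hxB⟩, hmB⟩ := B
    simp only at hne ⊢
    by_cases hβ : β <;> by_cases hγ : γ
    · exact ⟨y, by simp [*], by simp [*]⟩
    · have : ¬ A ⊆ B := fun h => hne (h.antisymm (hmA B hB hxB h))
      obtain ⟨z, h1, h2⟩ := not_subset.1 this
      exact ⟨z, by simp [*], by simp [*]⟩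
    · have : ¬ B ⊆ A := fun h => hne ((hmB A hA hxA h).antisymm h)
      obtain ⟨z, h1, h2⟩ := not_subset.1 this
      exact ⟨z, by simp [*], by simp [*]⟩
    · exact ⟨x, by simp [*], by simp [*]⟩

/-- If pairwise crossing families are bounded, then the subalgebra generated by a set is reached
after a bounded number of medians. -/
lemma medianIter_eq_univ (hW : MedianWalls H m) {N : ℕ} (hN : CrossingBound H N) {S : Set M}
    (hS : medianSpan m S = univ) (x : M) : x ∈ medianIter m S (2 * N + 1) := by
  classical
  have hx : x ∈ medianSpan m S := hS ▸ mem_univ x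
  -- A point that agrees with `x` on `F` avoids all members of `F`, so none of them can separate it
  -- from `x`.
  have agree : ∀ n (F : Set (Set M)), F.Finite → F.ncard ≤ n → (∀ A ∈ F, A ∈ H ∧ x ∉ A) →
      ∃ y ∈ medianIter m S n, Disjoint (maximalSep H x y) F := by
    intro n F hF hn hFH
    obtain ⟨y, hy, h⟩ := hW.exists_agree_finset hx n hF.toFinset
      (fun A hA => (hFH A (by simpa using hA)).1)
      (by rw [← ncard_eq_toFinset_card F hF]; omega)
    refine ⟨y, hy, disjoint_left.2 fun A hA hAF => ?_⟩
    exact (hFH A hAF).2 ((h A (by simpa using hAF)).1 hA.1.2.1)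
  obtain ⟨k, hk⟩ := mem_iUnion.1 hx
  obtain ⟨a, ha⟩ := nonempty_of_mem_medianIter hk
  have hT : ∀ y, ∀ A ∈ maximalSep H x y, A ∈ H ∧ x ∉ A := fun y A hA => ⟨hA.1.1, hA.1.2.2⟩
  -- The point `b` has to avoid at most `N` halfspaces and `c` at most `2 * N`, namely those for `a`
  -- and for `b`. The median of `a`, `b`, `c` is the one extra round in `2 * N + 1`.
  obtain ⟨b, hb, hab⟩ := agree N _ (hW.maximalSep_finite x a) (maximalSep_ncard_le hN hW x a) (hT a)
  obtain ⟨c, hc, habc⟩ := agree (2 * N) (maximalSep H x a ∪ maximalSep H x b)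
    ((hW.maximalSep_finite x a).union (hW.maximalSep_finite x b))
    (by
      have := ncard_union_le (maximalSep H x a) (maximalSep H x b)
      have := maximalSep_ncard_le hN hW x a
      have := maximalSep_ncard_le hN hW x b
      omega)
    (by rintro A (hA | hA) <;> exact hT _ A hA)
  refine ⟨a, hW.medianIter_mono S (Nat.zero_le _) ha, b,
    hW.medianIter_mono S (by omega) hb, c, hc, ?_⟩
  by_contra hne
  obtain ⟨A, ⟨hA, hmA, hxA⟩, hmax⟩ := hW.maximalSep_nonempty (Ne.symm hne)
  -- Maximality refers to `x` only, so `A` is maximal for every point that it contains. Since `A`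
  -- contains two of `a`, `b`, `c`, the disjointness above is violated.
  have hmem : ∀ y, y ∈ A → A ∈ maximalSep H x y := fun y hy => ⟨⟨hA, hy, hxA⟩, hmax⟩
  rw [disjoint_left] at hab habc
  rcases (hW.majority A hA a b c).1 hmA with ⟨h1, h2⟩ | ⟨h1, h2⟩ | ⟨h1, h2⟩
  · exact hab (hmem b h2) (hmem a h1)
  · exact habc (hmem c h2) (Or.inr (hmem b h1))
  · exact habc (hmem c h2) (Or.inl (hmem a h1))

/-! ### Restriction to a median subalgebra -/

variable (H) in
/-- The traces of halfspaces on a subset. -/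
def traceWalls (S : Set M) : Set (Set S) := (fun A : Set M => (Subtype.val ⁻¹' A : Set S)) '' H

lemma trace (hW : MedianWalls H m) {S : Set M} (m' : S → S → S → S)
    (hm' : ∀ a b c, (m' a b c : M) = m a b c) : MedianWalls (traceWalls H S) m' where
  compl_mem := by
    rintro _ ⟨A, hA, rfl⟩
    exact ⟨Aᶜ, hW.compl_mem A hA, rfl⟩
  finite_sep x y := by
    refine ((hW.finite_sep x y).image (fun A : Set M => (Subtype.val ⁻¹' A : Set S))).subset ?_
    rintro _ ⟨⟨A, hA, rfl⟩, h1, h2⟩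
    exact ⟨A, ⟨hA, h1, h2⟩, rfl⟩
  exists_sep x y hne := by
    obtain ⟨A, hA, h⟩ := hW.exists_sep x y (fun h => hne (Subtype.ext h))
    exact ⟨_, ⟨A, hA, rfl⟩, h⟩
  majority := by
    rintro _ ⟨A, hA, rfl⟩ x y z
    simp only [mem_preimage, hm', hW.majority A hA]

lemma crossingBound_trace {N : ℕ} (hN : CrossingBound H N) (S : Set M) :
    CrossingBound (traceWalls H S) N := by
  intro n A hA hcross
  choose B hB hBA using hA
  refine hN n B hB fun i j hij β γ => ?_
  obtain ⟨x, h1, h2⟩ := hcross i j hij β γ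
  rw [← hBA] at h1 h2
  exact ⟨x, h1, h2⟩

lemma wallSep_traceWalls (S : Set M) (x y : S) :
    wallSep (traceWalls H S) x y =
      (fun A : Set M => (Subtype.val ⁻¹' A : Set S)) '' wallSep H (x : M) y := by
  ext B
  constructor
  · rintro ⟨⟨A, hA, rfl⟩, h1, h2⟩
    exact ⟨A, ⟨hA, h1, h2⟩, rfl⟩
  · rintro ⟨A, ⟨hA, h1, h2⟩, rfl⟩
    exact ⟨⟨A, hA, rfl⟩, h1, h2⟩

lemma wallDist_trace_le (hW : MedianWalls H m) (S : Set M) (x y : S) :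
    (wallSep (traceWalls H S) x y).ncard ≤ (wallSep H (x : M) y).ncard := by
  rw [wallSep_traceWalls]
  exact ncard_image_le (hW.wallSep_finite _ _)

/-- If `S` is connected by jumps of length `r`, then at most `r` halfspaces have the same nontrivial
trace on `S`, so that distances in `S` are distorted by at most a factor `r`. -/
lemma wallDist_le_trace (hW : MedianWalls H m) {S : Set M} {r : ℕ}
    (hS : ∀ x y : S, Relation.ReflTransGen (fun a b : S => (wallSep H (a : M) b).ncard ≤ r) x y)
    (x y : S) :
    (wallSep H (x : M) y).ncard ≤ r * (wallSep (traceWalls H S) x y).ncard := by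
  classical
  -- A chain of jumps from `x` to `y` has to leave `B` at some jump.
  have jump : ∀ (B : Set S), x ∈ B → y ∉ B →
      ∃ a b : S, a ∈ B ∧ b ∉ B ∧ (wallSep H (a : M) b).ncard ≤ r := by
    intro B hx hy
    by_contra! hcon
    have : ∀ z, Relation.ReflTransGen (fun a b : S => (wallSep H (a : M) b).ncard ≤ r) x z →
        z ∈ B := by
      intro z hz
      induction hz with
      | refl => exact hx
      | @tail b c _ hbc ih =>
        by_contra hc
        exact absurd hbc (not_le.2 (hcon b c ih hc))
    exact hy (this y (hS x y))
  have hf := hW.wallSep_finite (x : M) y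
  have hft : (wallSep (traceWalls H S) x y).Finite := by
    rw [wallSep_traceWalls]; exact hf.image _
  rw [ncard_eq_toFinset_card _ hf, ncard_eq_toFinset_card _ hft, mul_comm]
  -- Count fibres of the trace map: all halfspaces with trace `B` separate the ends of the same
  -- jump, so a fibre has at most `r` members.
  refine (Finset.card_le_mul_card_image_of_maps_to
    (f := fun A : Set M => (Subtype.val ⁻¹' A : Set S)) ?_ r ?_).trans (by rw [mul_comm])
  · intro A hA
    simp only [Finite.mem_toFinset] at hA ⊢
    rw [wallSep_traceWalls]
    exact ⟨A, hA, rfl⟩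
  · intro B hB
    simp only [Finite.mem_toFinset] at hB
    obtain ⟨a, b, ha, hb, hab⟩ := jump B hB.2.1 hB.2.2
    refine le_trans ?_ hab
    rw [ncard_eq_toFinset_card _ (hW.wallSep_finite (a : M) b)]
    apply Finset.card_le_card
    intro A hA
    simp only [Finset.mem_filter, Finite.mem_toFinset] at hA ⊢
    obtain ⟨hA, rfl⟩ := hA
    exact ⟨hA.1, ha, hb⟩

/-! ### Distance estimates -/

lemma wallDist_comm (hW : MedianWalls H m) (x y : M) :
    (wallSep H x y).ncard = (wallSep H y x).ncard := by
  have aux : ∀ x y : M, (wallSep H x y).ncard ≤ (wallSep H y x).ncard := by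
    intro x y
    refine ncard_le_ncard_of_injOn compl ?_ (compl_injective.injOn) (hW.wallSep_finite _ _)
    rintro A ⟨hA, h1, h2⟩
    exact ⟨hW.compl_mem A hA, h2, fun h => h h1⟩
  exact le_antisymm (aux x y) (aux y x)

lemma wallDist_triangle (hW : MedianWalls H m) (x y z : M) :
    (wallSep H x z).ncard ≤ (wallSep H x y).ncard + (wallSep H y z).ncard := by
  refine (ncard_le_ncard ?_ ((hW.wallSep_finite x y).union (hW.wallSep_finite y z))).trans
    (ncard_union_le _ _)
  rintro A ⟨hA, h1, h2⟩
  by_cases hy : y ∈ A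
  · exact Or.inr ⟨hA, hy, h2⟩
  · exact Or.inl ⟨hA, h1, hy⟩

lemma wallDist_median_le (hW : MedianWalls H m) (a b c a' b' c' : M) :
    (wallSep H (m a b c) (m a' b' c')).ncard ≤
      (wallSep H a a').ncard + (wallSep H b b').ncard + (wallSep H c c').ncard := by
  refine (ncard_le_ncard (t := wallSep H a a' ∪ wallSep H b b' ∪ wallSep H c c') ?_
    (((hW.wallSep_finite _ _).union (hW.wallSep_finite _ _)).union (hW.wallSep_finite _ _))).trans
    ((ncard_union_le _ _).trans (Nat.add_le_add_right (ncard_union_le _ _) _))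
  rintro A ⟨hA, h1, h2⟩
  rw [hW.majority A hA] at h1 h2
  simp only [mem_union, wallSep, mem_ofPred_eq, hA, true_and]
  tauto

/-- Going from `a` to `b` through `p` crosses a halfspace containing `p` but neither end twice, once
as its complement and once as itself. A halfspace separating `a` from `b` is crossed at least once.
-/
lemma two_mul_ncard_excess_le (hW : MedianWalls H m) (a b p : M) :
    (wallSep H a b).ncard + 2 * {A ∈ H | p ∈ A ∧ a ∉ A ∧ b ∉ A}.ncard ≤
      (wallSep H a p).ncard + (wallSep H p b).ncard := by
  have hT : {A ∈ H | p ∈ A ∧ a ∉ A ∧ b ∉ A}.Finite :=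
    (hW.wallSep_finite p a).subset fun A h => ⟨h.1, h.2.1, h.2.2.1⟩
  have h1 : (wallSep H p b ∩ wallSep H a b).ncard + {A ∈ H | p ∈ A ∧ a ∉ A ∧ b ∉ A}.ncard ≤
      (wallSep H p b).ncard := by
    rw [← ncard_union_eq _ ((hW.wallSep_finite p b).inter_of_left _) hT]
    · apply ncard_le_ncard _ (hW.wallSep_finite p b)
      rintro A (h | h)
      · exact h.1
      · exact ⟨h.1, h.2.1, h.2.2.2⟩
    · exact disjoint_left.2 fun A h h' => h'.2.2.1 h.2.2.1
  have h2 : (wallSep H a p ∩ wallSep H a b).ncard + {A ∈ H | p ∈ A ∧ a ∉ A ∧ b ∉ A}.ncard ≤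
      (wallSep H a p).ncard := by
    rw [← ncard_image_of_injective {A ∈ H | p ∈ A ∧ a ∉ A ∧ b ∉ A} compl_injective,
      ← ncard_union_eq _ ((hW.wallSep_finite a p).inter_of_left _) (hT.image _)]
    · apply ncard_le_ncard _ (hW.wallSep_finite a p)
      rintro A (h | ⟨A, h, rfl⟩)
      · exact h.1
      · exact ⟨hW.compl_mem A h.1, h.2.2.1, fun h' => h' h.2.1⟩
    · rw [disjoint_left]
      rintro _ h ⟨A, h', rfl⟩
      exact h.2.2.2 h'.2.2.2
  have h3 : wallSep H a b ⊆ (wallSep H p b ∩ wallSep H a b) ∪ (wallSep H a p ∩ wallSep H a b) := by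
    intro A hA
    by_cases hp : p ∈ A
    · exact Or.inl ⟨⟨hA.1, hp, hA.2.2⟩, hA⟩
    · exact Or.inr ⟨⟨hA.1, hA.2.1, hp⟩, hA⟩
  have h4 := (ncard_le_ncard h3 (((hW.wallSep_finite p b).inter_of_left _).union
    ((hW.wallSep_finite a p).inter_of_left _))).trans (ncard_union_le _ _)
  omega

/-- An approximate median is close to the median. -/
lemma wallDist_median_le_of_approx (hW : MedianWalls H m) {a b c p : M} {e : ℕ}
    (hab : (wallSep H a p).ncard + (wallSep H p b).ncard ≤ (wallSep H a b).ncard + e)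
    (hbc : (wallSep H b p).ncard + (wallSep H p c).ncard ≤ (wallSep H b c).ncard + e)
    (hac : (wallSep H a p).ncard + (wallSep H p c).ncard ≤ (wallSep H a c).ncard + e) :
    (wallSep H p (m a b c)).ncard ≤ 2 * e := by
  have h1 := hW.two_mul_ncard_excess_le a b p
  have h2 := hW.two_mul_ncard_excess_le b c p
  have h3 := hW.two_mul_ncard_excess_le a c p
  have hT : ∀ a b, {A ∈ H | p ∈ A ∧ a ∉ A ∧ b ∉ A}.Finite := fun a b =>
    (hW.wallSep_finite p a).subset fun A h => ⟨h.1, h.2.1, h.2.2.1⟩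
  -- A halfspace containing `p` but not the median misses two of `a`, `b`, `c`. Each of the three
  -- resulting sets has at most `e / 2` members, so `2 * e` is ample.
  have hsub : wallSep H p (m a b c) ⊆ {A ∈ H | p ∈ A ∧ a ∉ A ∧ b ∉ A} ∪
      {A ∈ H | p ∈ A ∧ b ∉ A ∧ c ∉ A} ∪ {A ∈ H | p ∈ A ∧ a ∉ A ∧ c ∉ A} := by
    rintro A ⟨hA, hp, hm⟩
    rw [hW.majority A hA] at hm
    simp only [mem_union, mem_ofPred_eq, hA, hp, true_and]
    tauto
  have h4 := (ncard_le_ncard hsub (((hT _ _).union (hT _ _)).union (hT _ _))).trans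
    ((ncard_union_le _ _).trans (Nat.add_le_add_right (ncard_union_le _ _) _))
  omega

/-- Bounded iteration of medians moves points a bounded distance away. -/
lemma exists_near_of_mem_medianIter (hW : MedianWalls H m) {S : Set M} {D : ℕ}
    (hS : ∀ a ∈ S, ∀ b ∈ S, ∀ c ∈ S, ∃ s ∈ S, (wallSep H s (m a b c)).ncard ≤ D) (k : ℕ) :
    ∃ R : ℕ, ∀ x ∈ medianIter m S k, ∃ s ∈ S, (wallSep H s x).ncard ≤ R := by
  induction k with
  | zero => exact ⟨0, fun x hx => ⟨x, hx, by simp [wallSep_self]⟩⟩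
  | succ k ih =>
    obtain ⟨R, hR⟩ := ih
    -- The median moves by at most the sum `3 * R` of the displacements of its arguments; `D` is the
    -- defect of closedness of `S`.
    refine ⟨D + 3 * R, ?_⟩
    rintro _ ⟨a, ha, b, hb, c, hc, rfl⟩
    obtain ⟨a', ha', h1⟩ := hR a ha
    obtain ⟨b', hb', h2⟩ := hR b hb
    obtain ⟨c', hc', h3⟩ := hR c hc
    obtain ⟨s, hs, h⟩ := hS a' ha' b' hb' c' hc'
    refine ⟨s, hs, ?_⟩
    have h4 := hW.wallDist_triangle s (m a' b' c') (m a b c)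
    have h5 := hW.wallDist_median_le a' b' c' a b c
    omega

end MedianWalls

/-! ### Edges, squares and corners of cubes in charts. -/

/-- Change one coordinate of a vertex of the discrete cube. -/
def boolFlip {n : ℕ} (b : Fin n → Bool) (i : Fin n) : Fin n → Bool :=
  Function.update b i (! b i)

lemma boolFlip_same {n : ℕ} (b : Fin n → Bool) (i : Fin n) : boolFlip b i i = ! b i := by
  simp [boolFlip]

lemma boolFlip_of_ne {n : ℕ} (b : Fin n → Bool) {i j : Fin n} (h : j ≠ i) :
    boolFlip b i j = b j := by
  simp [boolFlip, h]

lemma boolFlip_ne {n : ℕ} (b : Fin n → Bool) (i : Fin n) : boolFlip b i ≠ b := by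
  intro h
  have := congrFun h i
  simp [boolFlip] at this

lemma boolFlip_injective {n : ℕ} (b : Fin n → Bool) : Function.Injective (boolFlip b) := by
  intro i j h
  by_contra hij
  have := congrFun h i
  rw [boolFlip_same, boolFlip_of_ne b hij] at this
  simp at this

lemma boolFlip_comm {n : ℕ} (b : Fin n → Bool) (i j : Fin n) :
    boolFlip (boolFlip b i) j = boolFlip (boolFlip b j) i := by
  by_cases h : i = j
  · rw [h]
  · funext k
    by_cases hi : k = i
    · subst hi
      simp [boolFlip_same, boolFlip_of_ne _ h]
    · by_cases hj : k = j
      · subst hj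
        simp [boolFlip_same, boolFlip_of_ne _ hi]
      · simp [boolFlip_of_ne _ hi, boolFlip_of_ne _ hj]

lemma boolFlip_boolFlip {n : ℕ} (b : Fin n → Bool) (i : Fin n) :
    boolFlip (boolFlip b i) i = b := by
  simp [boolFlip]

lemma boolFlip_boolFlip_ne {n : ℕ} (b : Fin n → Bool) {i j : Fin n} (h : i ≠ j) :
    boolFlip (boolFlip b i) j ≠ b := by
  intro e
  have := congrFun e i
  rw [boolFlip_of_ne _ h, boolFlip_same] at this
  simp at this

namespace CubeComplex

variable {V : Type*} {K : CubeComplex V}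

lemma edge_mem_of_chart {n : ℕ} {φ : (Fin n → Bool) → V} (h : IsCubeChart K.cubes φ)
    (b : Fin n → Bool) (i : Fin n) : ({φ b, φ (boolFlip b i)} : Set V) ∈ K.cubes := by
  refine (h.2 _ ?_).2 ⟨fun j => if j = i then none else some (b j), ?_⟩
  · rintro x (rfl | rfl) <;> exact ⟨_, rfl⟩
  · rw [← image_pair]
    congr 1
    ext c
    simp only [mem_insert_iff, mem_singleton_iff, cubeFace, mem_ofPred_eq]
    constructor
    · rintro (rfl | rfl) j β hj
      · by_cases hji : j = i <;> simp_all
      · by_cases hji : j = i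
        · simp [hji] at hj
        · rw [boolFlip_of_ne _ hji]; simpa [hji] using hj
    · intro hc
      by_cases hi : c i = b i
      · left
        funext j
        by_cases hji : j = i
        · rw [hji, hi]
        · exact hc j (b j) (by simp [hji])
      · right
        funext j
        by_cases hji : j = i
        · subst hji; rw [boolFlip_same]; cases h1 : c j <;> cases h2 : b j <;> simp_all
        · rw [boolFlip_of_ne _ hji]; exact hc j (b j) (by simp [hji])

lemma adj_of_chart {n : ℕ} {φ : (Fin n → Bool) → V} (h : IsCubeChart K.cubes φ)
    (b : Fin n → Bool) (i : Fin n) : K.graph.Adj (φ b) (φ (boolFlip b i)) :=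
  ⟨fun e => boolFlip_ne b i (h.1 e.symm), edge_mem_of_chart h b i⟩

lemma square_mem_of_chart {n : ℕ} {φ : (Fin n → Bool) → V} (h : IsCubeChart K.cubes φ)
    (b : Fin n → Bool) {i k : Fin n} (hik : i ≠ k) :
    ({φ b, φ (boolFlip b i), φ (boolFlip (boolFlip b i) k), φ (boolFlip b k)} : Set V) ∈
      K.cubes := by
  refine (h.2 _ ?_).2 ⟨fun j => if j = i ∨ j = k then none else some (b j), ?_⟩
  · rintro x (rfl | rfl | rfl | rfl) <;> exact ⟨_, rfl⟩
  · rw [← image_pair, ← image_insert_eq, ← image_insert_eq]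
    congr 1
    ext c
    simp only [mem_insert_iff, mem_singleton_iff, cubeFace, mem_ofPred_eq]
    constructor
    · intro hc j β hj
      have hjik : ¬ (j = i ∨ j = k) := by
        intro hh; simp [hh] at hj
      rw [if_neg hjik] at hj
      cases hj
      push Not at hjik
      rcases hc with rfl | rfl | rfl | rfl <;> simp [boolFlip_of_ne, hjik.1, hjik.2]
    · intro hc
      have key : ∀ d : Fin n → Bool, (∀ j, j ≠ i → j ≠ k → d j = b j) → d i = c i → d k = c k →
          c = d := by
        intro d hd hi hk
        funext j
        by_cases hji : j = i
        · rw [hji, hi]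
        · by_cases hjk : j = k
          · rw [hjk, hk]
          · rw [hd j hji hjk]; exact hc j (b j) (by simp [hji, hjk])
      have hn : ∀ x y : Bool, ¬ x = y → (!y) = x := by decide
      by_cases hi : c i = b i <;> by_cases hk : c k = b k
      · exact Or.inl (key _ (fun _ _ _ => rfl) hi.symm hk.symm)
      · refine Or.inr (Or.inr (Or.inr (key _ (fun j _ h => boolFlip_of_ne _ h) ?_ ?_)))
        · rw [boolFlip_of_ne _ hik, hi]
        · rw [boolFlip_same, hn _ _ hk]
      · refine Or.inr (Or.inl (key _ (fun j h _ => boolFlip_of_ne _ h) ?_ ?_))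
        · rw [boolFlip_same, hn _ _ hi]
        · rw [boolFlip_of_ne _ hik.symm, hk]
      · refine Or.inr (Or.inr (Or.inl (key _ (fun j h h' => ?_) ?_ ?_)))
        · rw [boolFlip_of_ne _ h', boolFlip_of_ne _ h]
        · rw [boolFlip_of_ne _ hik, boolFlip_same, hn _ _ hi]
        · rw [boolFlip_same, boolFlip_of_ne _ hik.symm, hn _ _ hk]

/-- The edge is a face of the chart. If `b` and `c` differ at `i`, then `i` is free in that face, so
the flip of `b` at `i` belongs to it and must be `c`. -/
lemma exists_flip_of_adj {n : ℕ} {φ : (Fin n → Bool) → V} (h : IsCubeChart K.cubes φ)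
    {b c : Fin n → Bool} (hbc : K.graph.Adj (φ b) (φ c)) : ∃ i, c = boolFlip b i := by
  obtain ⟨σ, hσ⟩ := (h.2 {φ b, φ c} (by rintro x (rfl | rfl) <;> exact ⟨_, rfl⟩)).1 hbc.2
  rw [← image_pair, h.1.image_injective.eq_iff] at hσ
  have hne : b ≠ c := by rintro rfl; exact hbc.1 rfl
  obtain ⟨i, hi⟩ := Function.ne_iff.1 hne
  have hb : b ∈ cubeFace σ := by rw [← hσ]; simp
  have hc : c ∈ cubeFace σ := by rw [← hσ]; simp
  have : boolFlip b i ∈ ({b, c} : Set (Fin n → Bool)) := by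
    rw [hσ]
    intro j β hj
    by_cases hji : j = i
    · subst hji
      exact absurd ((hb j β hj).trans (hc j β hj).symm) hi
    · rw [boolFlip_of_ne _ hji]; exact hb j β hj
  rcases this with h' | h'
  · exact absurd h' (boolFlip_ne b i)
  · exact ⟨i, h'.symm⟩

lemma ncard_cube {c : Set V} (hc : c ∈ K.cubes) : ∃ n : ℕ, c.ncard = 2 ^ n := by
  obtain ⟨n, φ, hφ, rfl⟩ := K.exists_chart c hc
  refine ⟨n, ?_⟩
  rw [← image_univ, ncard_image_of_injective _ hφ.1, ncard_univ]
  simp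

/-- `u, a, w, b` are the vertices of a square, in cyclic order. -/
structure IsSquare (K : CubeComplex V) (u a w b : V) : Prop where
  adj₁ : K.graph.Adj u a
  adj₂ : K.graph.Adj a w
  adj₃ : K.graph.Adj w b
  adj₄ : K.graph.Adj b u
  ne₁ : u ≠ w
  ne₂ : a ≠ b
  mem : ({u, a, w, b} : Set V) ∈ K.cubes

namespace IsSquare

lemma rotate {u a w b : V} (h : K.IsSquare u a w b) : K.IsSquare a w b u :=
  ⟨h.adj₂, h.adj₃, h.adj₄, h.adj₁, h.ne₂, h.ne₁.symm, by
    have : ({a, w, b, u} : Set V) = {u, a, w, b} := by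
      ext; simp only [mem_insert_iff, mem_singleton_iff]; tauto
    rw [this]; exact h.mem⟩

lemma symm {u a w b : V} (h : K.IsSquare u a w b) : K.IsSquare u b w a :=
  ⟨h.adj₄.symm, h.adj₃.symm, h.adj₂.symm, h.adj₁.symm, h.ne₁, h.ne₂.symm, by
    have : ({u, b, w, a} : Set V) = {u, a, w, b} := by
      ext; simp only [mem_insert_iff, mem_singleton_iff]; tauto
    rw [this]; exact h.mem⟩

/-- Otherwise the two squares would meet in a cube with three vertices, and the number of vertices
of a cube is a power of 2. -/
lemma unique₄ {u a w b b' : V} (h : K.IsSquare u a w b) (h' : K.IsSquare u a w b') : b = b' := by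
  by_contra hne
  have hi := K.inter_mem _ h.mem _ h'.mem ⟨u, by simp, by simp⟩
  have : ({u, a, w, b} ∩ {u, a, w, b'} : Set V) = {u, a, w} := by
    have h1 := h.ne₂
    have h2 := h.adj₃.ne
    have h3 := h.adj₄.ne
    ext x
    simp only [mem_inter_iff, mem_insert_iff, mem_singleton_iff]
    constructor
    · rintro ⟨hx | hx | hx | hx, hx'⟩
      · simp [hx]
      · simp [hx]
      · simp [hx]
      · subst hx
        rcases hx' with hx' | hx' | hx' | hx' <;> simp_all
    · tauto
  rw [this] at hi
  obtain ⟨n, hn⟩ := ncard_cube hi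
  rw [ncard_eq_three.2 ⟨u, a, w, h.adj₁.ne, h.ne₁, h.adj₂.ne, rfl⟩] at hn
  rcases n with _ | _ | n
  · simp at hn
  · simp at hn
  · rw [pow_add] at hn; omega

lemma unique₃ {u a w w' b : V} (h : K.IsSquare u a w b) (h' : K.IsSquare u a w' b) : w = w' :=
  unique₄ h.rotate.rotate.rotate h'.rotate.rotate.rotate

end IsSquare

lemma isSquare_of_chart {n : ℕ} {φ : (Fin n → Bool) → V} (h : IsCubeChart K.cubes φ)
    (b : Fin n → Bool) {i k : Fin n} (hik : i ≠ k) :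
    K.IsSquare (φ b) (φ (boolFlip b i)) (φ (boolFlip (boolFlip b i) k)) (φ (boolFlip b k)) where
  adj₁ := adj_of_chart h b i
  adj₂ := adj_of_chart h _ k
  adj₃ := by rw [boolFlip_comm]; exact (adj_of_chart h _ i).symm
  adj₄ := (adj_of_chart h b k).symm
  ne₁ := fun e => boolFlip_boolFlip_ne b hik (h.1 e.symm)
  ne₂ := fun e => hik (boolFlip_injective b (h.1 e))
  mem := square_mem_of_chart h b hik

/-- Both elementary moves preserve parity; with simple connectivity this makes the 1-skeleton
bipartite. -/
lemma even_length_eq_of_homotopic {u v : V} {p q : K.graph.Walk u v} (h : K.EdgeHomotopic p q) :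
    p.length % 2 = q.length % 2 := by
  induction h with
  | refl => rfl
  | symm _ ih => exact ih.symm
  | trans _ _ ih₁ ih₂ => exact ih₁.trans ih₂
  | backtrack p hab q => simp only [SimpleGraph.Walk.length_append, SimpleGraph.Walk.length_cons]; omega
  | square p hab hbc had hdc q hs => simp

lemma even_length_of_closed (hK : K.SimplyConnected) {v : V} (p : K.graph.Walk v v) :
    p.length % 2 = 0 := by
  simpa using even_length_eq_of_homotopic (hK.2 v p)

lemma dist_ne_of_adj (hK : K.SimplyConnected) (x : V) {u v : V} (h : K.graph.Adj u v) :
    K.graph.dist x u ≠ K.graph.dist x v := by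
  intro e
  obtain ⟨p, hp⟩ := hK.1.exists_walk_length_eq_dist x u
  obtain ⟨q, hq⟩ := hK.1.exists_walk_length_eq_dist v x
  have := even_length_of_closed hK (p.append (.cons h q))
  rw [SimpleGraph.Walk.length_append, SimpleGraph.Walk.length_cons, hp, hq,
    SimpleGraph.dist_comm (u := v), e] at this
  omega

lemma IsSquare.not_adj (hK : K.SimplyConnected) {u a w b : V} (h : K.IsSquare u a w b) :
    ¬ K.graph.Adj u w := by
  intro hw
  have := even_length_of_closed hK (.cons h.adj₁ (.cons h.adj₂ (.cons hw.symm .nil)))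
  simp at this

lemma IsSquare.isLinkSimplex (hK : K.SimplyConnected) {u a w b : V} (h : K.IsSquare u a w b) :
    K.IsLinkSimplex u {a, b} := by
  refine ⟨_, h.mem, by simp, ?_⟩
  ext x
  simp only [mem_insert_iff, mem_singleton_iff, mem_ofPred_eq]
  constructor
  · rintro (rfl | rfl)
    · exact ⟨by simp, h.adj₁⟩
    · exact ⟨by simp, h.adj₄.symm⟩
  · rintro ⟨rfl | rfl | rfl | rfl, hx⟩
    · exact absurd rfl hx.ne
    · simp
    · exact absurd hx (h.not_adj hK)
    · simp

/-- Neighbours of a vertex that pairwise span squares lie in a common cube. -/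
lemma exists_chart_of_pairwise_square (hK : K.IsCATZero) {v : V} {S : Set V} (hS : S.Finite)
    (hadj : ∀ a ∈ S, K.graph.Adj v a)
    (hsq : ∀ a ∈ S, ∀ b ∈ S, a ≠ b → ∃ w, K.IsSquare v a w b) :
    ∃ (n : ℕ) (φ : (Fin n → Bool) → V) (b : Fin n → Bool), IsCubeChart K.cubes φ ∧ φ b = v ∧
      ∀ a ∈ S, ∃ i, a = φ (boolFlip b i) := by
  obtain ⟨c, hc, hvc, hS'⟩ := hK.2 v S hS hadj (fun a ha b hb hab => by
    obtain ⟨w, hw⟩ := hsq a ha b hb hab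
    exact hw.isLinkSimplex hK.1)
  obtain ⟨n, φ, hφ, rfl⟩ := K.exists_chart c hc
  obtain ⟨b, rfl⟩ := hvc
  refine ⟨n, φ, b, hφ, rfl, fun a ha => ?_⟩
  have : a ∈ {u ∈ range φ | K.graph.Adj (φ b) u} := hS' ▸ ha
  obtain ⟨⟨d, rfl⟩, hd⟩ := this
  obtain ⟨i, rfl⟩ := exists_flip_of_adj hφ hd
  exact ⟨i, rfl⟩

/-- Three squares around a vertex span a cube. -/
lemma exists_cube_corner (hK : K.IsCATZero) {v a b c ab ac bc : V}
    (hab : K.IsSquare v a ab b) (hac : K.IsSquare v a ac c) (hbc : K.IsSquare v b bc c) :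
    ∃ t, K.IsSquare a ab t ac ∧ K.IsSquare ab b bc t ∧ K.IsSquare ac c bc t := by
  obtain ⟨n, φ, d, hφ, rfl, h⟩ := exists_chart_of_pairwise_square hK (v := v) (S := {a, b, c})
    (by simp) (by
      rintro x (rfl | rfl | rfl)
      · exact hab.adj₁
      · exact hbc.adj₁
      · exact hbc.adj₄.symm) (by
      rintro x (rfl | rfl | rfl) y (rfl | rfl | rfl) hxy
      · exact absurd rfl hxy
      · exact ⟨_, hab⟩
      · exact ⟨_, hac⟩
      · exact ⟨_, hab.symm⟩
      · exact absurd rfl hxy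
      · exact ⟨_, hbc⟩
      · exact ⟨_, hac.symm⟩
      · exact ⟨_, hbc.symm⟩
      · exact absurd rfl hxy)
  obtain ⟨i, rfl⟩ := h a (by simp)
  obtain ⟨j, rfl⟩ := h b (by simp)
  obtain ⟨k, rfl⟩ := h c (by simp)
  have hij : i ≠ j := by rintro rfl; exact hab.ne₂ rfl
  have hik : i ≠ k := by rintro rfl; exact hac.ne₂ rfl
  have hjk : j ≠ k := by rintro rfl; exact hbc.ne₂ rfl
  -- A square is determined by a corner and its two neighbours, so the given squares are the faces
  -- of the chart at `d`.
  obtain rfl := hab.unique₃ (isSquare_of_chart hφ d hij)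
  obtain rfl := hac.unique₃ (isSquare_of_chart hφ d hik)
  obtain rfl := hbc.unique₃ (isSquare_of_chart hφ d hjk)
  refine ⟨φ (boolFlip (boolFlip (boolFlip d i) j) k), isSquare_of_chart hφ _ hjk, ?_, ?_⟩
  · have := isSquare_of_chart hφ (boolFlip (boolFlip d i) j) hik
    rw [boolFlip_comm d i j, boolFlip_boolFlip, ← boolFlip_comm d i j] at this
    exact this
  · have := isSquare_of_chart hφ (boolFlip (boolFlip d i) k) hij
    rw [boolFlip_comm d i k, boolFlip_boolFlip, ← boolFlip_comm d i k, boolFlip_comm d k j,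
      boolFlip_comm (boolFlip d i) k j] at this
    exact this

end CubeComplex

/-! ### Reduced edge paths modulo squares. -/

namespace CubeComplex

variable {V : Type*} {K : CubeComplex V}

/-- Equivalence of edge paths of equal length modulo pushing across squares. A path is recorded as
the list of its vertices, starting with its final vertex. -/
inductive PathEquiv (K : CubeComplex V) : List V → List V → Prop
  | nil : PathEquiv K [] []
  | cons (u : V) {p q : List V} : PathEquiv K p q → PathEquiv K (u :: p) (u :: q)
  | square {u a w b : V} {p q r : List V} : K.IsSquare u a w b →
      PathEquiv K (a :: p) (a :: w :: r) → PathEquiv K (b :: q) (b :: w :: r) →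
      PathEquiv K (u :: a :: p) (u :: b :: q)

namespace PathEquiv

lemma refl : ∀ p : List V, K.PathEquiv p p
  | [] => .nil
  | u :: p => .cons u (refl p)

lemma symm {p q : List V} (h : K.PathEquiv p q) : K.PathEquiv q p := by
  induction h with
  | nil => exact .nil
  | cons u _ ih => exact .cons u ih
  | square hs h₁ h₂ _ _ => exact .square hs.symm h₂ h₁

lemma length_eq {p q : List V} (h : K.PathEquiv p q) : p.length = q.length := by
  induction h with
  | nil => rfl
  | cons u _ ih => simp [ih]
  | square hs h₁ h₂ ih₁ ih₂ => simp_all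

lemma head_eq {p q : List V} {u v : V} (h : K.PathEquiv (u :: p) (v :: q)) : u = v := by
  cases h <;> rfl

lemma getLast?_eq {p q : List V} (h : K.PathEquiv p q) : p.getLast? = q.getLast? := by
  induction h with
  | nil => rfl
  | cons u h ih => rw [List.getLast?_cons, List.getLast?_cons, ih]
  | square hs h₁ h₂ ih₁ ih₂ =>
    rw [List.getLast?_cons_cons, List.getLast?_cons_cons, ih₁, ih₂, List.getLast?_cons_cons,
      List.getLast?_cons_cons]

/-- Built into the form of `PathEquiv`: a square at the head changes the second vertex. This is why
the relation is defined by its effect on the first step instead of as a generated equivalence. -/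
lemma cancel {u v : V} {p q : List V} (h : K.PathEquiv (u :: v :: p) (u :: v :: q)) :
    K.PathEquiv (v :: p) (v :: q) := by
  cases h with
  | cons _ h => exact h
  | square hs _ _ => exact absurd rfl hs.ne₂

lemma isChain {p q : List V} (h : K.PathEquiv p q) (hp : p.IsChain K.graph.Adj) :
    q.IsChain K.graph.Adj := by
  have aux : (p.IsChain K.graph.Adj ↔ q.IsChain K.graph.Adj) := by
    clear hp
    induction h with
    | nil => rfl
    | @cons u p q h ih =>
      cases p with
      | nil => cases q with
        | nil => rfl
        | cons => exact absurd h.length_eq (by simp)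
      | cons a p => cases q with
        | nil => exact absurd h.length_eq (by simp)
        | cons b q =>
          obtain rfl := h.head_eq
          rw [List.isChain_cons_cons, List.isChain_cons_cons, ih]
    | square hs h₁ h₂ ih₁ ih₂ =>
      rw [List.isChain_cons_cons, List.isChain_cons_cons, ih₁, ih₂, List.isChain_cons_cons,
        List.isChain_cons_cons]
      have := hs.adj₁
      have := hs.adj₂
      have := hs.adj₃.symm
      have := hs.adj₄.symm
      tauto
  exact aux.1 hp

/-- The price of the inductive form of `PathEquiv`, and the place where flagness of links enters. By
induction on length; the critical case has two successive squares at the head. -/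
lemma trans (hK : K.IsCATZero) {p q r : List V} (h₁ : K.PathEquiv p q) (h₂ : K.PathEquiv q r) :
    K.PathEquiv p r := by
  induction hn : p.length using Nat.strong_induction_on generalizing p q r with
  | _ n ih =>
  have ih' : ∀ {p' q' r' : List V}, p'.length < n → K.PathEquiv p' q' → K.PathEquiv q' r' →
      K.PathEquiv p' r' := fun h h₁ h₂ => ih _ h h₁ h₂ rfl
  have hlen := h₁.length_eq
  cases h₁ with
  | nil => exact h₂
  | @cons u p q h₁ =>
    simp only [List.length_cons] at hn
    cases h₂ with
    | cons _ h₂ => exact .cons u (ih' (by omega) h₁ h₂)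
    | @square _ a w b q r s hs h₂ h₃ =>
      cases p with
      | nil => simp at hlen
      | cons a' p =>
        obtain rfl := h₁.head_eq
        exact .square hs (ih' (by omega) h₁ h₂) h₃
  | @square u a w b p q s hs h₁ h₁' =>
    simp only [List.length_cons] at hn hlen
    have hl₁ := h₁.length_eq
    have hl₁' := h₁'.length_eq
    simp only [List.length_cons] at hl₁ hl₁'
    cases h₂ with
    | @cons _ _ r h₂ =>
      cases r with
      | nil => exact absurd h₂.length_eq (by simp)
      | cons b' r =>
        obtain rfl := h₂.head_eq
        have hl₂ := h₂.length_eq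
        simp only [List.length_cons] at hl₂
        exact .square hs h₁ (ih' (by simp; omega) h₂.symm h₁')
    | @square _ _ w' c _ r s' hs' h₂ h₂' =>
      have hl₂ := h₂.length_eq
      have hl₂' := h₂'.length_eq
      simp only [List.length_cons] at hl₂ hl₂'
      have hw := ih' (by simp; omega) h₁'.symm h₂
      cases hw with
      | cons _ hw =>
        obtain rfl := hw.head_eq
        obtain rfl := hs.rotate.rotate.rotate.symm.unique₃ hs'.rotate
        exact .cons u (ih' (by simp; omega) h₁ (ih' (by simp; omega) (hw.cons a) h₂'.symm))
      | @square _ _ z _ x y t hz hz₁ hz₂ =>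
        -- The two squares at `u` and the square comparing `w` with `w'` all contain `b`, so they
        -- span the corner of a cube. The opposite faces of that cube carry the direct comparison of
        -- `a` and `c`.
        obtain ⟨d, hd, hd₁, hd₂⟩ := exists_cube_corner hK hs.rotate.rotate.rotate
          hs'.symm.rotate.rotate.rotate hz
        have hlz := hz₁.length_eq
        have hlz' := hz₂.length_eq
        simp only [List.length_cons] at hlz hlz'
        refine .square hd (ih' (by simp; omega) h₁ (ih' (by simp; omega) (hz₁.cons a)
          (.square hd₁ (refl _) (refl _)))) (ih' (by simp; omega) h₂' (ih' (by simp; omega)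
          (hz₂.cons c) (.square hd₂ (refl _) (refl _))))

end PathEquiv

/-- A path that cannot be shortened by pushing across squares and removing a backtrack. -/
def IsReduced (K : CubeComplex V) : List V → Prop
  | [] => True
  | [_] => True
  | v :: u :: p => IsReduced K (u :: p) ∧ ∀ q, ¬ K.PathEquiv (u :: p) (u :: v :: q)

lemma IsReduced.tail {u : V} {p : List V} (h : K.IsReduced (u :: p)) : K.IsReduced p := by
  cases p with
  | nil => trivial
  | cons v p => exact h.1

/-- In the square case, a cancellation in one of the two paths is carried around the square to a
cancellation in the other. -/
lemma PathEquiv.isReduced (hK : K.IsCATZero) {p q : List V} (h : K.PathEquiv p q)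
    (hp : K.IsReduced p) : K.IsReduced q := by
  induction hn : p.length using Nat.strong_induction_on generalizing p q with
  | _ n ih =>
  have ih' : ∀ {p' q' : List V}, p'.length < n → K.PathEquiv p' q' → K.IsReduced p' →
      K.IsReduced q' := fun h h₁ h₂ => ih _ h h₁ h₂ rfl
  have hlen := h.length_eq
  cases h with
  | nil => trivial
  | @cons u p q h =>
    simp only [List.length_cons] at hn hlen
    cases q with
    | nil => trivial
    | cons b q =>
      cases p with
      | nil => simp at hlen
      | cons a p =>
        obtain rfl := h.head_eq
        exact ⟨ih' (by omega) h hp.1, fun r hr => hp.2 r (h.trans hK hr)⟩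
  | @square u a w b p q s hs h₁ h₂ =>
    simp only [List.length_cons] at hn hlen
    have hl₁ := h₁.length_eq
    have hl₂ := h₂.length_eq
    simp only [List.length_cons] at hl₁ hl₂
    have h₃ : K.IsReduced (a :: w :: s) := ih' (by simp; omega) h₁ hp.1
    have h₄ : K.IsReduced (b :: w :: s) := by
      -- Were `b` to cancel against `w :: s`, rotating the square would let `u` cancel against `a ::
      -- p`.
      refine ⟨h₃.1, fun r hr => hp.2 (b :: r) ?_⟩
      exact h₁.trans hK ((hr.cons a).trans hK
        (.square hs.rotate (.refl _) (.refl _)))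
    refine ⟨ih' (by simp; omega) h₂.symm h₄, fun r hr => ?_⟩
    have h₅ := h₂.symm.trans hK hr
    cases h₅ with
    | cons _ h₆ => exact hs.ne₁ h₆.head_eq.symm
    -- The new square has to be the old one, so `x` is `a`, and `a` would cancel against `w :: s`.
    | @square _ _ x _ _ _ t hx h₆ h₇ =>
      obtain rfl := hx.unique₃ hs.rotate.rotate.rotate.symm
      exact h₃.2 _ h₆

/-- Append a vertex to a path, cancelling a backtrack if there is one. -/
noncomputable def pathAct (K : CubeComplex V) (p : List V) (v : V) : List V :=
  open Classical in
  if h : ∃ x : V × List V, K.PathEquiv p (x.1 :: v :: x.2) then v :: h.choose.2 else v :: p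

/-- By `cancel`, the chosen remainder is independent of the choice up to equivalence. -/
lemma pathAct_of_equiv {p : List V} {u v : V} {q : List V} (hK : K.IsCATZero)
    (h : K.PathEquiv p (u :: v :: q)) : K.PathEquiv (K.pathAct p v) (v :: q) := by
  have hex : ∃ x : V × List V, K.PathEquiv p (x.1 :: v :: x.2) := ⟨(u, q), h⟩
  rw [pathAct, dif_pos hex]
  have h1 := hex.choose_spec
  have h2 := h1.symm.trans hK h
  rw [h2.head_eq] at h2
  exact h2.cancel

lemma pathAct_of_not {p : List V} {u v : V} (h : ∀ q, ¬ K.PathEquiv (u :: p) (u :: v :: q)) :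
    K.pathAct (u :: p) v = v :: u :: p := by
  rw [pathAct, dif_neg]
  rintro ⟨⟨x, q⟩, hx⟩
  obtain rfl := hx.head_eq
  exact h q hx

lemma pathAct_congr (hK : K.IsCATZero) {u v : V} {p q : List V}
    (h : K.PathEquiv (u :: p) (u :: q)) :
    K.PathEquiv (K.pathAct (u :: p) v) (K.pathAct (u :: q) v) := by
  by_cases hex : ∃ r, K.PathEquiv (u :: p) (u :: v :: r)
  · obtain ⟨r, hr⟩ := hex
    exact (pathAct_of_equiv hK hr).trans hK (pathAct_of_equiv hK (h.symm.trans hK hr)).symm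
  · push Not at hex
    rw [pathAct_of_not hex, pathAct_of_not fun r hr => hex r (h.trans hK hr)]
    exact h.cons v

lemma pathAct_eq_cons (u v : V) (p : List V) : ∃ q, K.pathAct (u :: p) v = v :: q := by
  rw [pathAct]
  split_ifs with h
  · exact ⟨_, rfl⟩
  · exact ⟨_, rfl⟩

lemma isReduced_pathAct (hK : K.IsCATZero) {u v : V} {p : List V} (hp : K.IsReduced (u :: p)) :
    K.IsReduced (K.pathAct (u :: p) v) := by
  by_cases hex : ∃ r, K.PathEquiv (u :: p) (u :: v :: r)
  · obtain ⟨r, hr⟩ := hex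
    exact (pathAct_of_equiv hK hr).symm.isReduced hK (hr.isReduced hK hp).tail
  · push Not at hex
    rw [pathAct_of_not hex]
    exact ⟨hp, hex⟩

lemma pathAct_pathAct_self (hK : K.IsCATZero) {u v : V} {p : List V}
    (hp : K.IsReduced (u :: p)) : K.PathEquiv (K.pathAct (K.pathAct (u :: p) v) u) (u :: p) := by
  by_cases hex : ∃ r, K.PathEquiv (u :: p) (u :: v :: r)
  · obtain ⟨r, hr⟩ := hex
    have h1 := pathAct_of_equiv hK hr
    obtain ⟨q, hq⟩ := pathAct_eq_cons (K := K) u v p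
    rw [hq] at h1 ⊢
    have h2 := pathAct_congr (v := u) hK h1
    rw [pathAct_of_not (hr.isReduced hK hp).2] at h2
    exact h2.trans hK hr.symm
  · push Not at hex
    rw [pathAct_of_not hex]
    exact pathAct_of_equiv hK (.refl _)

/-- Together with `pathAct_pathAct_self` this says that edge paths act on classes of reduced paths
through their homotopy classes. The cases depend on which of the first edges to `a` and to `b`
cancel. -/
lemma pathAct_square (hK : K.IsCATZero) {u a c b : V} (hs : K.IsSquare u a c b) {p : List V}
    (hp : K.IsReduced (u :: p)) :
    K.PathEquiv (K.pathAct (K.pathAct (u :: p) a) c) (K.pathAct (K.pathAct (u :: p) b) c) := by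
  -- Only `a` cancels: then `c` cancels after `b`, and the result `c :: a :: r` is also what `c`
  -- appends after `a`.
  have one : ∀ {a b : V}, K.IsSquare u a c b → (∃ r, K.PathEquiv (u :: p) (u :: a :: r)) →
      (∀ r, ¬ K.PathEquiv (u :: p) (u :: b :: r)) →
      K.PathEquiv (K.pathAct (K.pathAct (u :: p) a) c) (K.pathAct (K.pathAct (u :: p) b) c) := by
    rintro a b hs ⟨r, hr⟩ hb
    have hred : K.IsReduced (b :: u :: p) := ⟨hp, hb⟩
    have h1 : K.PathEquiv (b :: u :: p) (b :: c :: a :: r) :=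
      (hr.cons b).trans hK (.square hs.rotate.rotate.rotate (.refl _) (.refl _))
    have h2 := h1.isReduced hK hred
    rw [pathAct_of_not hb]
    refine PathEquiv.trans hK ?_ (pathAct_of_equiv hK h1).symm
    have h3 := pathAct_of_equiv hK hr
    obtain ⟨q, hq⟩ := pathAct_eq_cons (K := K) u a p
    rw [hq] at h3 ⊢
    have h4 := pathAct_congr (v := c) hK h3
    rwa [pathAct_of_not h2.1.2] at h4
  -- Neither cancels: `c` cannot cancel after `a`, since by uniqueness of squares `b` would then
  -- cancel at `u`.
  have none : ∀ {a b : V}, K.IsSquare u a c b → (∀ r, ¬ K.PathEquiv (u :: p) (u :: a :: r)) →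
      (∀ r, ¬ K.PathEquiv (u :: p) (u :: b :: r)) →
      K.pathAct (K.pathAct (u :: p) a) c = c :: a :: u :: p := by
    intro a b hs ha hb
    rw [pathAct_of_not ha, pathAct_of_not]
    intro q hq
    cases hq with
    | cons _ h => exact hs.ne₁ h.head_eq
    | @square _ _ x _ _ _ t hx h₁ h₂ =>
      obtain rfl := hx.unique₃ hs.symm.rotate.rotate.rotate
      exact hb _ h₁
  by_cases ha : ∃ r, K.PathEquiv (u :: p) (u :: a :: r)
  · by_cases hb : ∃ r, K.PathEquiv (u :: p) (u :: b :: r)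
    · obtain ⟨r, hr⟩ := ha
      obtain ⟨s, hr'⟩ := hb
      have h1 := pathAct_of_equiv hK hr
      have h2 := pathAct_of_equiv hK hr'
      have h3 := hr.symm.trans hK hr'
      cases h3 with
      | cons _ h3 => exact absurd h3.head_eq hs.ne₂
      | @square _ _ x _ _ _ t hx h₄ h₅ =>
        obtain rfl := hx.unique₃ hs
        have key : ∀ {d : V} {q : List V}, K.PathEquiv (K.pathAct (u :: p) d) (d :: q) →
            K.PathEquiv (d :: q) (d :: x :: t) →
            K.PathEquiv (K.pathAct (K.pathAct (u :: p) d) x) (x :: t) := by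
          intro d q h h'
          exact pathAct_of_equiv hK (h.trans hK h')
        exact (key h1 h₄).trans hK (key h2 h₅).symm
    · push Not at hb
      exact one hs ha hb
  · push Not at ha
    by_cases hb : ∃ r, K.PathEquiv (u :: p) (u :: b :: r)
    · exact (one hs.symm hb ha).symm
    · push Not at hb
      rw [none hs ha hb, none hs.symm hb ha]
      exact .square hs.rotate.rotate.symm (.refl _) (.refl _)

end CubeComplex

/-! ### Triviality of the path covering, and the quadrangle condition. -/

namespace CubeComplex

variable {V : Type*} {K : CubeComplex V}

/-- The square move does not demand distinct vertices. With `b ≠ d` the only degeneration is `a =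
c`, which would be a cube with three vertices. -/
lemma isSquare_of_mem {a b c d : V} (hab : K.graph.Adj a b) (hbc : K.graph.Adj b c)
    (had : K.graph.Adj a d) (hdc : K.graph.Adj d c) (hs : ({a, b, c, d} : Set V) ∈ K.cubes)
    (hbd : b ≠ d) : K.IsSquare a b c d := by
  refine ⟨hab, hbc, hdc.symm, had.symm, ?_, hbd, hs⟩
  rintro rfl
  have : ({a, b, a, d} : Set V) = {a, b, d} := by
    ext; simp only [mem_insert_iff, mem_singleton_iff]; tauto
  rw [this] at hs
  obtain ⟨n, hn⟩ := ncard_cube hs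
  rw [ncard_eq_three.2 ⟨a, b, d, hab.ne, had.ne, hbd, rfl⟩] at hn
  rcases n with _ | _ | n
  · simp at hn
  · simp at hn
  · rw [pow_add] at hn; omega

/-- Extend a path along a walk, cancelling backtracks. -/
noncomputable def pathRun (K : CubeComplex V) :
    ∀ {u v : V}, List V → K.graph.Walk u v → List V
  | _, _, p, .nil => p
  | _, _, p, .cons (v := v) _ w => pathRun K (K.pathAct p v) w

lemma pathRun_append {u v w : V} (p : List V) (q : K.graph.Walk u v) (r : K.graph.Walk v w) :
    K.pathRun p (q.append r) = K.pathRun (K.pathRun p q) r := by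
  induction q generalizing p with
  | nil => rfl
  | cons h q ih => exact ih _ _

lemma pathRun_eq_cons {u v : V} (p : List V) (w : K.graph.Walk u v) :
    ∃ q, K.pathRun (u :: p) w = v :: q := by
  induction w generalizing p with
  | nil => exact ⟨p, rfl⟩
  | @cons u a v h w ih =>
    obtain ⟨q, hq⟩ := pathAct_eq_cons (K := K) u a p
    rw [pathRun, hq]
    exact ih q

lemma pathRun_congr (hK : K.IsCATZero) {u v : V} {p q : List V}
    (h : K.PathEquiv (u :: p) (u :: q)) (w : K.graph.Walk u v) :
    K.PathEquiv (K.pathRun (u :: p) w) (K.pathRun (u :: q) w) := by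
  induction w generalizing p q with
  | nil => exact h
  | @cons u a v _ w ih =>
    have h1 := pathAct_congr (v := a) hK h
    obtain ⟨p', hp'⟩ := pathAct_eq_cons (K := K) u a p
    obtain ⟨q', hq'⟩ := pathAct_eq_cons (K := K) u a q
    rw [pathRun, pathRun]
    rw [hp', hq'] at h1 ⊢
    exact ih h1

lemma isReduced_pathRun (hK : K.IsCATZero) {u v : V} {p : List V} (h : K.IsReduced (u :: p))
    (w : K.graph.Walk u v) : K.IsReduced (K.pathRun (u :: p) w) := by
  induction w generalizing p with
  | nil => exact h
  | @cons u a v _ w ih =>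
    have h1 := isReduced_pathAct (v := a) hK h
    obtain ⟨p', hp'⟩ := pathAct_eq_cons (K := K) u a p
    rw [pathRun]
    rw [hp'] at h1 ⊢
    exact ih h1

lemma pathRun_homotopic (hK : K.IsCATZero) {u v : V} {w w' : K.graph.Walk u v}
    (hw : K.EdgeHomotopic w w') {p : List V} (hp : K.IsReduced (u :: p)) :
    K.PathEquiv (K.pathRun (u :: p) w) (K.pathRun (u :: p) w') := by
  induction hw with
  | refl => exact .refl _
  | symm _ ih => exact ih.symm
  | trans _ _ ih₁ ih₂ => exact ih₁.trans hK ih₂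
  | @backtrack a b r hab q =>
    rw [pathRun_append, pathRun_append]
    have h1 := isReduced_pathRun hK hp r
    obtain ⟨s, hs⟩ := pathRun_eq_cons p r
    rw [hs] at h1 ⊢
    rw [pathRun, pathRun]
    have h2 := pathAct_pathAct_self (v := b) hK h1
    obtain ⟨t, ht⟩ := pathAct_eq_cons (K := K) a b s
    rw [ht] at h2 ⊢
    obtain ⟨t', ht'⟩ := pathAct_eq_cons (K := K) b a t
    rw [ht'] at h2 ⊢
    exact pathRun_congr hK h2 q
  | @square a b c d r hab hbc had hdc q hs =>
    by_cases hbd : b = d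
    · subst hbd; exact .refl _
    have hsq := isSquare_of_mem hab hbc had hdc hs hbd
    rw [pathRun_append, pathRun_append]
    have h1 := isReduced_pathRun hK hp r
    obtain ⟨s, hs⟩ := pathRun_eq_cons p r
    rw [hs] at h1 ⊢
    rw [pathRun, pathRun, pathRun, pathRun]
    have h2 := pathAct_square hK hsq h1
    obtain ⟨t, ht⟩ := pathAct_eq_cons (K := K) a b s
    obtain ⟨t', ht'⟩ := pathAct_eq_cons (K := K) a d s
    rw [ht, ht'] at h2 ⊢
    obtain ⟨x, hx⟩ := pathAct_eq_cons (K := K) b c t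
    obtain ⟨x', hx'⟩ := pathAct_eq_cons (K := K) d c t'
    rw [hx, hx'] at h2 ⊢
    exact pathRun_congr hK h2 q

/-- The loops `w w⁻¹` and `w⁻¹ w'` are null-homotopic, so running `w`, then `w⁻¹`, then `w'` is
equivalent both to running `w'` and to running `w`. -/
lemma pathRun_equiv (hK : K.IsCATZero) {u v : V} (w w' : K.graph.Walk u v) {p : List V}
    (hp : K.IsReduced (u :: p)) :
    K.PathEquiv (K.pathRun (u :: p) w) (K.pathRun (u :: p) w') := by
  have h1 := pathRun_homotopic hK (hK.1.2 u (w.append w.reverse)) hp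
  rw [pathRun_append, pathRun] at h1
  have hr := isReduced_pathRun hK hp w
  obtain ⟨q, hq⟩ := pathRun_eq_cons p w
  rw [hq] at h1 hr ⊢
  have h2 := pathRun_homotopic hK (hK.1.2 v (w.reverse.append w')) hr
  rw [pathRun_append, pathRun] at h2
  obtain ⟨s, hs⟩ := pathRun_eq_cons q w.reverse
  rw [hs] at h1 h2
  exact h2.symm.trans hK (pathRun_congr hK h1 w')

lemma isChain_pathAct (hK : K.IsCATZero) {u v : V} {p : List V}
    (hp : (u :: p).IsChain K.graph.Adj) (h : K.graph.Adj u v) :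
    (K.pathAct (u :: p) v).IsChain K.graph.Adj := by
  by_cases hex : ∃ r, K.PathEquiv (u :: p) (u :: v :: r)
  · obtain ⟨r, hr⟩ := hex
    exact (pathAct_of_equiv hK hr).symm.isChain (List.isChain_cons_cons.1 (hr.isChain hp)).2
  · push Not at hex
    rw [pathAct_of_not hex]
    exact List.isChain_cons_cons.2 ⟨h.symm, hp⟩

lemma getLast?_pathAct (hK : K.IsCATZero) (u v : V) (p : List V) :
    (K.pathAct (u :: p) v).getLast? = (u :: p).getLast? := by
  by_cases hex : ∃ r, K.PathEquiv (u :: p) (u :: v :: r)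
  · obtain ⟨r, hr⟩ := hex
    rw [(pathAct_of_equiv hK hr).getLast?_eq, hr.getLast?_eq, List.getLast?_cons_cons]
  · push Not at hex
    rw [pathAct_of_not hex, List.getLast?_cons_cons]

lemma length_pathAct_le (hK : K.IsCATZero) (u v : V) (p : List V) :
    (K.pathAct (u :: p) v).length ≤ p.length + 2 := by
  by_cases hex : ∃ r, K.PathEquiv (u :: p) (u :: v :: r)
  · obtain ⟨r, hr⟩ := hex
    have h1 := (pathAct_of_equiv hK hr).length_eq
    have h2 := hr.length_eq
    simp only [List.length_cons] at h1 h2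
    omega
  · push Not at hex
    rw [pathAct_of_not hex]; simp

lemma isChain_pathRun (hK : K.IsCATZero) {u v : V} {p : List V}
    (hp : (u :: p).IsChain K.graph.Adj) (w : K.graph.Walk u v) :
    (K.pathRun (u :: p) w).IsChain K.graph.Adj := by
  induction w generalizing p with
  | nil => exact hp
  | @cons u a v h w ih =>
    have h1 := isChain_pathAct hK hp h
    obtain ⟨p', hp'⟩ := pathAct_eq_cons (K := K) u a p
    rw [pathRun]
    rw [hp'] at h1 ⊢
    exact ih h1

lemma getLast?_pathRun (hK : K.IsCATZero) {u v : V} (p : List V) (w : K.graph.Walk u v) :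
    (K.pathRun (u :: p) w).getLast? = (u :: p).getLast? := by
  induction w generalizing p with
  | nil => rfl
  | @cons u a v h w ih =>
    have h1 := getLast?_pathAct hK u a p
    obtain ⟨p', hp'⟩ := pathAct_eq_cons (K := K) u a p
    rw [pathRun]
    rw [hp'] at h1 ⊢
    rw [← h1]
    exact ih p'

lemma length_pathRun_le (hK : K.IsCATZero) {u v : V} (p : List V) (w : K.graph.Walk u v) :
    (K.pathRun (u :: p) w).length ≤ p.length + 1 + w.length := by
  induction w generalizing p with
  | nil => rfl
  | @cons u a v h w ih =>
    have h1 := length_pathAct_le hK u a p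
    obtain ⟨p', hp'⟩ := pathAct_eq_cons (K := K) u a p
    rw [pathRun]
    rw [hp'] at h1 ⊢
    have := ih p'
    simp only [SimpleGraph.Walk.length_cons, List.length_cons] at *
    omega

lemma dist_le_of_isChain (hc : K.graph.Connected) {x u : V} {p : List V}
    (hp : (u :: p).IsChain K.graph.Adj) (hx : (u :: p).getLast? = some x) :
    K.graph.dist x u ≤ p.length := by
  induction p generalizing u with
  | nil =>
    simp at hx
    simp [hx]
  | cons a p ih =>
    rw [List.getLast?_cons_cons] at hx
    rw [List.isChain_cons_cons] at hp
    have h1 := ih hp.2 hx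
    have h2 := hc.dist_triangle (u := x) (v := a) (w := u)
    have h3 : K.graph.dist a u = 1 := SimpleGraph.dist_eq_one_iff_adj.2 hp.1.symm
    simp only [List.length_cons]
    omega

lemma dist_adj (hK : K.SimplyConnected) (x : V) {u v : V} (h : K.graph.Adj u v) :
    K.graph.dist x u = K.graph.dist x v + 1 ∨ K.graph.dist x v = K.graph.dist x u + 1 := by
  have h1 := dist_ne_of_adj hK x h
  have h2 : K.graph.dist u v = 1 := SimpleGraph.dist_eq_one_iff_adj.2 h
  have h3 := hK.1.dist_triangle (u := x) (v := u) (w := v)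
  have h4 := hK.1.dist_triangle (u := x) (v := v) (w := u)
  rw [SimpleGraph.dist_comm (u := v) (v := u)] at h4
  omega

/-- The quadrangle condition. -/
lemma exists_quadrangle (hK : K.IsCATZero) {x u a b : V} (ha : K.graph.Adj u a)
    (hb : K.graph.Adj u b) (hab : a ≠ b) (hda : K.graph.dist x a + 1 = K.graph.dist x u)
    (hdb : K.graph.dist x b + 1 = K.graph.dist x u) :
    ∃ w, K.IsSquare u a w b ∧ K.graph.dist x w + 1 = K.graph.dist x a := by
  -- Running a geodesic to `c` yields a path of length `dist x c`. The last edge to `u` cannot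
  -- cancel, as that would produce a path to `u` shorter than the distance.
  have key : ∀ {c}, K.graph.Adj u c → K.graph.dist x c + 1 = K.graph.dist x u →
      ∃ (w : K.graph.Walk x c) (p : List V), (c :: p).IsChain K.graph.Adj ∧
        (c :: p).getLast? = some x ∧ p.length = K.graph.dist x c ∧
        ∀ hc : K.graph.Adj c u, K.pathRun [x] (w.append (.cons hc .nil)) = u :: c :: p := by
    intro c hc hd
    obtain ⟨w, hw⟩ := hK.1.1.exists_walk_length_eq_dist x c
    obtain ⟨p, hp⟩ := pathRun_eq_cons [] w
    have h1 := isChain_pathRun hK (List.isChain_singleton x) w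
    have h2 : _ = some x := getLast?_pathRun hK [] w
    have h3 := length_pathRun_le hK [] w
    rw [hp] at h1 h2 h3
    simp only [List.length_cons, List.length_nil] at h3
    have h4 := dist_le_of_isChain hK.1.1 h1 h2
    refine ⟨w, p, h1, h2, by omega, fun hc' => ?_⟩
    rw [pathRun_append, hp, pathRun, pathRun]
    apply pathAct_of_not
    intro q hq
    have h5 := hq.getLast?_eq
    rw [h2, List.getLast?_cons_cons] at h5
    have h6 := dist_le_of_isChain hK.1.1 (List.isChain_cons_cons.1 (hq.isChain h1)).2 h5.symm
    have h7 := hq.length_eq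
    simp only [List.length_cons] at h7
    omega
  obtain ⟨wa, p, hp1, hp2, hp3, hp4⟩ := key ha hda
  obtain ⟨wb, q, hq1, hq2, hq3, hq4⟩ := key hb hdb
  -- Both lists are runs of walks from `x` to `u`, hence equivalent; since their second vertices
  -- differ, the equivalence starts with the desired square.
  have h := pathRun_equiv hK (wa.append (.cons ha.symm .nil)) (wb.append (.cons hb.symm .nil))
    (p := []) trivial
  rw [hp4, hq4] at h
  cases h with
  | cons _ h => exact absurd h.head_eq hab
  | @square _ _ w _ _ _ r hs h1 h2 =>
    refine ⟨w, hs, ?_⟩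
    have h3 := h1.getLast?_eq
    rw [hp2, List.getLast?_cons_cons] at h3
    have h4 := dist_le_of_isChain hK.1.1 (List.isChain_cons_cons.1 (h1.isChain hp1)).2 h3.symm
    have h5 := h1.length_eq
    simp only [List.length_cons] at h5
    have h6 := dist_adj hK.1 x hs.adj₂
    omega

lemma exists_adj_toward (hc : K.graph.Connected) {x u : V} (hne : x ≠ u) :
    ∃ a, K.graph.Adj u a ∧ K.graph.dist x a + 1 = K.graph.dist x u := by
  obtain ⟨p, hp⟩ := hc.exists_walk_length_eq_dist u x
  cases p with
  | nil => exact absurd rfl hne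
  | @cons _ a _ h p =>
    refine ⟨a, h, ?_⟩
    have h1 := SimpleGraph.dist_le p
    have h2 := hc.dist_triangle (u := u) (v := a) (w := x)
    have h3 : K.graph.dist u a = 1 := SimpleGraph.dist_eq_one_iff_adj.2 h
    rw [SimpleGraph.Walk.length_cons] at hp
    rw [SimpleGraph.dist_comm (u := x), SimpleGraph.dist_comm (u := x)]
    omega

/-! ### Halfspaces -/

/-- The vertices closer to `u` than to `v`. -/
def halfspace (K : CubeComplex V) (u v : V) : Set V := {x | K.graph.dist x u < K.graph.dist x v}

/-- The halfspaces of the 1-skeleton. -/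
def halfspaces (K : CubeComplex V) : Set (Set V) :=
  {A | ∃ u v, K.graph.Adj u v ∧ A = K.halfspace u v}

lemma compl_halfspace (hK : K.SimplyConnected) {u v : V} (h : K.graph.Adj u v) :
    (K.halfspace u v)ᶜ = K.halfspace v u := by
  ext x
  have := dist_adj hK x h
  simp only [halfspace, mem_compl_iff, mem_ofPred_eq]
  omega

/-- If `x` were on different sides, `u` and `v'` would be at distance `n` from `x`, and `u'`, `v` at
distance `n + 1`. The quadrangle condition at `v` gives a fourth corner at distance `n - 1`, but
uniqueness of squares makes it `u'`. -/
lemma halfspace_eq_of_isSquare (hK : K.IsCATZero) {u u' v' v : V} (h : K.IsSquare u u' v' v) :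
    K.halfspace u v = K.halfspace u' v' := by
  have aux : ∀ {u u' v' v : V}, K.IsSquare u u' v' v → K.halfspace u v ⊆ K.halfspace u' v' := by
    intro u u' v' v h x hx
    simp only [halfspace, mem_ofPred_eq] at hx ⊢
    by_contra hcon
    have h1 := dist_adj hK.1 x h.adj₁
    have h2 := dist_adj hK.1 x h.adj₂
    have h3 := dist_adj hK.1 x h.adj₃
    have h4 := dist_adj hK.1 x h.adj₄
    obtain ⟨w, hw, hd⟩ := exists_quadrangle hK (x := x) h.adj₄ h.adj₃.symm h.ne₁ (by omega)
      (by omega)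
    obtain rfl := hw.unique₃ h.rotate.rotate.rotate
    omega
  exact (aux h).antisymm (aux h.symm.rotate.rotate.rotate)

/-- Djoković's relation: an edge crossing the boundary of a halfspace defines that halfspace. -/
lemma halfspace_eq_of_crossing (hK : K.IsCATZero) {u v a b : V} (huv : K.graph.Adj u v)
    (hab : K.graph.Adj a b) (ha : a ∈ K.halfspace u v) (hb : b ∉ K.halfspace u v) :
    K.halfspace u v = K.halfspace a b := by
  induction hn : K.graph.dist u a using Nat.strong_induction_on generalizing a b with
  | _ n ih =>
  simp only [halfspace, mem_ofPred_eq] at ha hb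
  have h1 := dist_adj hK.1 a huv
  have h2 := dist_adj hK.1 b huv
  have h3 := dist_adj hK.1 u hab
  have h4 := dist_adj hK.1 v hab
  rw [SimpleGraph.dist_comm (u := a) (v := u), SimpleGraph.dist_comm (u := a) (v := v)] at h1 ha
  rw [SimpleGraph.dist_comm (u := b) (v := u), SimpleGraph.dist_comm (u := b) (v := v)] at h2 hb
  by_cases hvb : v = b
  · subst hvb
    have : K.graph.dist v v = 0 := SimpleGraph.dist_self
    have h5 : K.graph.dist u a = 0 := by omega
    rw [hK.1.1.dist_eq_zero_iff] at h5
    rw [h5]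
  -- Step from `b` toward `v`; the quadrangle condition seen from `u` gives a square whose edge
  -- opposite to `ab` also crosses the boundary, nearer to `u`.
  · obtain ⟨b', hb', hd⟩ := exists_adj_toward hK.1.1 hvb
    have h5 := dist_adj hK.1 u hb'
    have h6 := hK.1.1.dist_triangle (u := u) (v := v) (w := b')
    have h7 : K.graph.dist u v = 1 := SimpleGraph.dist_eq_one_iff_adj.2 huv
    obtain ⟨w, hw, hdw⟩ := exists_quadrangle hK (x := u) hab.symm hb'
      (by rintro rfl; omega) (by omega) (by omega)
    have h8 := dist_adj hK.1 v hw.adj₂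
    have h9 := dist_adj hK.1 v hw.adj₃
    rw [ih _ (by omega) hw.adj₃ ?_ ?_ rfl]
    · exact halfspace_eq_of_isSquare hK hw.rotate.rotate.symm
    · simp only [halfspace, mem_ofPred_eq]
      rw [SimpleGraph.dist_comm (u := w) (v := u), SimpleGraph.dist_comm (u := w) (v := v)]
      omega
    · simp only [halfspace, mem_ofPred_eq]
      rw [SimpleGraph.dist_comm (u := b') (v := u), SimpleGraph.dist_comm (u := b') (v := v)]
      omega

lemma compl_mem_halfspaces (hK : K.SimplyConnected) {A : Set V} (hA : A ∈ K.halfspaces) :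
    Aᶜ ∈ K.halfspaces := by
  obtain ⟨u, v, h, rfl⟩ := hA
  exact ⟨v, u, h.symm, compl_halfspace hK h⟩

/-- Along a geodesic each edge adds exactly one halfspace: by `halfspace_eq_of_crossing`, the only
halfspace it can leave is its own. -/
lemma wallSep_halfspaces (hK : K.IsCATZero) (x y : V) :
    (wallSep K.halfspaces x y).Finite ∧
      (wallSep K.halfspaces x y).ncard = K.graph.dist x y := by
  induction hn : K.graph.dist x y generalizing y with
  | zero =>
    rw [hK.1.1.dist_eq_zero_iff] at hn
    subst hn
    simp [MedianWalls.wallSep_self]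
  | succ n ih =>
    have hne : x ≠ y := by rintro rfl; simp at hn
    obtain ⟨z, hz, hd⟩ := exists_adj_toward hK.1.1 hne
    obtain ⟨h1, h2⟩ := ih z (by omega)
    have hsep : wallSep K.halfspaces x y =
        insert (K.halfspace z y) (wallSep K.halfspaces x z) := by
      ext A
      rw [mem_insert_iff]
      constructor
      · rintro ⟨hA, hx, hy⟩
        by_cases hzA : z ∈ A
        · left
          obtain ⟨u, v, huv, rfl⟩ := hA
          exact halfspace_eq_of_crossing hK huv hz.symm hzA hy
        · exact Or.inr ⟨hA, hx, hzA⟩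
      · rintro (rfl | ⟨hA, hx, hzA⟩)
        · refine ⟨⟨z, y, hz.symm, rfl⟩, ?_, ?_⟩
          · simp only [halfspace, mem_ofPred_eq]; omega
          · simp [halfspace]
        · refine ⟨hA, hx, fun hy => ?_⟩
          obtain ⟨u, v, huv, rfl⟩ := hA
          rw [halfspace_eq_of_crossing hK huv hz hy hzA] at hx
          simp only [halfspace, mem_ofPred_eq] at hx
          omega
    have hnot : K.halfspace z y ∉ wallSep K.halfspaces x z := fun h => h.2.2 (by
      have : K.graph.dist z y = 1 := SimpleGraph.dist_eq_one_iff_adj.2 hz.symm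
      simp [halfspace, this])
    rw [hsep]
    exact ⟨h1.insert _, by rw [ncard_insert_of_notMem hnot h1, h2]⟩

/-- If `p` left `A`, then `A` would count in `dist a p` without separating `a` from `b`, making the
detour through `p` strictly longer. -/
lemma convex_halfspace (hK : K.IsCATZero) {A : Set V} (hA : A ∈ K.halfspaces) {a b p : V}
    (ha : a ∈ A) (hb : b ∈ A)
    (h : K.graph.dist a b = K.graph.dist a p + K.graph.dist p b) : p ∈ A := by
  by_contra hp
  obtain ⟨f1, h1⟩ := wallSep_halfspaces hK a b
  obtain ⟨f2, h2⟩ := wallSep_halfspaces hK a p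
  obtain ⟨f3, h3⟩ := wallSep_halfspaces hK p b
  have hsub : wallSep K.halfspaces a b ⊆
      (wallSep K.halfspaces a p \ {A}) ∪ wallSep K.halfspaces p b := by
    rintro B ⟨hB, h4, h5⟩
    by_cases hpB : p ∈ B
    · exact Or.inr ⟨hB, hpB, h5⟩
    · exact Or.inl ⟨⟨hB, h4, hpB⟩, by rintro rfl; exact h5 hb⟩
  have h4 := (ncard_le_ncard hsub ((f2.sdiff).union f3)).trans (ncard_union_le _ _)
  have h5 := ncard_sdiff_singleton_add_one (s := wallSep K.halfspaces a p) ⟨hA, ha, hp⟩ f2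
  omega

/-- A vertex `p` without neighbours closer to both `x` and `z` lies between `x` and `z`. -/
lemma dist_eq_add_of_no_common (hK : K.IsCATZero) {x z p : V}
    (h : ∀ c, K.graph.Adj p c → K.graph.dist x c + 1 = K.graph.dist x p →
      K.graph.dist z c + 1 ≠ K.graph.dist z p) :
    K.graph.dist x z = K.graph.dist x p + K.graph.dist z p := by
  induction hn : K.graph.dist z p generalizing p with
  | zero =>
    rw [hK.1.1.dist_eq_zero_iff] at hn
    rw [hn, add_zero]
  | succ n ih =>
    have hne : z ≠ p := by rintro rfl; simp at hn
    obtain ⟨b, hb, hd⟩ := exists_adj_toward hK.1.1 hne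
    have h1 := dist_adj hK.1 x hb
    have h2 : ¬ K.graph.dist x b + 1 = K.graph.dist x p := fun h' => h b hb h' hd
    rw [ih (p := b) ?_ (by omega)]
    · omega
    · intro c hc hxc hzc
      -- The hypothesis passes to `b`: a neighbour of `b` nearer to both `x` and `z` is completed to
      -- a square containing `p`, and its fourth corner is a neighbour of `p` nearer to both.
      obtain ⟨w, hw, hdw⟩ := exists_quadrangle hK (x := x) hb.symm hc (by rintro rfl; omega)
        (by omega) hxc
      have h3 := dist_adj hK.1 z hw.adj₂
      have h4 := dist_adj hK.1 z hw.adj₃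
      exact h w hw.adj₂ hdw (by omega)

/-- Choose `p` as far as possible from `x` subject to lying between `x` and `y` and between `x` and
`z`. A neighbour of `p` nearer to both `y` and `z` would be a farther choice, so
`dist_eq_add_of_no_common` applies. -/
lemma exists_median (hK : K.IsCATZero) (x y z : V) :
    ∃ p, K.graph.dist x y = K.graph.dist x p + K.graph.dist p y ∧
      K.graph.dist y z = K.graph.dist y p + K.graph.dist p z ∧
      K.graph.dist x z = K.graph.dist x p + K.graph.dist p z := by
  let P : ℕ → Prop := fun n => ∃ p, K.graph.dist x p = n ∧
    K.graph.dist x y = K.graph.dist x p + K.graph.dist p y ∧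
    K.graph.dist x z = K.graph.dist x p + K.graph.dist p z
  classical
  have hP0 : P 0 := ⟨x, by simp⟩
  have hspec := Nat.findGreatest_spec (P := P) (Nat.zero_le (K.graph.dist x y)) hP0
  obtain ⟨p, hp, hxy, hxz⟩ := hspec
  refine ⟨p, hxy, ?_, hxz⟩
  rw [dist_eq_add_of_no_common hK (x := y) (z := z) (p := p) ?_, SimpleGraph.dist_comm (u := z)]
  intro c hc hyc hzc
  have h1 := dist_adj hK.1 x hc
  have h2 := hK.1.1.dist_triangle (u := x) (v := c) (w := y)
  have h3 := hK.1.1.dist_triangle (u := x) (v := c) (w := z)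
  rw [SimpleGraph.dist_comm (u := y), SimpleGraph.dist_comm (u := y)] at hyc
  rw [SimpleGraph.dist_comm (u := z), SimpleGraph.dist_comm (u := z)] at hzc
  have h4 : P (K.graph.dist x c) := ⟨c, rfl, by omega, by omega⟩
  have h5 := Nat.le_findGreatest (n := K.graph.dist x y) (by omega) h4
  omega

/-- The 1-skeleton of a CAT(0) cube complex is a median graph; its median is the majority vote over
the halfspaces. -/
lemma exists_medianWalls (hK : K.IsCATZero) : ∃ m, MedianWalls K.halfspaces m := by
  choose m h1 h2 h3 using exists_median hK
  have key : ∀ A ∈ K.halfspaces, ∀ x y z, (x ∈ A ∧ y ∈ A) ∨ (y ∈ A ∧ z ∈ A) ∨ (x ∈ A ∧ z ∈ A) →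
      m x y z ∈ A := by
    rintro A hA x y z (⟨hx, hy⟩ | ⟨hx, hy⟩ | ⟨hx, hy⟩)
    · exact convex_halfspace hK hA hx hy (h1 x y z)
    · exact convex_halfspace hK hA hx hy (h2 x y z)
    · exact convex_halfspace hK hA hx hy (h3 x y z)
  refine ⟨m, fun A hA => compl_mem_halfspaces hK.1 hA, fun x y => (wallSep_halfspaces hK x y).1,
    fun x y hne => ?_, fun A hA x y z => ⟨fun h => ?_, key A hA x y z⟩⟩
  · obtain ⟨hf, hn⟩ := wallSep_halfspaces hK x y
    have : (wallSep K.halfspaces x y).Nonempty := by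
      rw [nonempty_iff_ne_empty]
      intro h
      rw [h, ncard_empty] at hn
      exact hne (hK.1.1.dist_eq_zero_iff.1 hn.symm)
    exact this
  · by_contra hcon
    refine key Aᶜ (compl_mem_halfspaces hK.1 hA) x y z ?_ h
    simp only [mem_compl_iff]
    tauto

/-- Pairwise crossing halfspaces have a common transversal for every choice of sides. -/
lemma exists_orthant {m : V → V → V → V} {H : Set (Set V)} (hW : MedianWalls H m) {n : ℕ}
    {A : Fin n → Set V} (hA : ∀ i, A i ∈ H)
    (h1 : ∀ i, ∀ β : Prop, ∃ x, (x ∈ A i ↔ β))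
    (h2 : ∀ i j, i ≠ j → ∀ β γ : Prop, ∃ x, (x ∈ A i ↔ β) ∧ (x ∈ A j ↔ γ))
    [Nonempty V] (ε : Fin n → Prop) (T : Finset (Fin n)) : ∃ x, ∀ i ∈ T, (x ∈ A i ↔ ε i) := by
  induction hc : T.card using Nat.strong_induction_on generalizing T with
  | _ k ih =>
  have sub : ∀ i ∈ T, ∃ x, ∀ j ∈ T, j ≠ i → (x ∈ A j ↔ ε j) := fun i hi => by
    obtain ⟨x, hx⟩ := ih (T.erase i).card (by rw [← hc]; exact Finset.card_erase_lt_of_mem hi)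
      (T.erase i) rfl
    exact ⟨x, fun j hj hne => hx j (Finset.mem_erase.2 ⟨hne, hj⟩)⟩
  by_cases h3 : 2 < T.card
  · obtain ⟨i, j, k, hi, hj, hk, hij, hik, hjk⟩ := Finset.two_lt_card_iff.1 h3
    obtain ⟨a, ha⟩ := sub i hi
    obtain ⟨b, hb⟩ := sub j hj
    obtain ⟨c, hc⟩ := sub k hk
    refine ⟨m a b c, fun l hl => ?_⟩
    rw [hW.majority _ (hA l)]
    by_cases hli : l = i
    · subst hli
      rw [hb l hl hij, hc l hl hik]; tauto
    · by_cases hlj : l = j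
      · subst hlj
        rw [ha l hl hli, hc l hl hjk]; tauto
      · rw [ha l hl hli, hb l hl hlj]; tauto
  · have : T.card = 0 ∨ T.card = 1 ∨ T.card = 2 := by omega
    rcases this with h | h | h
    · rw [Finset.card_eq_zero.1 h]
      exact ⟨Classical.arbitrary V, by simp⟩
    · obtain ⟨i, rfl⟩ := Finset.card_eq_one.1 h
      simpa using h1 i (ε i)
    · obtain ⟨i, j, hij, rfl⟩ := Finset.card_eq_two.1 h
      simpa using h2 i j hij (ε i) (ε j)

/-- In a CAT(0) cube complex of dimension at most `N`, at most `N` halfspaces cross pairwise. -/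
lemma crossingBound (hK : K.IsCATZero) {N : ℕ}
    (hN : ∀ (n : ℕ) (φ : (Fin n → Bool) → V), IsCubeChart K.cubes φ → n ≤ N) :
    CrossingBound K.halfspaces N := by
  classical
  intro n A hA hcross
  obtain ⟨m, hW⟩ := exists_medianWalls hK
  have := hK.1.1.nonempty
  have hone : ∀ i, ∀ β : Prop, ∃ x, (x ∈ A i ↔ β) := by
    intro i β
    obtain ⟨u, v, huv, h⟩ := hA i
    have : K.graph.dist u v = 1 := SimpleGraph.dist_eq_one_iff_adj.2 huv
    rw [h]
    by_cases hβ : β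
    · exact ⟨u, by simp [halfspace, hβ, this]⟩
    · exact ⟨v, by simp [halfspace, hβ]⟩
  have orth : ∀ ε : Fin n → Prop, ∃ x, ∀ i, (x ∈ A i ↔ ε i) := fun ε => by
    obtain ⟨x, hx⟩ := exists_orthant hW hA hone hcross ε Finset.univ
    exact ⟨x, fun i => hx i (Finset.mem_univ i)⟩
  obtain ⟨z, hz⟩ := orth fun _ => False
  -- A vertex of the orthant where all `A i` hold, nearest to a vertex `z` of the opposite orthant;
  -- it will be a corner of a cube crossed by all `A i`.
  obtain ⟨y, hy, hmin⟩ := exists_minimalFor_of_wellFoundedLT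
    (fun y => ∀ i, y ∈ A i) (fun y => K.graph.dist z y) (by
      obtain ⟨y, hy⟩ := orth fun _ => True
      exact ⟨y, fun i => (hy i).2 trivial⟩)
  have nbr : ∀ i, ∃ a, K.graph.Adj y a ∧ K.graph.dist z a + 1 = K.graph.dist z y ∧
      ∀ j, (a ∈ A j ↔ j ≠ i) := by
    intro i
    -- The median of `z`, `y`, `q` leaves `A i` and no other member of the family. The first step
    -- from `y` toward it approaches `z`, so by minimality of `y` it already leaves `A i`.
    obtain ⟨q, hq⟩ := orth fun j => j ≠ i
    obtain ⟨p, h1, h2, h3⟩ := exists_median hK z y q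
    have hpi : p ∉ A i := by
      refine convex_halfspace hK (compl_mem_halfspaces hK.1 (hA i)) (a := z) (b := q) ?_ ?_ h3
      · exact fun h => (hz i).1 h
      · exact fun h => (hq i).1 h rfl
    have hpj : ∀ j, j ≠ i → p ∈ A j := fun j hj =>
      convex_halfspace hK (hA j) (hy j) ((hq j).2 hj) h2
    obtain ⟨a, ha, hd⟩ := exists_adj_toward hK.1.1 (x := p) (u := y)
      (by rintro rfl; exact hpi (hy i))
    have h4 := hK.1.1.dist_triangle (u := z) (v := p) (w := a)
    have h5 := dist_adj hK.1 z ha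
    have hza : K.graph.dist z a + 1 = K.graph.dist z y := by omega
    have haj : ∀ j, j ≠ i → a ∈ A j := fun j hj => by
      refine convex_halfspace hK (hA j) (hpj j hj) (hy j) (p := a) ?_
      have : K.graph.dist a y = 1 := SimpleGraph.dist_eq_one_iff_adj.2 ha.symm
      omega
    have hai : a ∉ A i := by
      intro hai
      have hle := hmin (j := a) (fun j => by
        by_cases hj : j = i
        · rw [hj]; exact hai
        · exact haj j hj) (by simp only; omega)
      simp only at hle
      omega
    exact ⟨a, ha, hza, fun j => ⟨fun h => by rintro rfl; exact hai h, haj j⟩⟩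
  choose f hf1 hf2 hf3 using nbr
  have hinj : ∀ i j, f i = f j → i = j := by
    intro i j h
    by_contra hij
    have := (hf3 j i).2 hij
    rw [← h] at this
    exact (hf3 i i).1 this rfl
  -- All these neighbours of `y` are nearer to `z`, so they pairwise span squares and lie in one
  -- cube, in distinct directions.
  obtain ⟨k, φ, b, hφ, rfl, hk⟩ := exists_chart_of_pairwise_square hK (v := y) (S := range f)
    (finite_range f) (by rintro _ ⟨i, rfl⟩; exact hf1 i) (by
      rintro _ ⟨i, rfl⟩ _ ⟨j, rfl⟩ hne
      obtain ⟨w, hw, -⟩ := exists_quadrangle hK (hf1 i) (hf1 j) hne (hf2 i) (hf2 j)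
      exact ⟨w, hw⟩)
  choose g hg using fun i => hk (f i) ⟨i, rfl⟩
  have hgi : Function.Injective g := fun i j h => hinj i j (by rw [hg, hg, h])
  have h := Fintype.card_le_of_injective g hgi
  simp only [Fintype.card_fin] at h
  exact h.trans (hN k φ hφ)

end CubeComplex

/-! ### Multilinear interpolation on the cube -/

/-- The multilinear weight of the vertex `b` at the point `x` of the cube. -/
noncomputable def cubeWeight {n : ℕ} (x : Fin n → ℝ) (b : Fin n → Bool) : ℝ :=
  ∏ i, (if b i then x i else 1 - x i)

lemma sum_bool_cons {n : ℕ} (F : (Fin (n + 1) → Bool) → ℝ) :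
    ∑ b, F b = ∑ b : Fin n → Bool, F (Fin.cons true b) + ∑ b : Fin n → Bool, F (Fin.cons false b) := by
  rw [← (Fin.consEquiv (fun _ : Fin (n + 1) => Bool)).sum_comp, Fintype.sum_prod_type]
  simp [Fin.consEquiv]

lemma cubeWeight_cons {n : ℕ} (x : Fin (n + 1) → ℝ) (c : Bool) (b : Fin n → Bool) :
    cubeWeight x (Fin.cons c b) = (if c then x 0 else 1 - x 0) * cubeWeight (Fin.tail x) b := by
  simp [cubeWeight, Fin.prod_univ_succ, Fin.tail]

lemma cubeWeight_nonneg {n : ℕ} {x : Fin n → ℝ} (hx : x ∈ CubeComplex.solidCube n)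
    (b : Fin n → Bool) : 0 ≤ cubeWeight x b := by
  refine Finset.prod_nonneg fun i _ => ?_
  have := hx i
  split_ifs <;> linarith

lemma sum_cubeWeight {n : ℕ} (x : Fin n → ℝ) : ∑ b, cubeWeight x b = 1 := by
  induction n with
  | zero => simp [cubeWeight]
  | succ n ih =>
    rw [sum_bool_cons]
    simp only [cubeWeight_cons, ← Finset.mul_sum, ih]
    simp

lemma cubeWeight_vertex {n : ℕ} (b c : Fin n → Bool) :
    cubeWeight (fun i => if b i then 1 else 0) c = if c = b then 1 else 0 := by
  rw [cubeWeight]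
  split_ifs with h
  · subst h
    refine Finset.prod_eq_one fun i _ => ?_
    cases c i <;> simp
  · obtain ⟨i, hi⟩ := Function.ne_iff.1 h
    refine Finset.prod_eq_zero (Finset.mem_univ i) ?_
    cases h1 : c i <;> cases h2 : b i <;> simp_all

/-- The multilinear extension of a function that is 1-Lipschitz along edges of the cube is
1-Lipschitz for the `ℓ¹` metric. -/
lemma abs_interpolation_sub_le {n : ℕ} (g : (Fin n → Bool) → ℝ)
    (hg : ∀ b i, |g b - g (boolFlip b i)| ≤ 1) {x y : Fin n → ℝ}
    (hx : x ∈ CubeComplex.solidCube n) (hy : y ∈ CubeComplex.solidCube n) :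
    |∑ b, cubeWeight x b * g b - ∑ b, cubeWeight y b * g b| ≤ ∑ i, |x i - y i| := by
  induction n with
  | zero => simp [cubeWeight]
  | succ n ih =>
    have hflip : ∀ (c : Bool) (b : Fin n → Bool) (i : Fin n),
        boolFlip (Fin.cons c b : Fin (n + 1) → Bool) i.succ = Fin.cons c (boolFlip b i) := by
      intro c b i
      simp [boolFlip, Fin.cons_update]
    have hflip0 : ∀ b : Fin n → Bool,
        boolFlip (Fin.cons true b : Fin (n + 1) → Bool) 0 = Fin.cons false b := by
      intro b
      simp [boolFlip, Fin.update_cons_zero]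
    have htx : Fin.tail x ∈ CubeComplex.solidCube n := fun i => hx i.succ
    have hty : Fin.tail y ∈ CubeComplex.solidCube n := fun i => hy i.succ
    have h1 := ih (fun b => g (Fin.cons true b)) (fun b i => by rw [← hflip]; exact hg _ _) htx hty
    have h0 := ih (fun b => g (Fin.cons false b)) (fun b i => by rw [← hflip]; exact hg _ _) htx hty
    have hd : |∑ b, cubeWeight (Fin.tail x) b * g (Fin.cons true b) -
        ∑ b, cubeWeight (Fin.tail x) b * g (Fin.cons false b)| ≤ 1 := by
      rw [← Finset.sum_sub_distrib]
      calc _ ≤ ∑ b, |cubeWeight (Fin.tail x) b * g (Fin.cons true b) -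
            cubeWeight (Fin.tail x) b * g (Fin.cons false b)| := Finset.abs_sum_le_sum_abs _ _
        _ ≤ ∑ b, cubeWeight (Fin.tail x) b := Finset.sum_le_sum fun b _ => by
          rw [← mul_sub, abs_mul, abs_of_nonneg (cubeWeight_nonneg htx b)]
          have := hg (Fin.cons true b) 0
          rw [hflip0] at this
          exact mul_le_of_le_one_right (cubeWeight_nonneg htx b) this
        _ = 1 := sum_cubeWeight _
    rw [sum_bool_cons, sum_bool_cons, Fin.sum_univ_succ]
    simp only [cubeWeight_cons, mul_assoc, ← Finset.mul_sum, if_true, Bool.false_eq_true, if_false]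
    have hs : ∑ i : Fin n, |x i.succ - y i.succ| = ∑ i, |Fin.tail x i - Fin.tail y i| := rfl
    rw [hs]
    set X1 := ∑ b, cubeWeight (Fin.tail x) b * g (Fin.cons true b)
    set X0 := ∑ b, cubeWeight (Fin.tail x) b * g (Fin.cons false b)
    set Y1 := ∑ b, cubeWeight (Fin.tail y) b * g (Fin.cons true b)
    set Y0 := ∑ b, cubeWeight (Fin.tail y) b * g (Fin.cons false b)
    set T := ∑ i, |Fin.tail x i - Fin.tail y i|
    -- Move the first coordinate with the others fixed at `x`, then move the others as a convex
    -- combination of two opposite facets.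
    have e : x 0 * X1 + (1 - x 0) * X0 - (y 0 * Y1 + (1 - y 0) * Y0) =
        (x 0 - y 0) * (X1 - X0) + (y 0 * (X1 - Y1) + (1 - y 0) * (X0 - Y0)) := by ring
    rw [e]
    have hy0 := hy 0
    refine (abs_add_le _ _).trans (add_le_add ?_ ((abs_add_le _ _).trans ?_))
    · rw [abs_mul]
      exact mul_le_of_le_one_right (abs_nonneg _) hd
    · rw [abs_mul, abs_mul, abs_of_nonneg hy0.1, abs_of_nonneg (by linarith : (0 : ℝ) ≤ 1 - y 0)]
      have h2 := mul_le_mul_of_nonneg_left h1 hy0.1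
      have h3 := mul_le_mul_of_nonneg_left h0 (by linarith : (0 : ℝ) ≤ 1 - y 0)
      linarith

/-! ### Points of the realization in charts, and multilinear extension. -/

namespace CubeComplex

variable {V : Type*} {K : CubeComplex V}

lemma weight_apply {n : ℕ} {φ : (Fin n → Bool) → V} (hφ : Function.Injective φ)
    (x : Fin n → ℝ) (b : Fin n → Bool) : weight φ x (φ b) = cubeWeight x b := by
  rw [weight, Finset.sum_eq_single b]
  · simp [cubeWeight]
  · intro c _ hc
    rw [if_neg (fun h => hc (hφ h))]
  · simp

lemma weight_of_notMem {n : ℕ} {φ : (Fin n → Bool) → V} (x : Fin n → ℝ) {v : V}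
    (hv : v ∉ range φ) : weight φ x v = 0 :=
  Finset.sum_eq_zero fun b _ => if_neg fun h => hv ⟨b, h⟩

/-- The multilinear extension of a function on the vertices. -/
noncomputable def interpolate (K : CubeComplex V) (g : V → ℝ) (p : K.Realization) : ℝ :=
  ∑ᶠ v, p.1 v * g v

lemma interpolate_eq (g : V → ℝ) {p : K.Realization} {n : ℕ} {φ : (Fin n → Bool) → V}
    (hφ : Function.Injective φ) {x : Fin n → ℝ} (hp : p.1 = weight φ x) :
    K.interpolate g p = ∑ b, cubeWeight x b * g (φ b) := by
  classical
  rw [interpolate, hp, finsum_eq_sum_of_support_subset (s := Finset.univ.image φ),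
    Finset.sum_image hφ.injOn]
  · simp only [weight_apply hφ]
  · intro v hv
    by_contra h
    have : v ∉ range φ := by simpa using h
    simp [weight_of_notMem x this] at hv

lemma isCubeChart_point (K : CubeComplex V) (v : V) :
    IsCubeChart K.cubes (fun _ : Fin 0 → Bool => v) := by
  refine ⟨fun _ _ _ => Subsingleton.elim _ _, fun s hs => ?_⟩
  have hc : ∀ σ : Fin 0 → Option Bool, (fun _ : Fin 0 → Bool => v) '' cubeFace σ = {v} := by
    intro σ
    have : cubeFace σ = univ := by
      ext; simp [cubeFace]
    rw [this]; simp
  simp only [hc, exists_const]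
  constructor
  · intro h
    obtain ⟨n, φ, -, rfl⟩ := K.exists_chart s h
    have hsv : range φ ⊆ {v} := hs.trans (by rintro _ ⟨_, rfl⟩; rfl)
    exact (Set.Nonempty.subset_singleton_iff (range_nonempty φ)).1 hsv
  · rintro rfl; exact K.singleton_mem v

/-- A vertex as a point of the realization. -/
noncomputable def vertexPoint (K : CubeComplex V) (v : V) : K.Realization :=
  ⟨weight (fun _ : Fin 0 → Bool => v) 0, 0, _, 0, K.isCubeChart_point v, fun i => i.elim0, rfl⟩

lemma vertexPoint_eq_weight {n : ℕ} {φ : (Fin n → Bool) → V} (hφ : Function.Injective φ)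
    (b : Fin n → Bool) :
    (K.vertexPoint (φ b)).1 = weight φ (fun i => if b i then 1 else 0) := by
  classical
  funext v
  have h0 : (K.vertexPoint (φ b)).1 v = if φ b = v then 1 else 0 := by
    simp [vertexPoint, weight]
  rw [h0]
  by_cases hv : v ∈ range φ
  · obtain ⟨c, rfl⟩ := hv
    rw [weight_apply hφ, cubeWeight_vertex]
    simp only [hφ.eq_iff, eq_comm (a := c)]
  · rw [weight_of_notMem _ hv, if_neg fun h => hv ⟨b, h⟩]

lemma vertex_mem_solidCube {n : ℕ} (b : Fin n → Bool) :
    (fun i => if b i then 1 else 0 : Fin n → ℝ) ∈ solidCube n := by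
  intro i
  cases h : b i <;> simp [h]

lemma interpolate_vertexPoint (g : V → ℝ) (v : V) : K.interpolate g (K.vertexPoint v) = g v := by
  rw [interpolate_eq g (K.isCubeChart_point v).1 rfl]
  simp [cubeWeight]

/-! ### Length metrics -/

/-- A symmetric length on cubes that is at most the `ℓ¹` length, and at least a fixed fraction of it
on the cubes of `K`. -/
structure IsCubeLength (K : CubeComplex V) (δ : ∀ n : ℕ, (Fin n → ℝ) → (Fin n → ℝ) → ℝ) (N : ℕ)
    (c : ℝ) : Prop where
  dim_le : ∀ (n : ℕ) (φ : (Fin n → Bool) → V), IsCubeChart K.cubes φ → n ≤ N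
  pos : 0 < c
  symm : ∀ n x y, δ n x y = δ n y x
  le_sum : ∀ n x y, δ n x y ≤ ∑ i, |x i - y i|
  sum_le : ∀ n x y, n ≤ N → ∑ i, |x i - y i| ≤ c * δ n x y

variable {δ : ∀ n : ℕ, (Fin n → ℝ) → (Fin n → ℝ) → ℝ}

lemma IsString.append {p q r : K.Realization} {l l' : ℝ} (h : K.IsString δ p q l)
    (h' : K.IsString δ q r l') : K.IsString δ p r (l + l') := by
  induction h with
  | nil p => simpa using h'
  | cons φ hφ x y hx hy hp hp' _ ih =>
    rw [add_assoc]
    exact .cons φ hφ x y hx hy hp hp' (ih h')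

lemma IsString.single {n : ℕ} {φ : (Fin n → Bool) → V} (hφ : IsCubeChart K.cubes φ)
    {x y : Fin n → ℝ} (hx : x ∈ solidCube n) (hy : y ∈ solidCube n)
    {p q : K.Realization} (hp : p.1 = weight φ x) (hq : q.1 = weight φ y) :
    K.IsString δ p q (δ n x y) := by
  simpa using IsString.cons φ hφ x y hx hy hp hq (.nil q)

namespace IsCubeLength

variable {N : ℕ} {c : ℝ}

lemma string_symm (hδ : K.IsCubeLength δ N c) {p q : K.Realization} {l : ℝ}
    (h : K.IsString δ p q l) : K.IsString δ q p l := by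
  induction h with
  | nil p => exact .nil p
  | @cons n φ hφ x y hx hy p p' q l hp hp' _ ih =>
    rw [add_comm, hδ.symm]
    exact ih.append (.single hφ hy hx hp' hp)

lemma nonneg_of_le (hδ : K.IsCubeLength δ N c) {n : ℕ} (hn : n ≤ N) (x y : Fin n → ℝ) :
    0 ≤ δ n x y := by
  have h1 := hδ.sum_le n x y hn
  have h2 : 0 ≤ ∑ i, |x i - y i| := Finset.sum_nonneg fun i _ => abs_nonneg _
  exact nonneg_of_mul_nonneg_right (h2.trans h1) hδ.pos

lemma string_nonneg (hδ : K.IsCubeLength δ N c) {p q : K.Realization} {l : ℝ}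
    (h : K.IsString δ p q l) : 0 ≤ l := by
  induction h with
  | nil p => exact le_rfl
  | cons φ hφ x y hx hy hp hp' _ ih =>
    exact add_nonneg (hδ.nonneg_of_le (hδ.dim_le _ _ hφ) x y) ih

lemma lengthDist_le (hδ : K.IsCubeLength δ N c) {p q : K.Realization} {l : ℝ}
    (h : K.IsString δ p q l) : K.lengthDist δ p q ≤ l :=
  csInf_le ⟨0, fun _ h => hδ.string_nonneg h⟩ h

lemma string_adj (hδ : K.IsCubeLength δ N c) {u v : V} (h : K.graph.Adj u v) :
    ∃ l ≤ 1, K.IsString δ (K.vertexPoint u) (K.vertexPoint v) l := by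
  obtain ⟨n, φ, hφ, hr⟩ := K.exists_chart _ h.2
  obtain ⟨b, rfl⟩ : u ∈ range φ := by rw [hr]; simp
  obtain ⟨b', rfl⟩ : v ∈ range φ := by rw [hr]; simp
  obtain ⟨i, rfl⟩ := exists_flip_of_adj hφ h
  refine ⟨_, (hδ.le_sum _ _ _).trans ?_, .single hφ (vertex_mem_solidCube b)
    (vertex_mem_solidCube _) (vertexPoint_eq_weight hφ.1 _) (vertexPoint_eq_weight hφ.1 _)⟩
  rw [Finset.sum_eq_single i]
  · rw [boolFlip_same]
    cases b i <;> simp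
  · intro j _ hj
    rw [boolFlip_of_ne _ hj]; simp
  · simp

lemma string_walk (hδ : K.IsCubeLength δ N c) {u v : V} (w : K.graph.Walk u v) :
    ∃ l ≤ (w.length : ℝ), K.IsString δ (K.vertexPoint u) (K.vertexPoint v) l := by
  induction w with
  | nil => exact ⟨0, by simp, .nil _⟩
  | cons h w ih =>
    obtain ⟨l, hl, hs⟩ := hδ.string_adj h
    obtain ⟨l', hl', hs'⟩ := ih
    refine ⟨l + l', ?_, hs.append hs'⟩
    rw [SimpleGraph.Walk.length_cons]
    push_cast
    linarith

lemma lengthDist_vertex_le (hδ : K.IsCubeLength δ N c) (hc : K.graph.Connected) (u v : V) :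
    K.lengthDist δ (K.vertexPoint u) (K.vertexPoint v) ≤ K.graph.dist u v := by
  obtain ⟨w, hw⟩ := hc.exists_walk_length_eq_dist u v
  obtain ⟨l, hl, hs⟩ := hδ.string_walk w
  rw [← hw]
  exact (hδ.lengthDist_le hs).trans hl

lemma exists_string_vertex {p : K.Realization} {n : ℕ} {φ : (Fin n → Bool) → V} {x : Fin n → ℝ}
    (hδ : K.IsCubeLength δ N c)
    (hφ : IsCubeChart K.cubes φ) (hx : x ∈ solidCube n) (hp : p.1 = weight φ x) :
    ∃ l ≤ (N : ℝ), K.IsString δ p (K.vertexPoint (φ fun _ => false)) l := by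
  refine ⟨_, (hδ.le_sum _ _ _).trans ?_, .single hφ hx
    (vertex_mem_solidCube fun _ => false) hp (vertexPoint_eq_weight hφ.1 _)⟩
  calc _ ≤ ∑ _i : Fin n, (1 : ℝ) := Finset.sum_le_sum fun i _ => by
        have := hx i
        simp only [Bool.false_eq_true, if_false, sub_zero]
        rw [abs_of_nonneg this.1]; exact this.2
    _ = n := by simp
    _ ≤ N := by exact_mod_cast hδ.dim_le n φ hφ

lemma exists_string (hδ : K.IsCubeLength δ N c) (hc : K.graph.Connected) (p q : K.Realization) :
    ∃ l, K.IsString δ p q l := by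
  obtain ⟨n, φ, x, hφ, hx, hp⟩ := p.2
  obtain ⟨n', φ', x', hφ', hx', hq⟩ := q.2
  obtain ⟨l, -, h⟩ := hδ.exists_string_vertex hφ hx hp
  obtain ⟨l', -, h'⟩ := hδ.exists_string_vertex hφ' hx' hq
  obtain ⟨w⟩ := hc.preconnected (φ fun _ => false) (φ' fun _ => false)
  obtain ⟨l'', -, h''⟩ := hδ.string_walk w
  exact ⟨_, (h.append h'').append (hδ.string_symm h')⟩

lemma lengthDist_comm (hδ : K.IsCubeLength δ N c) (p q : K.Realization) :
    K.lengthDist δ p q = K.lengthDist δ q p := by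
  have : {l | K.IsString δ p q l} = {l | K.IsString δ q p l} :=
    Set.ext fun l => ⟨hδ.string_symm, hδ.string_symm⟩
  rw [lengthDist, this, lengthDist]

lemma lengthDist_triangle (hδ : K.IsCubeLength δ N c) (hc : K.graph.Connected)
    (p q r : K.Realization) :
    K.lengthDist δ p r ≤ K.lengthDist δ p q + K.lengthDist δ q r := by
  have h1 : ∀ l, K.IsString δ p q l → ∀ l', K.IsString δ q r l' → K.lengthDist δ p r ≤ l + l' :=
    fun l h l' h' => hδ.lengthDist_le (h.append h')
  have h2 : ∀ l, K.IsString δ p q l → K.lengthDist δ p r - l ≤ K.lengthDist δ q r := fun l h =>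
    le_csInf (hδ.exists_string hc q r) fun l' h' => by linarith [h1 l h l' h']
  have h3 : K.lengthDist δ p r - K.lengthDist δ q r ≤ K.lengthDist δ p q :=
    le_csInf (hδ.exists_string hc p q) fun l h => by linarith [h2 l h]
  linarith

/-- Interpolations of functions that are 1-Lipschitz on the 1-skeleton are Lipschitz. -/
lemma interpolate_sub_le (hδ : K.IsCubeLength δ N c) {g : V → ℝ}
    (hg : ∀ u v, K.graph.Adj u v → |g u - g v| ≤ 1) {p q : K.Realization} {l : ℝ}
    (h : K.IsString δ p q l) : |K.interpolate g p - K.interpolate g q| ≤ c * l := by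
  induction h with
  | nil p => simp
  | @cons n φ hφ x y hx hy p p' q l hp hp' _ ih =>
    have h1 : |K.interpolate g p - K.interpolate g p'| ≤ c * δ n x y := by
      rw [interpolate_eq g hφ.1 hp, interpolate_eq g hφ.1 hp']
      exact (abs_interpolation_sub_le (fun b => g (φ b))
        (fun b i => hg _ _ (adj_of_chart hφ b i)) hx hy).trans
        (hδ.sum_le n x y (hδ.dim_le n φ hφ))
    rw [mul_add]
    exact (abs_sub_le _ _ _).trans (add_le_add h1 ih)

/-- The test function is the distance to `u`: its interpolation changes along a string by at most
`c` times the length. -/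
lemma dist_le_lengthDist (hδ : K.IsCubeLength δ N c) (hc : K.graph.Connected) (u v : V) :
    (K.graph.dist u v : ℝ) ≤ c * K.lengthDist δ (K.vertexPoint u) (K.vertexPoint v) := by
  have hg : ∀ a b, K.graph.Adj a b → |(K.graph.dist u a : ℝ) - K.graph.dist u b| ≤ 1 := by
    intro a b hab
    have h1 : K.graph.dist a b = 1 := SimpleGraph.dist_eq_one_iff_adj.2 hab
    have h2 := hc.dist_triangle (u := u) (v := a) (w := b)
    have h3 := hc.dist_triangle (u := u) (v := b) (w := a)
    rw [SimpleGraph.dist_comm (u := b) (v := a)] at h3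
    rw [h1] at h2 h3
    rw [abs_sub_le_iff]
    constructor
    · rw [sub_le_iff_le_add']; exact_mod_cast h3
    · rw [sub_le_iff_le_add']; exact_mod_cast h2
  rw [← div_le_iff₀' hδ.pos]
  refine le_csInf (hδ.exists_string hc _ _) fun l hl => ?_
  rw [div_le_iff₀' hδ.pos]
  have := hδ.interpolate_sub_le hg hl
  rw [interpolate_vertexPoint, interpolate_vertexPoint, SimpleGraph.dist_self, abs_sub_comm] at this
  simpa using this

end IsCubeLength

lemma isCubeLength_l1 {N : ℕ}
    (hN : ∀ (n : ℕ) (φ : (Fin n → Bool) → V), IsCubeChart K.cubes φ → n ≤ N) :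
    K.IsCubeLength (fun _ x y => ∑ i, |x i - y i|) N 1 where
  dim_le := hN
  pos := one_pos
  symm n x y := by simp only [abs_sub_comm]
  le_sum n x y := le_rfl
  sum_le n x y _ := by rw [one_mul]

/-- Each coordinate difference is at most the Euclidean length, which gives the factor `N`; the
added 1 keeps the constant positive in dimension 0. -/
lemma isCubeLength_euclidean {N : ℕ}
    (hN : ∀ (n : ℕ) (φ : (Fin n → Bool) → V), IsCubeChart K.cubes φ → n ≤ N) :
    K.IsCubeLength (fun _ x y => Real.sqrt (∑ i, (x i - y i) ^ 2)) N (N + 1) where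
  dim_le := hN
  pos := by positivity
  symm n x y := by
    congr 1
    exact Finset.sum_congr rfl fun i _ => by ring
  le_sum n x y := by
    rw [Real.sqrt_le_left (Finset.sum_nonneg fun i _ => abs_nonneg _)]
    calc ∑ i, (x i - y i) ^ 2 = ∑ i, |x i - y i| ^ 2 := by simp only [sq_abs]
      _ ≤ _ := Finset.sum_sq_le_sq_sum_of_nonneg fun i _ => abs_nonneg _
  sum_le n x y hn := by
    have h : ∀ i ∈ Finset.univ, |x i - y i| ≤ Real.sqrt (∑ i, (x i - y i) ^ 2) := fun i hi =>
      Real.abs_le_sqrt (Finset.single_le_sum (f := fun i => (x i - y i) ^ 2)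
        (fun i _ => sq_nonneg _) hi)
    refine (Finset.sum_le_card_nsmul _ _ _ h).trans ?_
    rw [nsmul_eq_mul, Finset.card_univ, Fintype.card_fin]
    refine mul_le_mul_of_nonneg_right ?_ (Real.sqrt_nonneg _)
    have : (n : ℝ) ≤ N := by exact_mod_cast hn
    linarith

/-- Every point of the realization is close to a vertex, in both metrics. -/
lemma exists_vertex_near {N : ℕ}
    (hN : ∀ (n : ℕ) (φ : (Fin n → Bool) → V), IsCubeChart K.cubes φ → n ≤ N)
    (p : K.Realization) :
    ∃ v, K.l1Dist p (K.vertexPoint v) ≤ N ∧ K.euclideanDist p (K.vertexPoint v) ≤ N := by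
  obtain ⟨n, φ, x, hφ, hx, hp⟩ := p.2
  obtain ⟨l, hl, h⟩ := (isCubeLength_l1 hN).exists_string_vertex hφ hx hp
  obtain ⟨l', hl', h'⟩ := (isCubeLength_euclidean hN).exists_string_vertex hφ hx hp
  exact ⟨_, ((isCubeLength_l1 hN).lengthDist_le h).trans hl,
    ((isCubeLength_euclidean hN).lengthDist_le h').trans hl'⟩

end CubeComplex

/-! ### Bounded generation and coarse connectedness of a subalgebra. -/

namespace MedianWalls

variable {M : Type*} {H : Set (Set M)} {m : M → M → M → M}

/-- The median of a set closed under medians. -/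
noncomputable def restrict (m : M → M → M → M) (S : Set M)
    (hS : ∀ a ∈ S, ∀ b ∈ S, ∀ c ∈ S, m a b c ∈ S) : S → S → S → S :=
  fun a b c => ⟨m a b c, hS _ a.2 _ b.2 _ c.2⟩

lemma val_mem_medianIter {S T : Set M} (hT : ∀ a ∈ T, ∀ b ∈ T, ∀ c ∈ T, m a b c ∈ T) (k : ℕ)
    {x : T} (hx : x ∈ medianIter (restrict m T hT) (Subtype.val ⁻¹' S) k) :
    (x : M) ∈ medianIter m S k := by
  induction k generalizing x with
  | zero => exact hx
  | succ k ih =>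
    obtain ⟨a, ha, b, hb, c, hc, rfl⟩ := hx
    exact ⟨a, ih ha, b, ih hb, c, ih hc, rfl⟩

lemma mem_medianIter_restrict {S T : Set M} (hT : ∀ a ∈ T, ∀ b ∈ T, ∀ c ∈ T, m a b c ∈ T)
    (k : ℕ) (hk : medianIter m S k ⊆ T) (hW : MedianWalls H m) {x : T}
    (hx : (x : M) ∈ medianIter m S k) :
    x ∈ medianIter (restrict m T hT) (Subtype.val ⁻¹' S) k := by
  induction k generalizing x with
  | zero => exact hx
  | succ k ih =>
    have hk' := (hW.medianIter_mono S (Nat.le_succ k)).trans hk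
    obtain ⟨a, ha, b, hb, c, hc, h⟩ := hx
    exact ⟨⟨a, hk' ha⟩, ih hk' ha, ⟨b, hk' hb⟩, ih hk' hb, ⟨c, hk' hc⟩, ih hk' hc, Subtype.ext h⟩

/-- A median subalgebra is generated from a generating set in a bounded number of steps. -/
lemma medianSpan_eq_medianIter (hW : MedianWalls H m) {N : ℕ} (hN : CrossingBound H N)
    (S : Set M) : medianSpan m S = medianIter m S (2 * N + 1) := by
  refine Subset.antisymm (fun x hx => ?_) (subset_iUnion (medianIter m S) _)
  have hT : ∀ a ∈ medianSpan m S, ∀ b ∈ medianSpan m S, ∀ c ∈ medianSpan m S,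
      m a b c ∈ medianSpan m S := fun a ha b hb c hc => hW.median_mem_medianSpan ha hb hc
  -- `medianIter_eq_univ` concerns sets generating the whole algebra, so it is applied inside the
  -- subalgebra with the trace halfspaces.
  have hW' := hW.trace (restrict m _ hT) (fun _ _ _ => rfl)
  refine val_mem_medianIter hT _ (x := ⟨x, hx⟩)
    (hW'.medianIter_eq_univ (crossingBound_trace hN _) ?_ _)
  refine eq_univ_of_forall fun y => ?_
  obtain ⟨k, hk⟩ := mem_iUnion.1 y.2
  exact mem_iUnion.2 ⟨k, mem_medianIter_restrict hT k (subset_iUnion (medianIter m S) k) hW hk⟩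

/-- If `S` is connected by bounded jumps and `T` is within bounded distance of `S`, then `T` is
connected by bounded jumps. -/
lemma reflTransGen_of_near (hW : MedianWalls H m) {S T : Set M} (hST : S ⊆ T) {r R : ℕ}
    (hS : ∀ x y : S, Relation.ReflTransGen (fun a b : S => (wallSep H (a : M) b).ncard ≤ r) x y)
    (hT : ∀ x ∈ T, ∃ s ∈ S, (wallSep H s x).ncard ≤ R) (x y : T) :
    Relation.ReflTransGen (fun a b : T => (wallSep H (a : M) b).ncard ≤ r + R) x y := by
  obtain ⟨s, hs, h1⟩ := hT x x.2
  obtain ⟨t, ht, h2⟩ := hT y y.2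
  have h3 : Relation.ReflTransGen (fun a b : T => (wallSep H (a : M) b).ncard ≤ r + R)
      ⟨s, hST hs⟩ ⟨t, hST ht⟩ :=
    (hS ⟨s, hs⟩ ⟨t, ht⟩).lift (fun a : S => (⟨a, hST a.2⟩ : T)) fun _ _ h =>
      h.trans (Nat.le_add_right r R)
  rw [hW.wallDist_comm] at h1
  have h4 : (wallSep H (x : M) s).ncard ≤ r + R := h1.trans (Nat.le_add_left R r)
  have h5 : (wallSep H (t : M) y).ncard ≤ r + R := h2.trans (Nat.le_add_left R r)
  exact (h3.tail h5).head h4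

end MedianWalls

/-! ### The complex dual to the generated subalgebra. -/

namespace CubeComplex

variable {V : Type*} {K : CubeComplex V}

/-- A coarsely connected coarsely median-closed family of vertices is quasiisometric to a
finite-dimensional CAT(0) cube complex. -/
lemma exists_quasiisometry_of_vertices {X : Type*} [Nonempty X] {d : X → X → ℝ}
    (hK : K.IsCATZero) (hfin : K.FiniteDimensional) {m : V → V → V → V}
    (hW : MedianWalls K.halfspaces m) (s : X → V) {L A : ℝ} (hL : 1 ≤ L) (hA : 0 ≤ A)
    (hs : ∀ x y, L⁻¹ * d x y - A ≤ K.graph.dist (s x) (s y) ∧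
      K.graph.dist (s x) (s y) ≤ L * d x y + A) (hd : ∀ x y, 0 ≤ d x y)
    {D : ℕ} (hD : ∀ x y z, ∃ t, K.graph.dist (s t) (m (s x) (s y) (s z)) ≤ D) {r : ℕ}
    (hr : ∀ x y, Relation.ReflTransGen (fun a b => K.graph.dist (s a) (s b) ≤ r) x y) :
    ∃ (T : Set V) (C' : CubeComplex T), C'.IsCATZero ∧ C'.FiniteDimensional ∧
      ∃ Ψ : X → C'.Realization, IsQuasiisometry d C'.euclideanDist Ψ := by
  obtain ⟨N, hN⟩ := hfin
  have hNb := crossingBound hK hN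
  have hdist : ∀ x y, (wallSep K.halfspaces x y).ncard = K.graph.dist x y :=
    fun x y => (wallSep_halfspaces hK x y).2
  have hTc : ∀ a ∈ MedianWalls.medianSpan m (range s), ∀ b ∈ MedianWalls.medianSpan m (range s),
      ∀ c ∈ MedianWalls.medianSpan m (range s), m a b c ∈ MedianWalls.medianSpan m (range s) :=
    fun a ha b hb c hc => hW.median_mem_medianSpan ha hb hc
  have hST : range s ⊆ MedianWalls.medianSpan m (range s) := MedianWalls.subset_medianSpan _
  -- The bound is for `2 * N + 1` rounds, which exhaust the subalgebra; so all of it lies within `R`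
  -- of the image of `s`.
  obtain ⟨R, hR⟩ := hW.exists_near_of_mem_medianIter (S := range s) (D := D) (by
    rintro _ ⟨x, rfl⟩ _ ⟨y, rfl⟩ _ ⟨z, rfl⟩
    obtain ⟨t, ht⟩ := hD x y z
    exact ⟨_, ⟨t, rfl⟩, by rwa [hdist]⟩) (2 * N + 1)
  rw [← hW.medianSpan_eq_medianIter hNb] at hR
  generalize MedianWalls.medianSpan m (range s) = T at hTc hST hR
  have hW' := hW.trace (MedianWalls.restrict m T hTc) (fun _ _ _ => rfl)
  have hNb' := MedianWalls.crossingBound_trace hNb T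
  have hjump : ∀ x y : range s, Relation.ReflTransGen
      (fun a b : range s => (wallSep K.halfspaces (a : V) b).ncard ≤ r) x y := by
    rintro ⟨_, x, rfl⟩ ⟨_, y, rfl⟩
    exact (hr x y).lift (fun x => (⟨s x, x, rfl⟩ : range s)) fun a b h => by
      simpa only [hdist] using h
  have hcmp := hW.wallDist_le_trace (hW.reflTransGen_of_near hST hjump hR)
  have hle := hW.wallDist_trace_le T
  obtain ⟨x₀⟩ := ‹Nonempty X›
  have : Nonempty T := ⟨⟨s x₀, hST ⟨x₀, rfl⟩⟩⟩
  have hC := hW'.isCATZero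
  have hCf := hW'.finiteDimensional hNb'
  obtain ⟨N', hN'⟩ := hCf
  have hE := isCubeLength_euclidean hN'
  have hcon := hC.1.1
  have hdle : ∀ x y : T, (hW'.wallComplex.graph.dist x y : ℝ) ≤ K.graph.dist (x : V) y :=
    fun x y => by
      rw [hW'.dist_eq, SimpleGraph.dist_comm, ← hdist]
      exact_mod_cast hle y x
  have hdge : ∀ x y : T, (K.graph.dist (x : V) y : ℝ) ≤
      (r + R + 1) * hW'.wallComplex.graph.dist x y := fun x y => by
    rw [hW'.dist_eq, SimpleGraph.dist_comm, ← hdist]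
    have h := hcmp y x
    -- The factor is enlarged by 1 so that it is at least 1 even if all jumps are trivial.
    have h' : (wallSep K.halfspaces (y : V) x).ncard ≤
        (r + R + 1) * (wallSep (MedianWalls.traceWalls K.halfspaces T) y x).ncard :=
      h.trans (Nat.mul_le_mul_right _ (Nat.le_succ _))
    exact_mod_cast h'
  have hEle : ∀ x y : T, hW'.wallComplex.euclideanDist (hW'.wallComplex.vertexPoint x)
      (hW'.wallComplex.vertexPoint y) ≤ hW'.wallComplex.graph.dist x y :=
    fun x y => hE.lengthDist_vertex_le hcon x y
  have hEge : ∀ x y : T, (hW'.wallComplex.graph.dist x y : ℝ) ≤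
      (N' + 1) * hW'.wallComplex.euclideanDist (hW'.wallComplex.vertexPoint x)
      (hW'.wallComplex.vertexPoint y) := fun x y => hE.dist_le_lengthDist hcon x y
  refine ⟨T, hW'.wallComplex, hC, ⟨N', hN'⟩,
    fun x => hW'.wallComplex.vertexPoint ⟨s x, hST ⟨x, rfl⟩⟩, ?_, R + N', ?_⟩
  · have hn : (1 : ℝ) ≤ N' + 1 := by linarith [Nat.cast_nonneg (α := ℝ) N']
    have hq : (1 : ℝ) ≤ r + R + 1 := by
      linarith [Nat.cast_nonneg (α := ℝ) r, Nat.cast_nonneg (α := ℝ) R]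
    have hnq : (1 : ℝ) ≤ (N' + 1) * (r + R + 1) := one_le_mul_of_one_le_of_one_le hn hq
    refine ⟨(N' + 1) * (r + R + 1) * L, A, one_le_mul_of_one_le_of_one_le hnq hL, hA, fun x y => ?_⟩
    obtain ⟨h1, h2⟩ := hs x y
    have h3 := hdle ⟨s x, hST ⟨x, rfl⟩⟩ ⟨s y, hST ⟨y, rfl⟩⟩
    have h4 := hdge ⟨s x, hST ⟨x, rfl⟩⟩ ⟨s y, hST ⟨y, rfl⟩⟩
    have h5 := hEle ⟨s x, hST ⟨x, rfl⟩⟩ ⟨s y, hST ⟨y, rfl⟩⟩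
    have h6 := hEge ⟨s x, hST ⟨x, rfl⟩⟩ ⟨s y, hST ⟨y, rfl⟩⟩
    constructor
    · have h7 := mul_le_mul_of_nonneg_left h6 (zero_le_one.trans hq)
      rw [mul_inv, mul_assoc, sub_le_iff_le_add, inv_mul_le_iff₀ (by positivity)]
      have h8 := mul_le_mul_of_nonneg_right hnq hA
      linarith
    · have h7 : L * d x y ≤ (N' + 1) * (r + R + 1) * L * d x y := by
        rw [mul_assoc ((N' + 1 : ℝ) * (r + R + 1)) L]
        exact le_mul_of_one_le_left (mul_nonneg (zero_le_one.trans hL) (hd x y)) hnq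
      linarith
  · intro y
    obtain ⟨w, -, hw⟩ := exists_vertex_near hN' y
    obtain ⟨_, ⟨x, rfl⟩, hx⟩ := hR w w.2
    refine ⟨x, (hE.lengthDist_triangle hcon _ (hW'.wallComplex.vertexPoint w) _).trans ?_⟩
    rw [hE.lengthDist_comm (hW'.wallComplex.vertexPoint w)]
    refine add_le_add ((hEle _ _).trans ((hdle _ _).trans ?_)) hw
    rw [hdist] at hx
    exact_mod_cast hx

end CubeComplex

/-! ### From the realization to the vertices. -/

/-- Even the empty set is approximated by a median graph, which has a vertex; its image is a point
of `X`. The dual complex has to be nonempty to be connected. -/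
lemma nonempty_of_isCoarseMedian {X : Type*} [MetricSpace X] {m : X → X → X → X}
    (hm : IsCoarseMedian m) : Nonempty X := by
  obtain ⟨h, -, -, h3⟩ := hm
  obtain ⟨V, -, G, -, g, hG, -⟩ := h3 0 ∅ (by simp)
  obtain ⟨v⟩ := hG.1.nonempty
  exact ⟨g v⟩

theorem mainTheorem5 {X : Type u} [MetricSpace X]
    (hX : IsCoarselyConnected X)
    (m : X → X → X → X) (hm : IsCoarseMedian m)
    {V : Type v} (C : CubeComplex V) (hC : C.IsCATZero) (hCfin : C.FiniteDimensional)
    (Φ : X → C.Realization)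
    (hΦ : IsQuasiisometricEmbedding (fun x y : X => dist x y) C.euclideanDist Φ)
    (hΦm : C.IsQuasimedian m Φ) :
    ∃ (W : Type v) (C' : CubeComplex W), C'.IsCATZero ∧ C'.FiniteDimensional ∧
      ∃ Ψ : X → C'.Realization,
        IsQuasiisometry (fun x y : X => dist x y) C'.euclideanDist Ψ := by
  have hXne := nonempty_of_isCoarseMedian hm
  obtain ⟨N, hN⟩ := hCfin
  obtain ⟨L, A, hL, hA, hLA⟩ := hΦ
  obtain ⟨D, hD⟩ := hΦm
  obtain ⟨r, hr, hchain⟩ := hX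
  obtain ⟨μ, hW⟩ := CubeComplex.exists_medianWalls hC
  have hdist : ∀ x y, (wallSep C.halfspaces x y).ncard = C.graph.dist x y :=
    fun x y => (CubeComplex.wallSep_halfspaces hC x y).2
  have hcon := hC.1.1
  have hE := CubeComplex.isCubeLength_euclidean hN
  have h1 := CubeComplex.isCubeLength_l1 hN
  have Etri : ∀ p q r, C.euclideanDist p r ≤ C.euclideanDist p q + C.euclideanDist q r :=
    hE.lengthDist_triangle hcon
  have Ecomm : ∀ p q, C.euclideanDist p q = C.euclideanDist q p := hE.lengthDist_comm
  have Ele : ∀ u v, C.euclideanDist (C.vertexPoint u) (C.vertexPoint v) ≤ C.graph.dist u v :=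
    hE.lengthDist_vertex_le hcon
  have Ege : ∀ u v, (C.graph.dist u v : ℝ) ≤
      (N + 1) * C.euclideanDist (C.vertexPoint u) (C.vertexPoint v) := hE.dist_le_lengthDist hcon
  have ltri : ∀ p q r, C.l1Dist p r ≤ C.l1Dist p q + C.l1Dist q r := h1.lengthDist_triangle hcon
  have lcomm : ∀ p q, C.l1Dist p q = C.l1Dist q p := h1.lengthDist_comm
  have lle : ∀ u v, C.l1Dist (C.vertexPoint u) (C.vertexPoint v) ≤ C.graph.dist u v :=
    h1.lengthDist_vertex_le hcon
  have lge : ∀ u v, (C.graph.dist u v : ℝ) ≤ C.l1Dist (C.vertexPoint u) (C.vertexPoint v) := by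
    intro u v
    have := h1.dist_le_lengthDist hcon u v
    rwa [one_mul] at this
  have hN0 : (0 : ℝ) ≤ N := Nat.cast_nonneg N
  -- One vertex serves both metrics: medians are defined by the `ℓ¹` metric, the quasiisometry and
  -- the quasimedian error by the Euclidean one.
  choose s hs1 hsE using fun x => CubeComplex.exists_vertex_near hN (Φ x)
  have hup : ∀ x y, (C.graph.dist (s x) (s y) : ℝ) ≤
      (N + 1) * (C.euclideanDist (Φ x) (Φ y) + 2 * N) := fun x y => by
    refine (Ege _ _).trans (mul_le_mul_of_nonneg_left ?_ (by positivity))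
    have e1 := Etri (C.vertexPoint (s x)) (Φ x) (C.vertexPoint (s y))
    have e2 := Etri (Φ x) (Φ y) (C.vertexPoint (s y))
    have e3 := hsE x
    rw [Ecomm] at e3
    linarith [hsE y]
  have hlow : ∀ x y, C.euclideanDist (Φ x) (Φ y) - 2 * N ≤ C.graph.dist (s x) (s y) := fun x y => by
    have e1 := Etri (Φ x) (C.vertexPoint (s x)) (Φ y)
    have e2 := Etri (C.vertexPoint (s x)) (C.vertexPoint (s y)) (Φ y)
    have e3 := hsE y
    rw [Ecomm] at e3
    linarith [hsE x, Ele (s x) (s y)]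
  have hmed : ∀ x y z, (C.graph.dist (s (m x y z)) (μ (s x) (s y) (s z)) : ℝ) ≤
      (N + 1) * (D + 2 * N) + 2 * (6 * N : ℕ) := by
    intro x y z
    obtain ⟨p, ⟨hab, hbc, hac⟩, hpD⟩ := hD x y z
    obtain ⟨w, hw1, hwE⟩ := CubeComplex.exists_vertex_near hN p
    -- Replacing `Φ a`, `Φ b` and `p` by vertices costs `2 * N` in each of the three distances. So
    -- `w` is an approximate median with error `6 * N`, within `2 * (6 * N)` of the true one.
    have near : ∀ a b, C.l1Dist (Φ a) (Φ b) = C.l1Dist (Φ a) p + C.l1Dist p (Φ b) →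
        C.graph.dist (s a) w + C.graph.dist w (s b) ≤ C.graph.dist (s a) (s b) + 6 * N := by
      intro a b hab
      have e1 := ltri (C.vertexPoint (s a)) (Φ a) (C.vertexPoint w)
      have e2 := ltri (Φ a) p (C.vertexPoint w)
      have e3 := ltri (C.vertexPoint w) p (C.vertexPoint (s b))
      have e4 := ltri p (Φ b) (C.vertexPoint (s b))
      have e5 := ltri (Φ a) (C.vertexPoint (s a)) (Φ b)
      have e6 := ltri (C.vertexPoint (s a)) (C.vertexPoint (s b)) (Φ b)
      rw [lcomm _ (Φ a)] at e1
      rw [lcomm _ p] at e3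
      rw [lcomm (C.vertexPoint (s b)) (Φ b)] at e6
      have : (C.graph.dist (s a) w : ℝ) + C.graph.dist w (s b) ≤
          C.graph.dist (s a) (s b) + 6 * N := by
        linarith [lge (s a) w, lge w (s b), lle (s a) (s b), hs1 a, hs1 b]
      exact_mod_cast this
    have hpm : (C.graph.dist w (μ (s x) (s y) (s z)) : ℝ) ≤ 2 * (6 * N : ℕ) := by
      have := hW.wallDist_median_le_of_approx (a := s x) (b := s y) (c := s z) (p := w) (e := 6 * N)
        (by simpa only [hdist] using near x y hab) (by simpa only [hdist] using near y z hbc)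
        (by simpa only [hdist] using near x z hac)
      rw [hdist] at this
      exact_mod_cast this
    have hsw : (C.graph.dist (s (m x y z)) w : ℝ) ≤ (N + 1) * (D + 2 * N) := by
      refine (Ege _ _).trans (mul_le_mul_of_nonneg_left ?_ (by positivity))
      have e1 := Etri (C.vertexPoint (s (m x y z))) (Φ (m x y z)) (C.vertexPoint w)
      have e2 := Etri (Φ (m x y z)) p (C.vertexPoint w)
      have e3 := hsE (m x y z)
      rw [Ecomm] at e3
      linarith
    have := hcon.dist_triangle (u := s (m x y z)) (v := w) (w := μ (s x) (s y) (s z))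
    have : (C.graph.dist (s (m x y z)) (μ (s x) (s y) (s z)) : ℝ) ≤
        C.graph.dist (s (m x y z)) w + C.graph.dist w (μ (s x) (s y) (s z)) := by
      exact_mod_cast this
    linarith
  obtain ⟨D', hD'⟩ := exists_nat_ge ((N + 1) * (D + 2 * N) + 2 * (6 * N : ℕ) : ℝ)
  obtain ⟨r', hr'⟩ := exists_nat_ge ((N + 1) * (L * r + A + 2 * N) : ℝ)
  have hN1 : (1 : ℝ) ≤ N + 1 := by linarith
  have hqi : ∀ x y, ((N + 1) * L)⁻¹ * dist x y - (N + 1) * (A + 2 * N) ≤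
      C.graph.dist (s x) (s y) ∧
      (C.graph.dist (s x) (s y) : ℝ) ≤ (N + 1) * L * dist x y + (N + 1) * (A + 2 * N) := by
    intro x y
    obtain ⟨e1, e2⟩ := hLA x y
    constructor
    · have e3 := hlow x y
      have e4 : ((N + 1 : ℝ) * L)⁻¹ * dist x y ≤ L⁻¹ * dist x y := by
        refine mul_le_mul_of_nonneg_right ?_ dist_nonneg
        exact inv_anti₀ (by linarith) (le_mul_of_one_le_left (by linarith) hN1)
      have e5 : A + 2 * N ≤ (N + 1) * (A + 2 * N) :=
        le_mul_of_one_le_left (by positivity) hN1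
      linarith
    · refine (hup x y).trans ?_
      have := mul_le_mul_of_nonneg_left e2 (by linarith : (0 : ℝ) ≤ N + 1)
      linarith
  have hjump : ∀ a b, dist a b ≤ r → C.graph.dist (s a) (s b) ≤ r' := by
    intro a b hab
    have e1 : (C.graph.dist (s a) (s b) : ℝ) ≤ r' := by
      refine (hup a b).trans (le_trans ?_ hr')
      refine mul_le_mul_of_nonneg_left ?_ (by positivity)
      have := (hLA a b).2
      have := mul_le_mul_of_nonneg_left hab (by linarith : (0 : ℝ) ≤ L)
      linarith
    exact_mod_cast e1
  obtain ⟨T, C', h⟩ := CubeComplex.exists_quasiisometry_of_vertices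
    (d := fun x y : X => dist x y) hC ⟨N, hN⟩ hW s (one_le_mul_of_one_le_of_one_le hN1 hL)
    (by positivity) hqi (fun x y => dist_nonneg) (D := D')
    (fun x y z => ⟨m x y z, by exact_mod_cast (hmed x y z).trans hD'⟩) (r := r')
    (fun x y => Relation.ReflTransGen.mono hjump _ _ (hchain x y))
  exact ⟨T, C', h⟩
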